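/- Let $p$ be a prime, let $x \ge 1$, and put $d_x = (p-1)p^{x-1}$. Let $K = \mathbb{Z}_p^{p-1}$ and let $M$ be the automorphism of $K$ given by the companion matrix of $y^{p-1} + y^{p-2} + \dots + y + 1$. Let $T = \bigoplus_{j=1}^{p^{x-1}} K$, which has rank $d_x$ over $\mathbb{Z}_p$, and let $\theta$ be the automorphism of $T$ given by $$\theta(k_1, k_2, \dots, k_{p^{x-1}}) = (M k_{p^{x-1}}, k_1, \dots, k_{p^{x-1}-1}).$$ Let $P = \langle \theta \rangle \cong C_{p^x}$ and let $R = T \rtimes P$, the uniserial $p$-adic space group with translation group $T$ and point group $P$. Then for every $i \ge 0$ there is exactly one subgroup $N_i \le T$ with $\theta(N_i) = N_i$ and $|T : N_i| = p^{i+d_x}$. Put $R_i = R/N_i$. For every $i \ge 0$ there is an isomorphism $$H^*(R_i; \mathbb{F}_p) \cong H^*(R_0; \mathbb{F}_p)$$ of graded $\mathbb{F}_p$-modules, where $\mathbb{F}_p$ has the trivial action. -/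

import Mathlib

open scoped Matrix

noncomputable section

namespace PAdicSpaceGroup

/-- The companion matrix of `y ^ (p - 1) + y ^ (p - 2) + ⋯ + y + 1` over `ℤ_[p]`: it sends
`e_j` to `e_{j+1}` for `j + 1 < p - 1`, and the last basis vector to `-(e_0 + ⋯ + e_{p-2})`. -/
def companion (p : ℕ) [Fact p.Prime] : Matrix (Fin (p - 1)) (Fin (p - 1)) ℤ_[p] :=
  fun i j => if (j : ℕ) + 1 = p - 1 then -1 else if (i : ℕ) = j + 1 then 1 else 0

/-- The inverse of `companion p`. -/
def companionInv (p : ℕ) [Fact p.Prime] : Matrix (Fin (p - 1)) (Fin (p - 1)) ℤ_[p] :=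
  fun i j => if (j : ℕ) = 0 then -1 else if (i : ℕ) + 1 = j then 1 else 0

theorem companion_mul_companionInv (p : ℕ) [Fact p.Prime] :
    companion p * companionInv p = 1 := by
  ext ⟨i, hi⟩ ⟨k, hk⟩
  rw [Matrix.mul_apply]
  simp only [companion, companionInv, Matrix.one_apply, Fin.mk.injEq]
  by_cases h0 : k = 0
  · by_cases hi0 : i = 0
    · rw [Finset.sum_eq_single (⟨p - 2, by omega⟩ : Fin (p - 1))]
      · grind
      · rintro ⟨j, hj⟩ - hne
        simp only [ne_eq, Fin.mk.injEq] at hne ⊢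
        grind
      · simp
    · rw [Finset.sum_eq_add (⟨i - 1, by omega⟩ : Fin (p - 1)) ⟨p - 2, by omega⟩
        (by simp only [ne_eq, Fin.mk.injEq]; omega)]
      · grind
      · rintro ⟨j, hj⟩ - hne
        simp only [ne_eq, Fin.mk.injEq] at hne ⊢
        grind
      · simp
      · simp
  · rw [Finset.sum_eq_single (⟨k - 1, by omega⟩ : Fin (p - 1))]
    · grind
    · rintro ⟨j, hj⟩ - hne
      simp only [ne_eq, Fin.mk.injEq] at hne ⊢
      grind
    · simp

theorem companionInv_mul_companion (p : ℕ) [Fact p.Prime] :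
    companionInv p * companion p = 1 :=
  mul_eq_one_comm.mp (companion_mul_companionInv p)

/-- The lattice `K = ℤ_p ^ (p - 1)`. -/
abbrev K (p : ℕ) [Fact p.Prime] : Type := Fin (p - 1) → ℤ_[p]

/-- The automorphism of `K` given by the companion matrix. -/
def companionAut (p : ℕ) [Fact p.Prime] : K p ≃+ K p where
  toFun v := companion p *ᵥ v
  invFun v := companionInv p *ᵥ v
  left_inv v := by simp [companionInv_mul_companion]
  right_inv v := by simp [companion_mul_companionInv]
  map_add' v w := Matrix.mulVec_add _ v w

/-- The translation group `T`, the direct sum of `p ^ (x - 1)` copies of `K`. -/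
abbrev T (p x : ℕ) [Fact p.Prime] : Type := Fin (p ^ (x - 1)) → K p

/-- The rank `d_x = (p - 1) p ^ (x - 1)` of the translation group. -/
def dim (p x : ℕ) : ℕ := (p - 1) * p ^ (x - 1)

/-- The automorphism `θ` of `T`, which moves the copies of `K` cyclically and applies the companion
matrix when it passes from the last copy to the first one:
`θ (k_0, …, k_{q-1}) = (M k_{q-1}, k_0, …, k_{q-2})` with `q = p ^ (x - 1)`.
The indices `j - 1` and `j + 1` in `Fin q` are taken modulo `q`. -/
def theta (p x : ℕ) [Fact p.Prime] : T p x ≃+ T p x where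
  toFun t j := if j = 0 then companionAut p (t (j - 1)) else t (j - 1)
  invFun t j := if j + 1 = 0 then (companionAut p).symm (t (j + 1)) else t (j + 1)
  left_inv t := by
    funext j
    by_cases h : j + 1 = 0
    · simp only [h, if_true, AddEquiv.symm_apply_apply]
      rw [← h, add_sub_cancel_right]
    · simp [h]
  right_inv t := by
    funext j
    by_cases h : j = 0 <;> simp [h]
  map_add' s t := by
    funext j
    by_cases h : j = 0 <;> simp [h]

/-- `θ` as an automorphism of the translation group written multiplicatively. -/
def thetaMul (p x : ℕ) [Fact p.Prime] : MulAut (Multiplicative (T p x)) :=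
  AddEquiv.toMultiplicative (theta p x)

/-- The point group `P = ⟨θ⟩`, a cyclic group of order `p ^ x` when `1 ≤ x`. -/
abbrev P (p x : ℕ) [Fact p.Prime] : Subgroup (MulAut (Multiplicative (T p x))) :=
  Subgroup.zpowers (thetaMul p x)

/-- The space group `R = T ⋊ P`. -/
abbrev R (p x : ℕ) [Fact p.Prime] : Type :=
  Multiplicative (T p x) ⋊[(P p x).subtype] P p x

/-- The `θ`-invariant subgroups of `T`. -/
def InvariantSubgroup (p x : ℕ) [Fact p.Prime] : Type :=
  {N : AddSubgroup (T p x) // N.map (theta p x).toAddMonoidHom = N}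

namespace InvariantSubgroup

variable {p x : ℕ} [Fact p.Prime]

/-- An invariant subgroup of `T`, seen as a subgroup of `R`. -/
def inSpaceGroup (N : InvariantSubgroup p x) : Subgroup (R p x) :=
  (AddSubgroup.toSubgroup N.1).map SemidirectProduct.inl

instance normal_inSpaceGroup (N : InvariantSubgroup p x) : N.inSpaceGroup.Normal := by
  have hθ : ∀ t : T p x, t ∈ N.1 ↔ theta p x t ∈ N.1 := by
    intro t
    constructor
    · intro ht
      rw [← N.2]
      exact AddSubgroup.mem_map_of_mem _ ht
    · intro ht
      rw [← N.2] at ht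
      obtain ⟨s, hs, hst⟩ := ht
      rwa [← (theta p x).injective hst]
  let S : Subgroup (Multiplicative (T p x)) := AddSubgroup.toSubgroup N.1
  have hS : ∀ t : Multiplicative (T p x), t ∈ S ↔ thetaMul p x t ∈ S :=
    fun t => hθ (Multiplicative.toAdd t)
  have hP : ∀ g : P p x, ∀ t ∈ S, g.1 t ∈ S := by
    rintro ⟨g, k, rfl⟩
    induction k using Int.induction_on with
    | zero => intro t ht; simpa using ht
    | succ k ih =>
      intro t ht
      have h := ih (thetaMul p x t) ((hS t).1 ht)
      simpa [zpow_add_one] using h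
    | pred k ih =>
      intro t ht
      have h := ih ((thetaMul p x)⁻¹ t) ((hS _).2 (by simpa using ht))
      simpa [zpow_sub_one] using h
  constructor
  rintro _ ⟨n, hn, rfl⟩ g
  refine ⟨g.left * g.right.1 n * g.left⁻¹, ?_, ?_⟩
  · have : g.left * g.right.1 n * g.left⁻¹ = g.right.1 n := by
      rw [mul_comm, inv_mul_cancel_left]
    rw [this]
    exact hP g.right n hn
  · apply SemidirectProduct.ext <;> simp

/-- The quotient group `R / N`. -/
abbrev Quotient (N : InvariantSubgroup p x) : Type := R p x ⧸ N.inSpaceGroup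

end InvariantSubgroup

/-- The cohomology group `H^n(G; 𝔽_p)` with trivial coefficients. -/
abbrev H (p : ℕ) (G : Type) [Group G] (n : ℕ) : ModuleCat (ZMod p) :=
  groupCohomology (Rep.trivial (ZMod p) G (ZMod p)) n

end PAdicSpaceGroup

end

/-!
Put `ψ = θ ^ p ^ (x - 1)`. The finite index invariant subgroups of `T` are the `(θ - 1) ^ m T`, and
`(θ - 1) ^ (i + d) T = p (θ - 1) ^ i T`. Hence the subgroups in question are `N = p δ T`, where `δ`
divides a power of `p` in `ℤ[θ]`, and it suffices to show that the dimension of `H ^ n (R / N; 𝔽_p)`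
does not depend on `δ`.

Multiplication by `ψ - 1` embeds `R / N` in `U ⋊ P`, where `U = T / p δ (ψ - 1) T`. By Shapiro's
lemma, its cohomology is that of the `U ⋊ P`-module of functions on `U` which are constant on the
cosets of `(ψ - 1) T`. Let `V` be the dual of `T / p T`. Over the group ring of a dense lattice in
`T` we take the Koszul differential with the entries `h z - h ψ z`, where `z` is the first basis
vector, and twist it by a matrix factorization, so that its square is a combination of the elements
`h w - h ψ w`, where `w = p δ z`. These form a regular sequence which vanishes in `k[U]`. This gives
a coresolution of the coset functions by the modules coinduced from the graded pieces of
`Sym V ⊗ Λ V` with the action of `P`, which do not involve `δ`.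

The differentials of the coresolution vanish on the functions which are constant on `U`, while every
cohomology class of a coinduced module is represented by such functions. So the long exact sequences
of cohomology split into short ones, and the dimension of `H ^ n (R / N; 𝔽_p)` is the sum of the
dimensions of the `H ^ i (P; (Sym V ⊗ Λ V)_(n - i))`.
-/

noncomputable section

/-! ### Cohomology and short exact sequences -/

section GroupCohomology

open CategoryTheory Limits groupCohomology

universe u

theorem finite_groupCohomology {k G : Type u} [CommRing k] [IsNoetherianRing k] [Group G] [Finite G]
    (A : Rep.{u} k G) [Module.Finite k A] (n : ℕ) : Module.Finite k (groupCohomology A n) := by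
  have : Module.Finite k ((inhomogeneousCochains A).X n) :=
    inferInstanceAs (Module.Finite k ((Fin n → G) → A))
  have : Module.Finite k (cocycles A n) :=
    Module.Finite.of_injective (iCocycles A n).hom
      ((ModuleCat.mono_iff_injective (iCocycles A n)).1 inferInstance)
  exact Module.Finite.of_surjective (groupCohomology.π A n).hom
    ((ModuleCat.epi_iff_surjective (groupCohomology.π A n)).1
      (inferInstanceAs (Epi ((inhomogeneousCochains A).homologyπ n))))

theorem rep_exact_of_forall {k G : Type u} [CommRing k] [Group G] {A B C : Rep.{u} k G}
    (f : A ⟶ B) (g : B ⟶ C) (h : f ≫ g = 0) (hex : ∀ b : B, g.hom b = 0 → ∃ a, f.hom a = b) :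
    (ShortComplex.mk f g h).Exact := by
  refine (forget₂ (Rep k G) (ModuleCat k)).reflects_exact_of_faithful _ ?_
  rw [ShortComplex.moduleCat_exact_iff]
  exact hex

theorem shortExact_kernel_lift {𝒜 : Type*} [Category 𝒜] [Abelian 𝒜] {A B C D : 𝒜} {i : A ⟶ B}
    [Mono i] {f : B ⟶ C} {g : C ⟶ D} {hif : i ≫ f = 0} {hfg : f ≫ g = 0}
    (hf : (ShortComplex.mk i f hif).Exact) (hg : (ShortComplex.mk f g hfg).Exact) :
    (ShortComplex.mk i (kernel.lift g f hfg)
      (by rw [← cancel_mono (kernel.ι g)]; simpa using hif)).ShortExact := by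
  refine @ShortComplex.ShortExact.mk _ _ _ _ ?_ inferInstance
    ((ShortComplex.exact_iff_epi_kernel_lift _).1 hg)
  let ψ : ShortComplex.mk i (kernel.lift g f hfg)
      (by rw [← cancel_mono (kernel.ι g)]; simpa using hif) ⟶ ShortComplex.mk i f hif :=
    { τ₁ := 𝟙 _, τ₂ := 𝟙 _, τ₃ := kernel.ι g }
  have : Epi ψ.τ₁ := inferInstanceAs (Epi (𝟙 _))
  have : IsIso ψ.τ₂ := inferInstanceAs (IsIso (𝟙 _))
  have : Mono ψ.τ₃ := inferInstanceAs (Mono (kernel.ι g))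
  exact (ShortComplex.exact_iff_of_epi_of_isIso_of_mono ψ).2 hf

/-- A representation `B` has *cohomology from the kernel* of `f : B ⟶ C` if every
cohomology class of `B` comes from a representation that maps into `ker f`. The long exact
sequence of `0 ⟶ ker f ⟶ B ⟶ C ⟶ 0` then splits into short exact sequences. -/
def HasCohomologyFromKernel {k G : Type u} [CommRing k] [Group G] {B C : Rep.{u} k G}
    (f : B ⟶ C) : Prop :=
  ∃ (K : Rep.{u} k G) (κ : K ⟶ B), κ ≫ f = 0 ∧
    ∀ n, Function.Surjective (groupCohomology.map (MonoidHom.id G) κ n).hom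

namespace HasCohomologyFromKernel

variable {k G : Type u} [Field k] [Group G]

theorem of_comp_mono {B C D : Rep.{u} k G} {f : B ⟶ C} {g : C ⟶ D} [Mono g]
    (h : HasCohomologyFromKernel (f ≫ g)) : HasCohomologyFromKernel f := by
  obtain ⟨K, κ, hκ, hs⟩ := h
  exact ⟨K, κ, by rwa [← cancel_mono g, Category.assoc, zero_comp], hs⟩

variable {X : ShortComplex (Rep.{u} k G)} (hX : X.ShortExact) (hg : HasCohomologyFromKernel X.g)

include hX hg

theorem map_surjective (n : ℕ) :
    Function.Surjective (groupCohomology.map (MonoidHom.id G) X.f n).hom := by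
  obtain ⟨K, κ, hκ, hs⟩ := hg
  have := hX.mono_f
  intro y
  obtain ⟨z, rfl⟩ := hs n y
  refine ⟨(groupCohomology.map (MonoidHom.id G) (hX.exact.lift κ hκ) n).hom z, ?_⟩
  conv_rhs => rw [← hX.exact.lift_f κ hκ, map_id_comp]
  rfl

theorem finrank_zero :
    Module.finrank k (groupCohomology X.X₁ 0) = Module.finrank k (groupCohomology X.X₂ 0) := by
  have := hX.mono_f
  have hinj : Function.Injective (groupCohomology.map (MonoidHom.id G) X.f 0).hom :=
    (ModuleCat.mono_iff_injective _).1 inferInstance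
  exact (LinearEquiv.ofBijective _ ⟨hinj, hg.map_surjective hX 0⟩).finrank_eq

theorem δ_injective (n : ℕ) : Function.Injective (δ hX n (n + 1) rfl).hom := by
  refine (injective_iff_map_eq_zero _).2 fun z hz => ?_
  obtain ⟨y, rfl⟩ := (mapShortComplex₃_exact hX (i := n) rfl).moduleCat_range_eq_ker.ge hz
  obtain ⟨w, rfl⟩ := hg.map_surjective hX n y
  exact (mapShortComplex₂_exact hX n).moduleCat_range_eq_ker.le ⟨w, rfl⟩

theorem finrank_succ [Finite G] [Module.Finite k X.X₁] (n : ℕ) :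
    Module.finrank k (groupCohomology X.X₁ (n + 1)) =
      Module.finrank k (groupCohomology X.X₃ n) +
        Module.finrank k (groupCohomology X.X₂ (n + 1)) := by
  have := finite_groupCohomology X.X₁ (n + 1)
  have hker := (mapShortComplex₁_exact hX (i := n) rfl).moduleCat_range_eq_ker
  rw [← LinearMap.finrank_range_add_finrank_ker
      (groupCohomology.map (MonoidHom.id G) X.f (n + 1)).hom,
    LinearMap.range_eq_top.2 (hg.map_surjective hX (n + 1)), finrank_top, add_comm,
    ← LinearMap.finrank_range_of_inj (hg.δ_injective hX n)]
  exact congrArg (· + _)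
    (congrArg (fun S : Submodule k (groupCohomology X.X₁ (n + 1)) => Module.finrank k S) hker.symm)

end HasCohomologyFromKernel

/-- For a double sequence `h i m` of dimensions of `Hⁱ(G, Cₘ)`, the sum of `h i (m + n - i)` over
`i ≤ n`: the dimension in degree `n` of the total complex of the columns from `m` on. -/
def diagonalDim (h : ℕ → ℕ → ℕ) : ℕ → ℕ → ℕ
  | 0, m => h 0 m
  | n + 1, m => diagonalDim h n (m + 1) + h (n + 1) m

theorem finrank_groupCohomology_eq_diagonalDim {k G : Type u} [Field k] [Group G] [Finite G]
    (C : ℕ → Rep.{u} k G) [∀ m, Module.Finite k (C m)] (d : ∀ m, C m ⟶ C (m + 1))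
    (hd : ∀ m, d m ≫ d (m + 1) = 0) (hex : ∀ m, (ShortComplex.mk (d m) (d (m + 1)) (hd m)).Exact)
    (hker : ∀ m, HasCohomologyFromKernel (d m)) (n m : ℕ) (B : Rep.{u} k G) (i : B ⟶ C m) [Mono i]
    (hi : i ≫ d m = 0) (hB : (ShortComplex.mk i (d m) hi).Exact) :
    Module.finrank k (groupCohomology B n) =
      diagonalDim (fun n m => Module.finrank k (groupCohomology (C m) n)) n m := by
  have hker' (m : ℕ) : HasCohomologyFromKernel (kernel.lift (d (m + 1)) (d m) (hd m)) :=
    .of_comp_mono (g := kernel.ι (d (m + 1))) (by rw [kernel.lift_ι]; exact hker m)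
  induction n generalizing m B with
  | zero =>
    have hS := shortExact_kernel_lift hB (hex m)
    refine (HasCohomologyFromKernel.finrank_zero hS (hker' m)).trans ?_
    rw [diagonalDim]
  | succ n ih =>
    have hS := shortExact_kernel_lift hB (hex m)
    have : Module.Finite k B :=
      Module.Finite.of_injective i.hom.toLinearMap ((Rep.mono_iff_injective i).1 inferInstance)
    refine (@HasCohomologyFromKernel.finrank_succ _ _ _ _ _ hS (hker' m) _ ‹_› n).trans ?_
    rw [diagonalDim]
    congr 1
    exact ih (m + 1) _ (kernel.ι _) (kernel.condition _) (ShortComplex.exact_kernel _)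

end GroupCohomology

/-! ### Modules coinduced from the complement of a semidirect product -/

section Coinduction

open CategoryTheory SemidirectProduct

universe u

variable {k U P : Type u} [Group U] [Group P]

/-- The complement `P` of `U` in `U ⋊ P`, as a subgroup. -/
abbrev semidirectComplement (φ : P →* MulAut U) : Subgroup (U ⋊[φ] P) :=
  (inr : P →* U ⋊[φ] P).range

/-- The isomorphism of the complement of `U` in `U ⋊ P` with `P`. -/
def semidirectComplementEquiv (φ : P →* MulAut U) : semidirectComplement φ ≃* P :=
  (MonoidHom.ofInjective (f := (inr : P →* U ⋊[φ] P)) inr_injective).symm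

theorem semidirectComplementEquiv_apply (φ : P →* MulAut U) (s : semidirectComplement φ) :
    semidirectComplementEquiv φ s = s.1.right := by
  obtain ⟨_, g, rfl⟩ := s
  rw [semidirectComplementEquiv, MulEquiv.symm_apply_eq]
  rfl

theorem finite_semidirectProduct (φ : P →* MulAut U) [Finite U] [Finite P] :
    Finite (U ⋊[φ] P) :=
  Finite.of_equiv _ SemidirectProduct.equivProd.symm

/-- The convolution of a function `F : U → M` with a family of linear maps `M → N` indexed
by `U`. -/
def convolve {k U M N : Type*} [CommSemiring k] [Group U] [Fintype U] [AddCommMonoid M]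
    [AddCommMonoid N] [Module k M] [Module k N] (A : U → M →ₗ[k] N) (F : U → M) (u : U) : N :=
  ∑ v, A v (F (v⁻¹ * u))

variable [Field k] (φ : P →* MulAut U)

/-- A representation of `P`, seen as a representation of the complement of `U` in `U ⋊ P`. -/
abbrev resComplement (N : Rep.{u} k P) : Rep k (semidirectComplement φ) :=
  Rep.res (rightHom.comp (semidirectComplement φ).subtype) N

/-- The representation of `U ⋊ P` coinduced from a representation of `P`. -/
abbrev coindComplement (N : Rep.{u} k P) : Rep k (U ⋊[φ] P) :=
  Rep.coind (semidirectComplement φ).subtype (resComplement φ N)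

namespace coindComplement

theorem apply_inr_mul {N : Rep.{u} k P} (f : coindComplement φ N) (g : P) (y : U ⋊[φ] P) :
    f.1 (inr g * y) = N.ρ g (f.1 y) :=
  f.2 ⟨inr g, g, rfl⟩ y

/-- The inclusion of the inflation of `N` in the coinduced representation, as the functions that
are constant on `U`. -/
def constants (N : Rep.{u} k P) : Rep.res rightHom N ⟶ coindComplement φ N :=
  Rep.resCoindToHom (semidirectComplement φ).subtype (Rep.res rightHom N) (resComplement φ N) (𝟙 _)

theorem constants_apply (N : Rep.{u} k P) (v : N) (y : U ⋊[φ] P) :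
    ((constants φ N).hom v).1 y = N.ρ y.right v := rfl

/-- Evaluation at `1` of the coinduced representation, which is equivariant for `P` only. -/
def evalOne (N : Rep.{u} k P) : Rep.res inr (coindComplement φ N) ⟶ N :=
  Rep.ofHom ⟨LinearMap.proj 1 ∘ₗ Submodule.subtype _, fun g => by
    ext f
    change f.1 (1 * inr g) = N.ρ g (f.1 1)
    simpa using apply_inr_mul φ f g 1⟩

theorem finrank_groupCohomology (N : Rep.{u} k P) (n : ℕ) :
    Module.finrank k (groupCohomology (coindComplement φ N) n) =
      Module.finrank k (groupCohomology N n) :=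
  ((groupCohomology.coindIso (resComplement φ N) n).toLinearEquiv.trans
    (groupCohomology.mapIso (semidirectComplementEquiv φ) (LinearEquiv.refl k N) (fun g => by
      rw [semidirectComplementEquiv_apply]; rfl) n).toLinearEquiv).finrank_eq

theorem map_constants_comp_map_evalOne (N : Rep.{u} k P) (n : ℕ) :
    groupCohomology.map (rightHom : U ⋊[φ] P →* P) (constants φ N) n ≫
      groupCohomology.map (inr : P →* U ⋊[φ] P) (evalOne φ N) n = 𝟙 _ := by
  rw [← groupCohomology.map_comp, ← groupCohomology.map_id]
  refine groupCohomology.map_congr (by ext; simp) ?_ n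
  ext v
  change ((constants φ N).hom v).1 1 = v
  rw [constants_apply]
  simp

section Finite

variable [Finite U] [Finite P] (N : Rep.{u} k P) [Module.Finite k N]

instance moduleFinite : Module.Finite k (coindComplement φ N) :=
  have := finite_semidirectProduct φ
  inferInstanceAs (Module.Finite k (Representation.coindV _ _))

-- The map is split injective, and by Shapiro's lemma both sides have the same dimension.
theorem map_rightHom_constants_surjective (n : ℕ) : Function.Surjective
    (groupCohomology.map (rightHom : U ⋊[φ] P →* P) (constants φ N) n).hom := by
  have := finite_semidirectProduct φ
  have := finite_groupCohomology (coindComplement φ N) n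
  have := finite_groupCohomology N n
  have hinj : Function.Injective
      (groupCohomology.map (rightHom : U ⋊[φ] P →* P) (constants φ N) n).hom :=
    Function.LeftInverse.injective
      (g := (groupCohomology.map (inr : P →* U ⋊[φ] P) (evalOne φ N) n).hom) fun z =>
        congrArg (fun f : groupCohomology N n ⟶ _ => f.hom z)
          (map_constants_comp_map_evalOne φ N n)
  exact (LinearMap.injective_iff_surjective_of_finrank_eq_finrank
    (finrank_groupCohomology φ N n).symm).1 hinj

theorem map_id_constants_surjective (n : ℕ) : Function.Surjective
    (groupCohomology.map (A := Rep.res rightHom N) (MonoidHom.id (U ⋊[φ] P))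
      (constants φ N) n).hom := by
  have hfac : groupCohomology.map (rightHom : U ⋊[φ] P →* P) (constants φ N) n =
      groupCohomology.map (rightHom : U ⋊[φ] P →* P) (𝟙 (Rep.res rightHom N)) n ≫
        groupCohomology.map (A := Rep.res rightHom N) (MonoidHom.id (U ⋊[φ] P))
          (constants φ N) n := by
    rw [← groupCohomology.map_comp]
    exact groupCohomology.map_congr rfl rfl n
  have hsurj := map_rightHom_constants_surjective φ N n
  rw [hfac] at hsurj
  exact Function.Surjective.of_comp hsurj

end Finite

/-- An element of the coinduced representation is determined by its restriction to `U`, which is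
arbitrary. -/
def equivFun (N : Rep.{u} k P) : coindComplement φ N ≃ₗ[k] (U → N) where
  toFun f u := f.1 (inl u)
  map_add' _ _ := rfl
  map_smul' _ _ := rfl
  invFun F := ⟨fun y => N.ρ y.right (F (φ y.right⁻¹ y.left)), by
    rintro ⟨_, g, rfl⟩ y
    change N.ρ (inr g * y).right (F (φ (inr g * y).right⁻¹ (inr g * y).left)) =
      N.ρ g (N.ρ y.right (F (φ y.right⁻¹ y.left)))
    simp⟩
  left_inv f := by
    refine Subtype.ext (funext fun y => ?_)
    have hy : y = inr y.right * inl (φ y.right⁻¹ y.left) := by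
      apply SemidirectProduct.ext <;> simp
    conv_rhs => rw [hy, apply_inr_mul]
  right_inv F := by
    funext u
    change N.ρ 1 (F (φ (1 : P)⁻¹ u)) = F u
    simp

theorem inl_inv_mul_inr_mul (u : U) (g : P) (y : U ⋊[φ] P) :
    (inl u)⁻¹ * (inr g * y) = inr g * ((inl (φ g⁻¹ u))⁻¹ * y) := by
  apply SemidirectProduct.ext <;> simp

variable [Fintype U] {M N : Rep.{u} k P} (A : U → M →ₗ[k] N)
  (hA : ∀ g u, N.ρ g ∘ₗ A u = A (φ g u) ∘ₗ M.ρ g)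

include hA in
theorem sum_apply_inr_mul (f : coindComplement φ M) (g : P) (y : U ⋊[φ] P) :
    ∑ u, A u (f.1 ((inl u)⁻¹ * (inr g * y))) = N.ρ g (∑ u, A u (f.1 ((inl u)⁻¹ * y))) := by
  rw [map_sum, ← Equiv.sum_comp (φ g).toEquiv]
  refine Finset.sum_congr rfl fun u _ => ?_
  have hu : N.ρ g (A u (f.1 ((inl u)⁻¹ * y))) = A (φ g u) (M.ρ g (f.1 ((inl u)⁻¹ * y))) :=
    LinearMap.congr_fun (hA g u) _
  rw [hu, ← apply_inr_mul, inl_inv_mul_inr_mul]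
  simp

/-- Convolution with an equivariant family of linear maps, as a morphism of coinduced
representations. -/
def convolution : coindComplement φ M ⟶ coindComplement φ N :=
  Rep.ofHom
    { toFun f := ⟨fun y => ∑ u, A u (f.1 ((inl u)⁻¹ * y)), by
        rintro ⟨_, g, rfl⟩ y
        exact sum_apply_inr_mul φ A hA f g y⟩
      map_add' f f' := by
        ext y
        change ∑ u, A u (f.1 _ + f'.1 _) = ∑ u, A u (f.1 _) + ∑ u, A u (f'.1 _)
        simp only [map_add, Finset.sum_add_distrib]
      map_smul' c f := by
        ext y
        change ∑ u, A u (c • f.1 _) = c • ∑ u, A u (f.1 _)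
        simp only [map_smul, Finset.smul_sum]
      isIntertwining' g := by
        ext f y
        change ∑ u, A u (f.1 ((inl u)⁻¹ * y * g)) = ∑ u, A u (f.1 ((inl u)⁻¹ * (y * g)))
        simp only [mul_assoc] }

theorem convolution_apply (f : coindComplement φ M) (y : U ⋊[φ] P) :
    ((convolution φ A hA).hom f).1 y = ∑ u, A u (f.1 ((inl u)⁻¹ * y)) := rfl

theorem equivFun_convolution (f : coindComplement φ M) :
    equivFun φ N ((convolution φ A hA).hom f) = convolve A (equivFun φ M f) := by
  funext u
  refine (convolution_apply φ A hA f (inl u)).trans (Finset.sum_congr rfl fun v _ => ?_)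
  change A v (f.1 ((inl v)⁻¹ * inl u)) = A v (f.1 (inl (v⁻¹ * u)))
  rw [map_mul, map_inv]

theorem convolution_eq_zero_iff (f : coindComplement φ M) :
    (convolution φ A hA).hom f = 0 ↔ convolve A (equivFun φ M f) = 0 := by
  rw [← equivFun_convolution φ A hA, LinearEquiv.map_eq_zero_iff]

theorem constants_comp_convolution (h0 : ∑ u, A u = 0) :
    constants φ M ≫ convolution φ A hA = 0 := by
  refine Rep.hom_ext (DFunLike.ext _ _ fun v => Subtype.ext (funext fun y => ?_))
  change ∑ u, A u (M.ρ ((inl u)⁻¹ * y).right v) = 0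
  simpa using LinearMap.congr_fun h0 (M.ρ y.right v)

end coindComplement

/-- A sequence of representations `N m` of `P` and equivariant families `U → N m → N (m + 1)` such
that the convolutions with these families form an exact sequence. The families have sum zero, which
makes the convolutions vanish on constant functions; this is what makes the cohomology of the
complex of coinduced representations split. -/
structure ConvolutionCoresolution [Fintype U] where
  N : ℕ → Rep.{u} k P
  A (m : ℕ) : U → N m →ₗ[k] N (m + 1)
  finite (m : ℕ) : Module.Finite k (N m)
  equivariant (m : ℕ) (g : P) (u : U) : (N (m + 1)).ρ g ∘ₗ A m u = A m (φ g u) ∘ₗ (N m).ρ g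
  sum_eq_zero (m : ℕ) : ∑ u, A m u = 0
  convolve_convolve (m : ℕ) (F : U → N m) : convolve (A (m + 1)) (convolve (A m) F) = 0
  exact (m : ℕ) (F : U → N (m + 1)) :
    convolve (A (m + 1)) F = 0 → ∃ F', convolve (A m) F' = F

namespace ConvolutionCoresolution

open coindComplement

variable {φ} [Fintype U] (𝒞 : ConvolutionCoresolution (k := k) φ)

/-- The differential of the complex of coinduced representations. -/
def d (m : ℕ) : coindComplement φ (𝒞.N m) ⟶ coindComplement φ (𝒞.N (m + 1)) :=
  convolution φ (𝒞.A m) (𝒞.equivariant m)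

theorem d_eq_zero_iff (m : ℕ) (f : coindComplement φ (𝒞.N m)) :
    (𝒞.d m).hom f = 0 ↔ convolve (𝒞.A m) (equivFun φ _ f) = 0 :=
  convolution_eq_zero_iff φ _ _ f

theorem d_comp_d (m : ℕ) : 𝒞.d m ≫ 𝒞.d (m + 1) = 0 := by
  refine Rep.hom_ext (DFunLike.ext _ _ fun f => (𝒞.d_eq_zero_iff (m + 1) _).2 ?_)
  exact (congrArg _ (equivFun_convolution φ _ _ f)).trans (𝒞.convolve_convolve m _)

theorem exact_d (m : ℕ) : (ShortComplex.mk (𝒞.d m) (𝒞.d (m + 1)) (𝒞.d_comp_d m)).Exact := by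
  refine rep_exact_of_forall _ _ _ fun f hf => ?_
  obtain ⟨F, hF⟩ := 𝒞.exact m _ ((𝒞.d_eq_zero_iff _ f).1 hf)
  refine ⟨(equivFun φ _).symm F, (equivFun φ _).injective ?_⟩
  refine (equivFun_convolution φ _ _ _).trans ?_
  rw [LinearEquiv.apply_symm_apply, hF]

variable [Finite P]

theorem hasCohomologyFromKernel_d (m : ℕ) : HasCohomologyFromKernel (𝒞.d m) :=
  have := 𝒞.finite m
  ⟨_, constants φ (𝒞.N m), constants_comp_convolution φ _ _ (𝒞.sum_eq_zero m),
    map_id_constants_surjective φ (𝒞.N m)⟩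

theorem finrank_groupCohomology (B : Rep k (U ⋊[φ] P)) (i : B ⟶ coindComplement φ (𝒞.N 0))
    (hi : Function.Injective i.hom)
    (hB : ∀ f, (∃ b, i.hom b = f) ↔ convolve (𝒞.A 0) (equivFun φ _ f) = 0) (n : ℕ) :
    Module.finrank k (groupCohomology B n) =
      diagonalDim (fun n m => Module.finrank k (groupCohomology (𝒞.N m) n)) n 0 := by
  have := finite_semidirectProduct φ
  have := 𝒞.finite
  have hmono : Mono i := (Rep.mono_iff_injective i).2 hi
  have hi0 : i ≫ 𝒞.d 0 = 0 :=
    Rep.hom_ext (DFunLike.ext _ _ fun b => (𝒞.d_eq_zero_iff 0 _).2 ((hB _).1 ⟨b, rfl⟩))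
  rw [finrank_groupCohomology_eq_diagonalDim (fun m => coindComplement φ (𝒞.N m)) 𝒞.d
    𝒞.d_comp_d 𝒞.exact_d 𝒞.hasCohomologyFromKernel_d n 0 B i hi0
    (rep_exact_of_forall _ _ _ fun f hf => (hB f).2 ((𝒞.d_eq_zero_iff 0 f).1 hf))]
  simp only [coindComplement.finrank_groupCohomology]

end ConvolutionCoresolution

end Coinduction

/-! ### Matrix factorizations over a regular sequence -/

section MatrixFactorization

open Finsupp

/-- A family of elements which is a regular sequence in every order. -/
def IsRegularFamily {Q σ : Type*} [CommRing Q] (g : σ → Q) : Prop :=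
  ∀ (s : Finset σ) (i : σ), i ∉ s → ∀ q, g i * q ∈ Ideal.span (g '' s) → q ∈ Ideal.span (g '' s)

variable {Q M σ C : Type*} [CommRing Q] [AddCommGroup M] [Module Q M]

/-- The homogeneous part of degree `m` of a free module, for a grading `δ` of its basis. -/
def homogeneousSpan {J : Type*} (B : Module.Basis J Q M) (δ : J → ℕ) (m : ℕ) : Submodule Q M :=
  Submodule.span Q (B '' {j | δ j = m})

theorem mem_homogeneousSpan {J : Type*} {B : Module.Basis J Q M} {δ : J → ℕ} {m : ℕ} {w : M} :
    w ∈ homogeneousSpan B δ m ↔ ∀ j, B.repr w j ≠ 0 → δ j = m := by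
  rw [homogeneousSpan, Module.Basis.mem_span_image]
  simp [Set.subset_def]

/-- The degree on `Sym ⊗ C` for which the variables of the symmetric algebra have degree two. -/
def monomialDegree (deg : C → ℕ) (j : (σ →₀ ℕ) × C) : ℕ := 2 * j.1.degree + deg j.2

/-- Multiplication of a monomial by a variable. -/
def monomialShift (i : σ) (j : (σ →₀ ℕ) × C) : (σ →₀ ℕ) × C := (j.1 + single i 1, j.2)

theorem monomialDegree_monomialShift (deg : C → ℕ) (i : σ) (j : (σ →₀ ℕ) × C) :
    monomialDegree deg (monomialShift i j) = monomialDegree deg j + 2 := by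
  simp only [monomialDegree, monomialShift, map_add, degree_single]
  ring

theorem monomialShift_injective (i : σ) :
    Function.Injective (monomialShift i : (σ →₀ ℕ) × C → _) := by
  rintro ⟨a, c⟩ ⟨b, e⟩ h
  simpa [monomialShift] using h

theorem exists_monomialShift_eq {i : σ} {j : (σ →₀ ℕ) × C} (h : j.1 i ≠ 0) :
    ∃ j', monomialShift i j' = j :=
  ⟨(j.1 - single i 1, j.2), Prod.ext
    (tsub_add_cancel_of_le (single_le_iff.2 (Nat.one_le_iff_ne_zero.2 h))) rfl⟩

variable (B : Module.Basis ((σ →₀ ℕ) × C) Q M)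

/-- The elements of `M` whose coefficients at monomials in the variables of `t` are in `I`. -/
def coeffIn (I : Ideal Q) (t : Finset σ) : Submodule Q M where
  carrier := {w | ∀ j, j.1.support ⊆ t → B.repr w j ∈ I}
  add_mem' ha hb j hj := by simpa using I.add_mem (ha j hj) (hb j hj)
  zero_mem' j _ := by simp
  smul_mem' c w hw j hj := by simpa using I.mul_mem_left c (hw j hj)

variable {B}

theorem mem_coeffIn {I : Ideal Q} {t : Finset σ} {w : M} :
    w ∈ coeffIn B I t ↔ ∀ j, j.1.support ⊆ t → B.repr w j ∈ I := Iff.rfl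

theorem coeffIn_mono {I I' : Ideal Q} (hI : I ≤ I') {t t' : Finset σ} (ht : t' ⊆ t) :
    coeffIn B I t ≤ coeffIn B I' t' :=
  fun _ hw j hj => hI (hw j (hj.trans ht))

theorem smul_mem_coeffIn {I : Ideal Q} {q : Q} (hq : q ∈ I) (t : Finset σ) (w : M) :
    q • w ∈ coeffIn B I t := fun j _ => by
  simpa using I.mul_mem_right _ hq

theorem mem_coeffIn_of_smul_mem {I : Ideal Q} {t : Finset σ} {g : Q}
    (hg : ∀ q, g * q ∈ I → q ∈ I) {w : M} (h : g • w ∈ coeffIn B I t) : w ∈ coeffIn B I t :=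
  fun j hj => hg _ (by simpa using h j hj)

theorem exists_sub_smul_mem_coeffIn {I : Ideal Q} {t : Finset σ} {g : Q}
    {δ : (σ →₀ ℕ) × C → ℕ} {m : ℕ} {w : M} (hwm : w ∈ homogeneousSpan B δ m)
    (hw : w ∈ coeffIn B (I ⊔ Ideal.span {g}) t) :
    ∃ u ∈ homogeneousSpan B δ m, w - g • u ∈ coeffIn B I t := by
  have h (j) : ∃ q : Q, (B.repr w j = 0 → q = 0) ∧
      (j.1.support ⊆ t → B.repr w j - g * q ∈ I) := by
    by_cases h0 : B.repr w j = 0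
    · exact ⟨0, fun _ => rfl, fun _ => by simp [h0]⟩
    by_cases hj : j.1.support ⊆ t
    · obtain ⟨a, ha, b, hb, hab⟩ := Submodule.mem_sup.1 (hw j hj)
      obtain ⟨q, rfl⟩ := Ideal.mem_span_singleton'.1 hb
      refine ⟨q, fun h => (h0 h).elim, fun _ => ?_⟩
      rwa [← hab, mul_comm g q, add_sub_cancel_right]
    · exact ⟨0, fun _ => rfl, fun h => (hj h).elim⟩
  choose q hq0 hq using h
  let u : M := B.repr.symm (onFinset (B.repr w).support q fun j hj =>
    Finsupp.mem_support_iff.2 fun h => hj (hq0 j h))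
  have hu (j) : B.repr u j = q j := by simp [u]
  refine ⟨u, mem_homogeneousSpan.2 fun j hj => mem_homogeneousSpan.1 hwm j fun h => hj ?_,
    fun j hj => ?_⟩
  · rw [hu, hq0 j h]
  · simpa [hu] using hq j hj

section Variable

variable {X : σ → Module.End Q M} (hX : ∀ i j, X i (B j) = B (monomialShift i j))
include hX

theorem repr_variable (i : σ) (w : M) :
    B.repr (X i w) = mapDomain (monomialShift i) (B.repr w) := by
  have : B.repr.toLinearMap ∘ₗ X i =
      lmapDomain Q Q (monomialShift i) ∘ₗ B.repr.toLinearMap :=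
    B.ext fun j => by simp [hX]
  exact LinearMap.congr_fun this w

theorem repr_variable_monomialShift (i : σ) (w : M) (j) :
    B.repr (X i w) (monomialShift i j) = B.repr w j := by
  rw [repr_variable hX, mapDomain_apply (monomialShift_injective i)]

theorem repr_variable_of_eq_zero (i : σ) (w : M) (j) (h : j.1 i = 0) : B.repr (X i w) j = 0 := by
  rw [repr_variable hX, mapDomain_of_notMem_range]
  rintro ⟨j', rfl⟩
  simp [monomialShift] at h

theorem variable_mem_coeffIn (I : Ideal Q) {t : Finset σ} {i : σ} (hi : i ∉ t) (w : M) :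
    X i w ∈ coeffIn B I t := by
  intro j hj
  rw [repr_variable_of_eq_zero hX]
  · exact I.zero_mem
  · by_contra h
    exact hi (hj (Finsupp.mem_support_iff.2 h))

theorem mem_coeffIn_of_variable_mem {I : Ideal Q} {t : Finset σ} {i : σ} (hi : i ∈ t) {w : M}
    (h : X i w ∈ coeffIn B I t) : w ∈ coeffIn B I t := by
  classical
  intro j hj
  rw [← repr_variable_monomialShift hX i]
  refine h _ fun l hl => ?_
  rcases Finset.mem_union.1 (support_add hl) with h | h
  · exact hj h
  · rw [support_single _ one_ne_zero, Finset.mem_singleton] at h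
    exact h ▸ hi

theorem exists_sub_variable_mem_coeffIn [DecidableEq σ] {I : Ideal Q} {t : Finset σ} (i : σ)
    {deg : C → ℕ} {m : ℕ} {w : M} (hwm : w ∈ homogeneousSpan B (monomialDegree deg) (m + 2))
    (hw : w ∈ coeffIn B I t) :
    ∃ u ∈ homogeneousSpan B (monomialDegree deg) m, w - X i u ∈ coeffIn B I (insert i t) := by
  let u : M := B.repr.symm
    (comapDomain (monomialShift i) (B.repr w) (monomialShift_injective i).injOn)
  have hu (j) : B.repr u j = B.repr w (monomialShift i j) := by simp [u]
  refine ⟨u, mem_homogeneousSpan.2 fun j hj => ?_, fun j hj => ?_⟩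
  · have := mem_homogeneousSpan.1 hwm _ (hu j ▸ hj)
    rw [monomialDegree_monomialShift] at this
    exact Nat.add_right_cancel this
  rw [map_sub, Finsupp.sub_apply]
  by_cases hji : j.1 i = 0
  · rw [repr_variable_of_eq_zero hX _ _ _ hji, sub_zero]
    refine hw j fun l hl => (Finset.mem_insert.1 (hj hl)).resolve_left ?_
    rintro rfl
    exact Finsupp.mem_support_iff.1 hl hji
  · obtain ⟨j', rfl⟩ := exists_monomialShift_eq hji
    rw [repr_variable_monomialShift hX, hu, sub_self]
    exact I.zero_mem

theorem le_of_repr_apply_ne_zero {D : Module.End Q M} (hD : ∀ i, Commute D (X i)) (j j')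
    (h : B.repr (D (B j)) j' ≠ 0) : j.1 ≤ j'.1 := by
  obtain ⟨n, hn⟩ : ∃ n, j.1.degree = n := ⟨_, rfl⟩
  induction n generalizing j j' with
  | zero =>
    rw [degree_eq_zero_iff] at hn
    simp [hn]
  | succ n ih =>
    obtain ⟨i, hi⟩ : ∃ i, j.1 i ≠ 0 := by
      by_contra! h0
      rw [(Finsupp.ext h0 : j.1 = 0)] at hn
      simp at hn
    obtain ⟨j₁, rfl⟩ := exists_monomialShift_eq hi
    have hc : D (X i (B j₁)) = X i (D (B j₁)) := LinearMap.congr_fun (hD i).eq _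
    rw [← hX, hc] at h
    by_cases h0 : j'.1 i = 0
    · exact (h (repr_variable_of_eq_zero hX _ _ _ h0)).elim
    obtain ⟨j₂, rfl⟩ := exists_monomialShift_eq h0
    rw [repr_variable_monomialShift hX] at h
    simp only [monomialShift, map_add, degree_single] at hn
    exact add_le_add_left (ih j₁ j₂ h (by lia)) _

-- An operator which commutes with the variables does not lower the exponents of monomials.
theorem apply_mem_coeffIn {D : Module.End Q M} (hD : ∀ i, Commute D (X i)) {I : Ideal Q}
    {t : Finset σ} {w : M} (hw : w ∈ coeffIn B I t) : D w ∈ coeffIn B I t := by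
  intro j' hj'
  rw [← B.linearCombination_repr w, linearCombination_apply, Finsupp.sum, map_sum,
    map_sum, finsetSum_apply]
  refine I.sum_mem fun j _ => ?_
  rw [map_smul, map_smul, Finsupp.smul_apply, smul_eq_mul]
  by_cases h : B.repr (D (B j)) j' = 0
  · simp [h]
  · exact I.mul_mem_right _
      (hw j ((support_mono (le_of_repr_apply_ne_zero hX hD j j' h)).trans hj'))

end Variable

/-- An odd operator `D` on a free module `M` over the polynomial ring `Q[X i]`, with a basis graded
by `deg`, which is a matrix factorization of the linear polynomial `∑ g i X i`. The module `M` and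
the operators are described over `Q`, on the basis of multiples of basis elements by monomials. -/
structure IsMatrixFactorization [Fintype σ] (B : Module.Basis ((σ →₀ ℕ) × C) Q M) (deg : C → ℕ)
    (X : σ → Module.End Q M) (D : Module.End Q M) (g : σ → Q) : Prop where
  variable_basis : ∀ i j, X i (B j) = B (monomialShift i j)
  commute : ∀ i, Commute D (X i)
  mul_self : D * D = ∑ i, g i • X i
  apply_mem : ∀ m, ∀ w ∈ homogeneousSpan B (monomialDegree deg) m,
    D w ∈ homogeneousSpan B (monomialDegree deg) (m + 1)

namespace IsMatrixFactorization

variable [Fintype σ] {deg : C → ℕ} {X : σ → Module.End Q M} {D : Module.End Q M}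
  {g : σ → Q} (h : IsMatrixFactorization B deg X D g) {s : Finset σ} {i : σ} {m : ℕ}

include h

theorem apply_apply_sub_mem_coeffIn [DecidableEq σ] (u : M) :
    D (D u) - g i • X i u ∈ coeffIn B (Ideal.span (g '' s)) (insert i s) := by
  have hDD : D (D u) = ∑ l, g l • X l u := by
    simpa using LinearMap.congr_fun h.mul_self u
  rw [hDD, ← Finset.add_sum_erase _ _ (Finset.mem_univ i), add_sub_cancel_left]
  refine Submodule.sum_mem _ fun l hl => ?_
  by_cases hls : l ∈ s
  · exact smul_mem_coeffIn (Ideal.subset_span (Set.mem_image_of_mem g hls)) _ _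
  · refine Submodule.smul_mem _ _ (variable_mem_coeffIn h.variable_basis _ ?_ _)
    simp [Finset.ne_of_mem_erase hl, hls]

-- Modulo the `g l` with `l ∈ s`, if `D v = g i • w`, then `g i • X i v = D (D v) = g i • D w`,
-- where `g i` can be cancelled.
theorem exists_variable_sub_apply_mem_coeffIn [DecidableEq σ] (hreg : IsRegularFamily g)
    (hi : i ∉ s) {v : M} (hv : v ∈ homogeneousSpan B (monomialDegree deg) (m + 1))
    (hDv : D v ∈ coeffIn B (Ideal.span (g '' s) ⊔ Ideal.span {g i}) (insert i s)) :
    ∃ w ∈ homogeneousSpan B (monomialDegree deg) (m + 2),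
      X i v - D w ∈ coeffIn B (Ideal.span (g '' s)) (insert i s) := by
  obtain ⟨w, hw, hvw⟩ := exists_sub_smul_mem_coeffIn (h.apply_mem _ v hv) hDv
  refine ⟨w, hw, mem_coeffIn_of_smul_mem (hreg s i hi) ?_⟩
  have hsplit : g i • (X i v - D w) = D (D v - g i • w) - (D (D v) - g i • X i v) := by
    simp only [map_sub, map_smul, smul_sub]
    abel
  rw [hsplit]
  exact Submodule.sub_mem _ (apply_mem_coeffIn h.variable_basis h.commute hvw)
    (h.apply_apply_sub_mem_coeffIn v)

-- Modulo the `g l` with `l ∈ s`, if `w - D u = X i t`, then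
-- `X i v = D w = g i • X i u + X i (D t)`, where `X i` can be cancelled.
theorem exists_sub_apply_mem_coeffIn_insert [DecidableEq σ] {u v w : M}
    (hw : w ∈ homogeneousSpan B (monomialDegree deg) (m + 2))
    (hvw : X i v - D w ∈ coeffIn B (Ideal.span (g '' s)) (insert i s))
    (hu : u ∈ homogeneousSpan B (monomialDegree deg) (m + 1))
    (hwu : w - D u ∈ coeffIn B (Ideal.span (g '' s)) s) :
    ∃ t ∈ homogeneousSpan B (monomialDegree deg) m,
      v - D t ∈ coeffIn B (Ideal.span (g '' s) ⊔ Ideal.span {g i}) (insert i s) := by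
  obtain ⟨t, ht, hwt⟩ := exists_sub_variable_mem_coeffIn h.variable_basis i
    (Submodule.sub_mem _ hw (h.apply_mem _ u hu)) hwu
  refine ⟨t, ht, ?_⟩
  have hcancel : v - D t - g i • u ∈ coeffIn B (Ideal.span (g '' s)) (insert i s) := by
    refine mem_coeffIn_of_variable_mem h.variable_basis (Finset.mem_insert_self i s) ?_
    have hcomm : X i (D t) = D (X i t) := (LinearMap.congr_fun (h.commute i).eq t).symm
    have hsplit : X i (v - D t - g i • u) =
        (X i v - D w) + D (w - D u - X i t) + (D (D u) - g i • X i u) := by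
      simp only [map_sub, map_smul, hcomm]
      abel
    rw [hsplit]
    exact Submodule.add_mem _ (Submodule.add_mem _ hvw
      (apply_mem_coeffIn h.variable_basis h.commute hwt)) (h.apply_apply_sub_mem_coeffIn u)
  rw [← sub_add_cancel (v - D t) (g i • u)]
  exact Submodule.add_mem _ (coeffIn_mono le_sup_left subset_rfl hcancel)
    (smul_mem_coeffIn (Ideal.mem_sup_right (Ideal.mem_span_singleton_self _)) _ _)

theorem exists_sub_apply_mem_coeffIn_image (hreg : IsRegularFamily g)
    (hdeg : ∀ c, deg c ≤ Fintype.card σ) (hm : Fintype.card σ ≤ m + s.card) {v : M}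
    (hv : v ∈ homogeneousSpan B (monomialDegree deg) (m + 1))
    (hDv : D v ∈ coeffIn B (Ideal.span (g '' s)) s) :
    ∃ u ∈ homogeneousSpan B (monomialDegree deg) m,
      v - D u ∈ coeffIn B (Ideal.span (g '' s)) s := by
  classical
  induction s using Finset.induction_on generalizing m v with
  | empty =>
    refine ⟨0, zero_mem _, fun j hj => ?_⟩
    by_contra hne
    rw [map_zero, sub_zero] at hne
    have hj0 : j.1 = 0 := support_eq_empty.1 (Finset.subset_empty.1 hj)
    have hjm := mem_homogeneousSpan.1 hv j fun h0 => hne (h0 ▸ zero_mem _)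
    have hj2 := hdeg j.2
    simp only [monomialDegree, hj0, map_zero] at hjm
    rw [Finset.card_empty] at hm
    lia
  | insert i s hi ih =>
    have hspan : Ideal.span (g '' (insert i s : Finset σ)) =
        Ideal.span (g '' s) ⊔ Ideal.span {g i} := by
      rw [Finset.coe_insert, Set.image_insert_eq, Ideal.span_insert, sup_comm]
    rw [hspan] at hDv ⊢
    rw [Finset.card_insert_of_notMem hi] at hm
    obtain ⟨w, hw, hvw⟩ := h.exists_variable_sub_apply_mem_coeffIn hreg hi hv hDv
    have hDw : D w ∈ coeffIn B (Ideal.span (g '' s)) s := by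
      simpa using Submodule.sub_mem _ (variable_mem_coeffIn h.variable_basis _ hi v)
        (coeffIn_mono le_rfl (Finset.subset_insert i s) hvw)
    obtain ⟨u, hu, hwu⟩ := ih (by lia) hw hDw
    exact h.exists_sub_apply_mem_coeffIn_insert hw hvw hu hwu

theorem exists_sub_apply_mem_coeffIn (hreg : IsRegularFamily g)
    (hdeg : ∀ c, deg c ≤ Fintype.card σ) {v : M}
    (hv : v ∈ homogeneousSpan B (monomialDegree deg) (m + 1))
    (hDv : D v ∈ coeffIn B (Ideal.span (Set.range g)) Finset.univ) :
    ∃ u ∈ homogeneousSpan B (monomialDegree deg) m,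
      v - D u ∈ coeffIn B (Ideal.span (Set.range g)) Finset.univ := by
  rw [← Set.image_univ, ← Finset.coe_univ] at hDv ⊢
  exact h.exists_sub_apply_mem_coeffIn_image hreg hdeg (by simp) hv hDv

end IsMatrixFactorization

end MatrixFactorization

/-! ### Regular sequences in group rings -/

section GroupRing

open MonoidAlgebra

variable {k L U σ : Type*} [CommRing k] [CommGroup L] [CommGroup U]

theorem single_sub_one_mem_of_mem_closure {I : Ideal (MonoidAlgebra k L)} {S : Set L}
    (hI : ∀ a ∈ S, single a (1 : k) - 1 ∈ I) {a : L} (ha : a ∈ Subgroup.closure S) :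
    single a (1 : k) - 1 ∈ I := by
  induction ha using Subgroup.closure_induction with
  | mem a ha => exact hI a ha
  | one => simp [← one_def]
  | mul a b _ _ ha hb =>
    have hab : single (a * b) (1 : k) - 1 =
        single a 1 * (single b 1 - 1) + (single a 1 - 1) := by
      rw [mul_sub, single_mul_single]
      simp
    rw [hab]
    exact I.add_mem (I.mul_mem_left _ hb) ha
  | inv a _ ha =>
    have hinv : single a⁻¹ (1 : k) - 1 = -single a⁻¹ 1 * (single a 1 - 1) := by
      rw [neg_mul, mul_sub, single_mul_single]
      simp [← one_def]
    rw [hinv]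
    exact I.mul_mem_left _ ha

theorem single_sub_single_eq_mul (a b : L) :
    single a (1 : k) - single b 1 = single b 1 * (single (a / b) 1 - 1) := by
  rw [mul_sub, single_mul_single]
  simp

theorem single_div_sub_one_mem_iff {I : Ideal (MonoidAlgebra k L)} {a b : L} :
    single (a / b) (1 : k) - 1 ∈ I ↔ single a (1 : k) - single b 1 ∈ I := by
  rw [single_sub_single_eq_mul]
  refine ⟨I.mul_mem_left _, fun h => ?_⟩
  have := I.mul_mem_left (single b⁻¹ (1 : k)) h
  rwa [← mul_assoc, single_mul_single, inv_mul_cancel, one_mul, ← one_def, one_mul] at this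

theorem mem_of_mapDomain_eq_zero {I : Ideal (MonoidAlgebra k L)} {r : L →* U}
    (hI : ∀ a ∈ r.ker, single a (1 : k) - 1 ∈ I) {f : MonoidAlgebra k L}
    (hf : mapDomain r f = 0) : f ∈ I := by
  let τ : L → L := Function.invFun r ∘ r
  have hτ (a : L) : single a (1 : k) - single (τ a) 1 ∈ I := by
    refine single_div_sub_one_mem_iff.1 (hI _ ?_)
    have hrτ : r (τ a) = r a := Function.invFun_eq (f := r) ⟨a, rfl⟩
    rw [MonoidHom.mem_ker, map_div, hrτ, div_self']
  have hsub (f : MonoidAlgebra k L) : f - mapDomain τ f ∈ I := by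
    induction f using MonoidAlgebra.induction_linear with
    | zero => simp
    | add f g hf hg =>
      rw [mapDomain_add, add_sub_add_comm]
      exact I.add_mem hf hg
    | single a c =>
      have hac : single a c - mapDomain τ (single a c) =
          single 1 c * (single a 1 - single (τ a) 1) := by
        rw [mul_sub, single_mul_single, single_mul_single, mapDomain_single]
        simp
      rw [hac]
      exact I.mul_mem_left _ (hτ a)
  have hτf : mapDomain τ f = mapDomain (Function.invFun r) (mapDomain r f) := by
    ext a
    simp only [coeff_mapDomain, τ, ← Finsupp.mapDomain_comp]
  simpa [hτf, hf] using hsub f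

theorem mem_span_single_sub_single_iff (a b : σ → L) (s : Set σ) (r : L →* U)
    (hr : r.ker = Subgroup.closure ((fun i => a i / b i) '' s)) {f : MonoidAlgebra k L} :
    f ∈ Ideal.span ((fun i => single (a i) (1 : k) - single (b i) 1) '' s) ↔
      mapDomain r f = 0 := by
  constructor
  · suffices Ideal.span ((fun i => single (a i) (1 : k) - single (b i) 1) '' s) ≤
        RingHom.ker (mapDomainRingHom k r) from fun hf => this hf
    rw [Ideal.span_le]
    rintro _ ⟨i, hi, rfl⟩
    have hri : r (a i) = r (b i) := by
      rw [← div_eq_one, ← map_div, ← MonoidHom.mem_ker, hr]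
      exact Subgroup.subset_closure ⟨i, hi, rfl⟩
    change mapDomainRingHom k r (single (a i) (1 : k) - single (b i) 1) = 0
    rw [map_sub, sub_eq_zero]
    simp [hri]
  · refine mem_of_mapDomain_eq_zero fun c hc => ?_
    rw [hr] at hc
    refine single_sub_one_mem_of_mem_closure ?_ hc
    rintro _ ⟨i, hi, rfl⟩
    exact single_div_sub_one_mem_iff.2 (Ideal.subset_span ⟨i, hi, rfl⟩)

theorem eq_zero_of_single_sub_single_mul_eq_zero {a b : U} (hab : ∀ m : ℤ, (a / b) ^ m = 1 → m = 0)
    {f : MonoidAlgebra k U} (hf : (single a (1 : k) - single b 1) * f = 0) : f = 0 := by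
  have hinv (c : U) : f.coeff (a⁻¹ * c) = f.coeff (b⁻¹ * c) := by
    have := congrArg (fun f : MonoidAlgebra k U => f.coeff c) hf
    simpa [sub_mul, coeff_single_mul_apply, sub_eq_zero] using this
  have hpow (m : ℕ) (c : U) : f.coeff ((a / b) ^ m * c) = f.coeff c := by
    induction m with
    | zero => simp
    | succ m ih =>
      rw [← ih, show (a / b) ^ m * c = a⁻¹ * (a * ((a / b) ^ m * c)) by group, hinv]
      congr 1
      rw [pow_succ', div_eq_mul_inv, mul_comm a]
      simp only [mul_assoc]
  by_contra hne
  obtain ⟨c, hc⟩ : ∃ c, f.coeff c ≠ 0 := by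
    by_contra! h
    exact hne (by ext c; simpa using h c)
  have hinj : Function.Injective fun m : ℕ => (a / b) ^ m * c := by
    intro m m' hm
    have hm : (a / b) ^ m = (a / b) ^ m' := mul_right_cancel hm
    have := hab (m - m') (by rw [zpow_sub, zpow_natCast, zpow_natCast, hm, mul_inv_cancel])
    lia
  refine Set.infinite_range_of_injective hinj (f.coeff.support.finite_toSet.subset ?_)
  rintro _ ⟨m, rfl⟩
  simpa [hpow] using hc

/-- A family of elements of a commutative group which is linearly independent over `ℤ`. -/
def IsIndependentFamily (a : σ → L) : Prop :=
  ∀ (s : Finset σ) (i : σ), i ∉ s → ∀ m : ℤ, a i ^ m ∈ Subgroup.closure (a '' s) → m = 0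

variable (k) in
theorem isRegularFamily_single_sub_single {a b : σ → L}
    (hab : IsIndependentFamily fun i => a i / b i) :
    IsRegularFamily fun i => single (a i) (1 : k) - single (b i) 1 := by
  intro s i hi f hf
  set r := QuotientGroup.mk' (Subgroup.closure ((fun i => a i / b i) '' s))
  have hr := QuotientGroup.ker_mk' (Subgroup.closure ((fun i => a i / b i) '' s))
  rw [mem_span_single_sub_single_iff a b s r hr] at hf ⊢
  refine eq_zero_of_single_sub_single_mul_eq_zero (a := r (a i)) (b := r (b i)) (fun m hm => ?_) ?_
  · refine hab s i hi m ?_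
    rwa [← hr, MonoidHom.mem_ker, map_zpow, map_div]
  · have hmap : mapDomainRingHom k r ((single (a i) 1 - single (b i) 1) * f) = 0 := hf
    rw [map_mul, map_sub] at hmap
    simpa using hmap

end GroupRing

/-! ### The algebra `Sym V ⊗ Λ V` -/

open scoped TensorProduct

/-- The tensor product of the symmetric and the exterior algebra of `V`. -/
abbrev SymExt (k V : Type*) [CommRing k] [AddCommGroup V] [Module k V] :=
  SymmetricAlgebra k V ⊗[k] ExteriorAlgebra k V

namespace SymExt

variable {k V : Type*} [CommRing k] [AddCommGroup V] [Module k V]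

/-- Multiplication by a vector in the exterior algebra. -/
def wedge : V →ₗ[k] Module.End k (SymExt k V) :=
  LinearMap.lTensorHom _ ∘ₗ LinearMap.mul k (ExteriorAlgebra k V) ∘ₗ ExteriorAlgebra.ι k

/-- Multiplication by a vector in the symmetric algebra. -/
def times : V →ₗ[k] Module.End k (SymExt k V) :=
  LinearMap.rTensorHom _ ∘ₗ LinearMap.mul k (SymmetricAlgebra k V) ∘ₗ SymmetricAlgebra.ι k V

/-- Contraction with a linear form in the exterior algebra. -/
def contract : Module.Dual k V →ₗ[k] Module.End k (SymExt k V) :=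
  LinearMap.lTensorHom _ ∘ₗ CliffordAlgebra.contractLeft (Q := (0 : QuadraticForm k V))

theorem wedge_tmul (v : V) (a : SymmetricAlgebra k V) (b : ExteriorAlgebra k V) :
    wedge v (a ⊗ₜ b) = a ⊗ₜ (ExteriorAlgebra.ι k v * b) := rfl

theorem times_tmul (v : V) (a : SymmetricAlgebra k V) (b : ExteriorAlgebra k V) :
    times v (a ⊗ₜ b) = (SymmetricAlgebra.ι k V v * a) ⊗ₜ b := rfl

theorem contract_tmul (ξ : Module.Dual k V) (a : SymmetricAlgebra k V)
    (b : ExteriorAlgebra k V) :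
    contract ξ (a ⊗ₜ b) = a ⊗ₜ CliffordAlgebra.contractLeft (Q := (0 : QuadraticForm k V)) ξ b :=
  rfl

theorem wedge_mul_wedge_add (v w : V) : wedge (k := k) v * wedge w + wedge w * wedge v = 0 := by
  refine TensorProduct.ext' fun a b => ?_
  simp only [LinearMap.add_apply, Module.End.mul_apply, wedge_tmul, LinearMap.zero_apply]
  rw [← TensorProduct.tmul_add, ← mul_assoc, ← mul_assoc, ← add_mul,
    ExteriorAlgebra.ι_add_mul_swap, zero_mul, TensorProduct.tmul_zero]

theorem wedge_mul_self (v : V) : wedge (k := k) v * wedge v = 0 := by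
  refine TensorProduct.ext' fun a b => ?_
  simp only [Module.End.mul_apply, wedge_tmul, LinearMap.zero_apply]
  rw [← mul_assoc, ExteriorAlgebra.ι_sq_zero, zero_mul, TensorProduct.tmul_zero]

theorem contract_mul_contract_add (ξ η : Module.Dual k V) :
    contract ξ * contract η + contract η * contract ξ = 0 := by
  refine TensorProduct.ext' fun a b => ?_
  simp only [LinearMap.add_apply, Module.End.mul_apply, contract_tmul, LinearMap.zero_apply]
  rw [← TensorProduct.tmul_add, CliffordAlgebra.contractLeft_comm, neg_add_cancel,
    TensorProduct.tmul_zero]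

theorem contract_mul_self (ξ : Module.Dual k V) : contract ξ * contract ξ = 0 := by
  refine TensorProduct.ext' fun a b => ?_
  simp only [Module.End.mul_apply, contract_tmul, LinearMap.zero_apply]
  rw [CliffordAlgebra.contractLeft_contractLeft, TensorProduct.tmul_zero]

theorem contract_mul_wedge_add (ξ : Module.Dual k V) (v : V) :
    contract ξ * wedge v + wedge v * contract ξ = ξ v • 1 := by
  refine TensorProduct.ext' fun a b => ?_
  simp only [LinearMap.add_apply, Module.End.mul_apply, contract_tmul, wedge_tmul,
    LinearMap.smul_apply, Module.End.one_apply]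
  have h := CliffordAlgebra.contractLeft_ι_mul (Q := (0 : QuadraticForm k V)) (d := ξ) v b
  rw [← TensorProduct.tmul_add, ← TensorProduct.tmul_smul]
  congr 1
  refine (congrArg (· + _) h).trans ?_
  exact sub_add_cancel _ _

theorem commute_times_wedge (v w : V) : Commute (times (k := k) v) (wedge w) := by
  refine TensorProduct.ext' fun a b => ?_
  simp only [Module.End.mul_apply, times_tmul, wedge_tmul]

theorem commute_times_contract (v : V) (ξ : Module.Dual k V) :
    Commute (times v) (contract ξ) := by
  refine TensorProduct.ext' fun a b => ?_
  simp only [Module.End.mul_apply, times_tmul, contract_tmul]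

theorem commute_times_times (v w : V) : Commute (times (k := k) v) (times w) := by
  refine TensorProduct.ext' fun a b => ?_
  simp only [Module.End.mul_apply, times_tmul, mul_left_comm]

/-- The functoriality of `SymExt k V`. -/
def map (f : V →ₗ[k] V) : Module.End k (SymExt k V) :=
  TensorProduct.map (SymmetricAlgebra.lift (SymmetricAlgebra.ι k V ∘ₗ f)).toLinearMap
    (ExteriorAlgebra.map f).toLinearMap

theorem map_tmul (f : V →ₗ[k] V) (a : SymmetricAlgebra k V) (b : ExteriorAlgebra k V) :
    map f (a ⊗ₜ b) =
      SymmetricAlgebra.lift (SymmetricAlgebra.ι k V ∘ₗ f) a ⊗ₜ ExteriorAlgebra.map f b := rfl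

protected theorem map_one (f : V →ₗ[k] V) : map f 1 = 1 := by
  rw [Algebra.TensorProduct.one_def, map_tmul, map_one, map_one]

protected theorem map_id : map (LinearMap.id : V →ₗ[k] V) = 1 := by
  refine TensorProduct.ext' fun a b => ?_
  rw [map_tmul, ExteriorAlgebra.map_id, LinearMap.comp_id, SymmetricAlgebra.lift_ι]
  rfl

protected theorem map_comp (f g : V →ₗ[k] V) : map (f ∘ₗ g) = map f * map g := by
  refine TensorProduct.ext' fun a b => ?_
  rw [Module.End.mul_apply, map_tmul, map_tmul, map_tmul, ← ExteriorAlgebra.map_comp_map]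
  congr 1
  have : SymmetricAlgebra.lift (SymmetricAlgebra.ι k V ∘ₗ f ∘ₗ g) =
      (SymmetricAlgebra.lift (SymmetricAlgebra.ι k V ∘ₗ f)).comp
        (SymmetricAlgebra.lift (SymmetricAlgebra.ι k V ∘ₗ g)) := by
    refine SymmetricAlgebra.algHom_ext (LinearMap.ext fun v => ?_)
    simp
  rw [this]
  rfl

theorem map_mul_wedge (f : V →ₗ[k] V) (v : V) : map f * wedge v = wedge (f v) * map f := by
  refine TensorProduct.ext' fun a b => ?_
  rw [Module.End.mul_apply, Module.End.mul_apply, wedge_tmul, map_tmul, map_tmul, wedge_tmul,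
    map_mul, ExteriorAlgebra.map_apply_ι]

theorem map_mul_times (f : V →ₗ[k] V) (v : V) : map f * times v = times (f v) * map f := by
  refine TensorProduct.ext' fun a b => ?_
  rw [Module.End.mul_apply, Module.End.mul_apply, times_tmul, map_tmul, map_tmul, times_tmul,
    map_mul, SymmetricAlgebra.lift_ι_apply]
  rfl

theorem map_mul_contract (f : V →ₗ[k] V) (ξ : Module.Dual k V) :
    map f * contract (ξ ∘ₗ f) = contract ξ * map f := by
  refine TensorProduct.ext' fun a b => ?_
  rw [Module.End.mul_apply, Module.End.mul_apply, contract_tmul, map_tmul, map_tmul, contract_tmul]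
  congr 1
  induction b using CliffordAlgebra.left_induction with
  | algebraMap r =>
    rw [CliffordAlgebra.contractLeft_algebraMap, map_zero]
    have := (ExteriorAlgebra.map f).commutes r
    exact ((congrArg _ this).trans
      (CliffordAlgebra.contractLeft_algebraMap (Q := (0 : QuadraticForm k V)) ξ r)).symm
  | add x y hx hy =>
    exact (congrArg _ (map_add _ x y)).trans ((map_add _ _ _).trans
      ((congrArg₂ _ hx hy).trans ((map_add _ _ _).symm.trans
        (congrArg _ (map_add (ExteriorAlgebra.map f) x y).symm))))
  | ι_mul x m hx =>
    have hmul (y) : ExteriorAlgebra.map f (CliffordAlgebra.ι 0 m * y) =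
        CliffordAlgebra.ι 0 (f m) * ExteriorAlgebra.map f y :=
      (map_mul _ _ _).trans (congrArg (· * _) (ExteriorAlgebra.map_apply_ι f m))
    rw [CliffordAlgebra.contractLeft_ι_mul, hmul, CliffordAlgebra.contractLeft_ι_mul, ← hx, ← hmul]
    exact (map_sub (ExteriorAlgebra.map f) _ _).trans (congrArg₂ _ (map_smul _ _ _) rfl)

/-- Monomials in elements of `V`, of degree one in the exterior algebra and of degree two in the
symmetric algebra. -/
inductive IsMonomial : ℕ → SymExt k V → Prop
  | one : IsMonomial 0 1
  | wedge {m w} (v : V) : IsMonomial m w → IsMonomial (m + 1) (SymExt.wedge v w)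
  | times {m w} (v : V) : IsMonomial m w → IsMonomial (m + 2) (SymExt.times v w)

variable (k V) in
/-- The homogeneous elements of degree `m`, the degree being that of `IsMonomial`. -/
def graded (m : ℕ) : Submodule k (SymExt k V) := Submodule.span k {w | IsMonomial m w}

theorem apply_mem_graded_of_forall {m n : ℕ} (T : Module.End k (SymExt k V))
    (h : ∀ w, IsMonomial m w → T w ∈ graded k V n) {w : SymExt k V} (hw : w ∈ graded k V m) :
    T w ∈ graded k V n := by
  have : graded k V m ≤ (graded k V n).comap T := Submodule.span_le.2 h
  exact this hw

theorem one_mem_graded : (1 : SymExt k V) ∈ graded k V 0 := Submodule.subset_span .one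

theorem graded_zero : graded k V 0 = Submodule.span k {1} := by
  rw [graded]
  congr 1
  ext w
  refine ⟨fun h => ?_, ?_⟩
  · change IsMonomial 0 w at h
    generalize hm : 0 = m at h
    cases h <;> first | rfl | lia
  · rintro rfl
    exact .one

theorem wedge_mem_graded (v : V) {m : ℕ} {w : SymExt k V} (hw : w ∈ graded k V m) :
    wedge v w ∈ graded k V (m + 1) :=
  apply_mem_graded_of_forall _ (fun _ h => Submodule.subset_span (.wedge v h)) hw

theorem times_mem_graded (v : V) {m : ℕ} {w : SymExt k V} (hw : w ∈ graded k V m) :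
    times v w ∈ graded k V (m + 2) :=
  apply_mem_graded_of_forall _ (fun _ h => Submodule.subset_span (.times v h)) hw

theorem contract_one (ξ : Module.Dual k V) : contract ξ 1 = 0 := by
  rw [Algebra.TensorProduct.one_def, contract_tmul]
  refine (congrArg _ (CliffordAlgebra.contractLeft_one (Q := (0 : QuadraticForm k V)) ξ)).trans ?_
  exact TensorProduct.tmul_zero _ _

theorem contract_eq_zero (ξ : Module.Dual k V) {w : SymExt k V} (hw : w ∈ graded k V 0) :
    contract ξ w = 0 := by
  rw [graded_zero, Submodule.mem_span_singleton] at hw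
  obtain ⟨c, rfl⟩ := hw
  rw [map_smul, contract_one, smul_zero]

theorem contract_wedge (ξ : Module.Dual k V) (v : V) (w : SymExt k V) :
    contract ξ (wedge v w) = ξ v • w - wedge v (contract ξ w) := by
  rw [eq_sub_iff_add_eq]
  simpa using LinearMap.congr_fun (contract_mul_wedge_add ξ v) w

theorem contract_times (ξ : Module.Dual k V) (v : V) (w : SymExt k V) :
    contract ξ (times v w) = times v (contract ξ w) :=
  (LinearMap.congr_fun (commute_times_contract v ξ).eq w).symm

theorem IsMonomial.contract_eq_zero_or_mem_graded (ξ : Module.Dual k V) {m : ℕ} {w : SymExt k V}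
    (hw : IsMonomial m w) :
    contract ξ w = 0 ∨ ∃ n, n + 1 = m ∧ contract ξ w ∈ graded k V n := by
  induction hw with
  | one => exact .inl (contract_one ξ)
  | @wedge m w u h ih =>
    refine .inr ⟨m, rfl, ?_⟩
    rw [contract_wedge]
    refine Submodule.sub_mem _ (Submodule.smul_mem _ _ (Submodule.subset_span h)) ?_
    rcases ih with ih | ⟨n, rfl, hn⟩
    · simp [ih]
    · exact wedge_mem_graded u hn
  | @times m w u _ ih =>
    refine .inr ⟨m + 1, rfl, ?_⟩
    rw [contract_times]
    rcases ih with ih | ⟨n, rfl, hn⟩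
    · simp [ih]
    · exact times_mem_graded u hn

theorem times_contract_mem_graded (v : V) (ξ : Module.Dual k V) {m : ℕ} {w : SymExt k V}
    (hw : w ∈ graded k V m) : times v (contract ξ w) ∈ graded k V (m + 1) := by
  refine apply_mem_graded_of_forall (times v * contract ξ) (fun w hw => ?_) hw
  rw [Module.End.mul_apply]
  rcases hw.contract_eq_zero_or_mem_graded ξ with h | ⟨n, rfl, hn⟩
  · simp [h]
  · exact times_mem_graded v hn

theorem IsMonomial.map (f : V →ₗ[k] V) {m : ℕ} {w : SymExt k V} (hw : IsMonomial m w) :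
    IsMonomial m (SymExt.map f w) := by
  induction hw with
  | one => rw [SymExt.map_one]; exact .one
  | wedge v _ ih =>
    rw [← Module.End.mul_apply, map_mul_wedge]
    exact .wedge _ ih
  | times v _ ih =>
    rw [← Module.End.mul_apply, map_mul_times]
    exact .times _ ih

theorem map_mem_graded (f : V →ₗ[k] V) {m : ℕ} {w : SymExt k V} (hw : w ∈ graded k V m) :
    map f w ∈ graded k V m :=
  apply_mem_graded_of_forall _ (fun _ hw => Submodule.subset_span (hw.map f)) hw

theorem one_tmul_mem_graded {n : ℕ} {x : ExteriorAlgebra k V} (hx : x ∈ ⋀[k]^n V) :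
    (1 : SymmetricAlgebra k V) ⊗ₜ x ∈ graded k V n := by
  induction hx using Submodule.pow_induction_on_left' with
  | algebraMap r =>
    rw [Algebra.algebraMap_eq_smul_one, TensorProduct.tmul_smul]
    exact Submodule.smul_mem _ _ one_mem_graded
  | add x y i _ _ ihx ihy =>
    rw [TensorProduct.tmul_add]
    exact Submodule.add_mem _ ihx ihy
  | mem_mul m hm i x _ ihx =>
    obtain ⟨v, rfl⟩ := hm
    exact wedge_mem_graded v ihx

theorem symmetricAlgebra_zero {σ : Type*} (b : Module.Basis σ k V) :
    b.symmetricAlgebra (0 : σ →₀ ℕ) = 1 := by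
  simp only [Module.Basis.symmetricAlgebra, Module.Basis.map_apply,
    MvPolynomial.coe_basisMonomials, AlgEquiv.toLinearEquiv_apply]
  exact map_one _

theorem symmetricAlgebra_add_single {σ : Type*} (b : Module.Basis σ k V) (i : σ) (α : σ →₀ ℕ) :
    b.symmetricAlgebra (α + Finsupp.single i 1) =
      SymmetricAlgebra.ι k V (b i) * b.symmetricAlgebra α := by
  simp only [Module.Basis.symmetricAlgebra, Module.Basis.map_apply,
    MvPolynomial.coe_basisMonomials, AlgEquiv.toLinearEquiv_apply]
  rw [← SymmetricAlgebra.equivMvPolynomial_symm_X, ← map_mul]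
  congr 1
  rw [MvPolynomial.X, MvPolynomial.monomial_mul, one_mul, add_comm]

section basis

variable {σ : Type*} [LinearOrder σ] (b : Module.Basis σ k V)

/-- The basis of `SymExt k V` formed by monomials in the vectors of a basis of `V`. -/
def basis : Module.Basis ((σ →₀ ℕ) × Finset σ) k (SymExt k V) :=
  b.symmetricAlgebra.tensorProduct b.ExteriorAlgebra

theorem basis_apply (α : σ →₀ ℕ) (c : Finset σ) :
    basis b (α, c) = b.symmetricAlgebra α ⊗ₜ b.ExteriorAlgebra c := by
  simp [basis]

theorem times_basis (i : σ) (j : (σ →₀ ℕ) × Finset σ) :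
    times (b i) (basis b j) = basis b (monomialShift i j) := by
  obtain ⟨α, c⟩ := j
  rw [basis_apply, monomialShift, basis_apply, times_tmul, symmetricAlgebra_add_single]

theorem exteriorAlgebra_mem (c : Finset σ) : b.ExteriorAlgebra c ∈ ⋀[k]^(c.card) V := by
  rw [ExteriorAlgebra.basis_eq_coe_basis b (⟨c, rfl⟩ : Set.powersetCard σ c.card)]
  exact Subtype.property _

local notation "𝒢" => homogeneousSpan (basis b) (monomialDegree Finset.card)

theorem tmul_mem_homogeneousSpan (α : σ →₀ ℕ) {n : ℕ} {x : ExteriorAlgebra k V}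
    (hx : x ∈ ⋀[k]^n V) : b.symmetricAlgebra α ⊗ₜ x ∈ 𝒢 (2 * α.degree + n) := by
  have hsum := congrArg (fun y : ⋀[k]^n V => (y : ExteriorAlgebra k V))
    ((b.exteriorPower n).linearCombination_repr ⟨x, hx⟩)
  simp only [Finsupp.linearCombination_apply, Finsupp.sum, AddSubmonoidClass.coe_finsetSum,
    Submodule.coe_smul, ← ExteriorAlgebra.basis_eq_coe_basis] at hsum
  rw [← hsum, TensorProduct.tmul_sum]
  refine Submodule.sum_mem _ fun s _ => ?_
  rw [TensorProduct.tmul_smul, ← basis_apply]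
  refine Submodule.smul_mem _ _ (Submodule.subset_span ⟨_, ?_, rfl⟩)
  simp [monomialDegree]

theorem wedge_basis_mem_homogeneousSpan (v : V) (j : (σ →₀ ℕ) × Finset σ) :
    wedge v (basis b j) ∈ 𝒢 (monomialDegree Finset.card j + 1) := by
  obtain ⟨α, c⟩ := j
  rw [basis_apply, wedge_tmul, monomialDegree, add_assoc]
  refine tmul_mem_homogeneousSpan b _ ?_
  rw [add_comm, ExteriorAlgebra.exteriorPower, pow_add, pow_one]
  exact Submodule.mul_mem_mul ⟨v, rfl⟩ (exteriorAlgebra_mem b _)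

theorem times_basis_mem_homogeneousSpan (v : V) (j : (σ →₀ ℕ) × Finset σ) :
    times v (basis b j) ∈ 𝒢 (monomialDegree Finset.card j + 2) := by
  rw [← b.linearCombination_repr v, Finsupp.linearCombination_apply, Finsupp.sum, map_sum,
    LinearMap.sum_apply]
  refine Submodule.sum_mem _ fun i _ => ?_
  rw [map_smul, LinearMap.smul_apply, times_basis]
  exact Submodule.smul_mem _ _ (Submodule.subset_span
    ⟨_, monomialDegree_monomialShift Finset.card i j, rfl⟩)

variable {b} in
theorem apply_mem_homogeneousSpan_add {T : Module.End k (SymExt k V)} {a : ℕ}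
    (hT : ∀ j, T (basis b j) ∈ 𝒢 (monomialDegree Finset.card j + a)) {m : ℕ} {w : SymExt k V}
    (hw : w ∈ 𝒢 m) : T w ∈ 𝒢 (m + a) := by
  have hle : 𝒢 m ≤ (𝒢 (m + a)).comap T := by
    rw [homogeneousSpan, Submodule.span_le]
    rintro _ ⟨j, rfl, rfl⟩
    exact hT j
  exact hle hw

theorem IsMonomial.mem_homogeneousSpan {m : ℕ} {w : SymExt k V} (hw : IsMonomial m w) :
    w ∈ 𝒢 m := by
  induction hw with
  | one =>
    have h1 : (1 : ExteriorAlgebra k V) ∈ ⋀[k]^0 V := by simp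
    have := tmul_mem_homogeneousSpan b 0 h1
    rwa [symmetricAlgebra_zero, map_zero, mul_zero, zero_add,
      ← Algebra.TensorProduct.one_def] at this
  | wedge v _ ih => exact apply_mem_homogeneousSpan_add (wedge_basis_mem_homogeneousSpan b v) ih
  | times v _ ih => exact apply_mem_homogeneousSpan_add (times_basis_mem_homogeneousSpan b v) ih

theorem basis_mem_graded (j : (σ →₀ ℕ) × Finset σ) :
    basis b j ∈ graded k V (monomialDegree Finset.card j) := by
  obtain ⟨n, hn⟩ : ∃ n, j.1.degree = n := ⟨_, rfl⟩
  induction n generalizing j with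
  | zero =>
    obtain ⟨α, c⟩ := j
    obtain rfl := (Finsupp.degree_eq_zero_iff _).1 hn
    rw [basis_apply, symmetricAlgebra_zero]
    simpa [monomialDegree] using one_tmul_mem_graded (exteriorAlgebra_mem b c)
  | succ n ih =>
    obtain ⟨i, hi⟩ : ∃ i, j.1 i ≠ 0 := by
      by_contra! h0
      rw [(Finsupp.ext h0 : j.1 = 0)] at hn
      simp at hn
    obtain ⟨j, rfl⟩ := exists_monomialShift_eq hi
    have hj : j.1.degree = n := by simpa [monomialShift] using hn
    rw [← times_basis, monomialDegree_monomialShift]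
    exact times_mem_graded (b i) (ih j hj)

theorem graded_eq_homogeneousSpan (m : ℕ) : graded k V m = 𝒢 m := by
  refine le_antisymm (Submodule.span_le.2 fun w hw => hw.mem_homogeneousSpan b) ?_
  rw [homogeneousSpan, Submodule.span_le]
  rintro _ ⟨j, rfl, rfl⟩
  exact basis_mem_graded b j

include b in
theorem finite_graded [Finite σ] (m : ℕ) : Module.Finite k (graded k V m) := by
  rw [graded_eq_homogeneousSpan b, homogeneousSpan]
  refine Module.Finite.span_of_finite k (Set.Finite.image _ ?_)
  refine ((Finsupp.finite_of_degree_le m).prod (Set.toFinite (Set.univ : Set (Finset σ)))).subset ?_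
  rintro ⟨α, c⟩ h
  simp only [Set.mem_ofPred_eq, monomialDegree] at h
  simp only [Set.mem_prod, Set.mem_ofPred_eq, Set.mem_univ, and_true]
  lia

end basis

end SymExt

/-! ### The differential of a difference system -/

theorem sum_mul_sum_eq_zero_of_anticommute {ι A : Type*} [Fintype ι] [Ring A] (a : ι → A)
    (h0 : ∀ i, a i * a i = 0) (h : ∀ i j, a i * a j + a j * a i = 0) :
    (∑ i, a i) * ∑ i, a i = 0 := by
  classical
  suffices ∀ s : Finset ι, (∑ i ∈ s, a i) * ∑ i ∈ s, a i = 0 from this _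
  intro s
  induction s using Finset.induction_on with
  | empty => simp
  | insert i s hi ih =>
    have hcross : a i * ∑ j ∈ s, a j + (∑ j ∈ s, a j) * a i = 0 := by
      rw [Finset.mul_sum, Finset.sum_mul, ← Finset.sum_add_distrib]
      exact Finset.sum_eq_zero fun j _ => h i j
    rw [Finset.sum_insert hi, add_mul, mul_add, mul_add, h0, ih, zero_add, add_zero, hcross]

theorem SymExt.times_contract_mul {k V : Type*} [CommRing k] [AddCommGroup V] [Module k V]
    (v w : V) (ξ η : Module.Dual k V) : times v * contract ξ * (times w * contract η) =
      times v * times w * (contract ξ * contract η) := by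
  rw [mul_assoc, ← mul_assoc (contract ξ), ← (commute_times_contract w ξ).eq]
  simp only [mul_assoc]

/-- A representation `V` of `P` with a family of vectors `e h` and a family of linear forms `ev h`,
both permuted by `P`, such that `ev x (e h)` is the difference of the Kronecker symbols of `h` and
`x` and of `h` and `x ψ`. The forms `ev (l i)` are the coordinates of a basis. This is what the
module of forms on a lattice with a cyclic point group has to offer to the Koszul differential. -/
structure DifferenceSystem (k P V σ : Type*) [CommRing k] [CommGroup P] [DecidableEq P]
    [AddCommGroup V] [Module k V] where
  ρ : Representation k P V
  ψ : P
  e : P → V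
  ev : P → Module.Dual k V
  l : σ → P
  basis : Module.Basis σ k V
  ρ_e : ∀ g h, ρ g (e h) = e (g * h)
  ev_ρ : ∀ g h, ev (g * h) ∘ₗ ρ g = ev h
  ev_e : ∀ x h, ev x (e h) = (if h = x then 1 else 0) - (if h = x * ψ then 1 else 0)
  basis_repr : ∀ i v, basis.repr v i = ev (l i) v

namespace DifferenceSystem

open SymExt

variable {k P V σ : Type*} [CommRing k] [CommGroup P] [DecidableEq P] [AddCommGroup V] [Module k V]
  [Fintype P] (𝒟 : DifferenceSystem k P V σ)

theorem sum_ev_e_smul {W : Type*} [AddCommGroup W] [Module k W] (q : P → W) (x : P) :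
    ∑ h, 𝒟.ev x (𝒟.e h) • q h = q x - q (x * 𝒟.ψ) := by
  simp [𝒟.ev_e, sub_smul, Finset.sum_sub_distrib]

theorem sum_tmul_e [Fintype σ] {W : Type*} [AddCommGroup W] [Module k W] (q : P → W) :
    ∑ h, q h ⊗ₜ[k] 𝒟.e h =
      ∑ i, (q (𝒟.l i) - q (𝒟.l i * 𝒟.ψ)) ⊗ₜ[k] 𝒟.basis i := by
  simp only [← 𝒟.sum_ev_e_smul, TensorProduct.sum_tmul, TensorProduct.smul_tmul]
  rw [Finset.sum_comm]
  refine Finset.sum_congr rfl fun h _ => ?_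
  rw [← TensorProduct.tmul_sum]
  congr 1
  conv_lhs => rw [← 𝒟.basis.sum_repr (𝒟.e h)]
  simp only [𝒟.basis_repr]

theorem sum_e [Finite σ] : ∑ h, 𝒟.e h = 0 := by
  have := Fintype.ofFinite σ
  have := 𝒟.sum_tmul_e (fun _ => (1 : k))
  simp only [sub_self, TensorProduct.zero_tmul, Finset.sum_const_zero] at this
  simpa using congrArg (TensorProduct.lid k V) this

section differential

variable {Q Q' : Type*} [CommRing Q] [Algebra k Q] [CommRing Q'] [Algebra k Q']

/-- The differential of the twisted Koszul complex `Q ⊗ Sym V ⊗ Λ V`: the Koszul differential of the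
family `z`, corrected by contractions with coefficients `c`. -/
def differential (z : P → Q) (c : P → P → Q) : Q ⊗[k] Module.End k (SymExt k V) :=
  ∑ h, z h ⊗ₜ wedge (𝒟.e h) +
    ∑ y : P × P, c y.1 y.2 ⊗ₜ (times (𝒟.e y.1) * contract (𝒟.ev (y.1 * y.2)))

theorem map_differential (f : Q →ₐ[k] Q') (z : P → Q) (c : P → P → Q) :
    Algebra.TensorProduct.map f (AlgHom.id k _) (𝒟.differential z c) =
      𝒟.differential (fun h => f (z h)) (fun h g => f (c h g)) := by
  simp [differential]

theorem sum_wedge_mul_self (z : P → Q) :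
    (∑ h, z h ⊗ₜ[k] wedge (k := k) (𝒟.e h)) * ∑ h, z h ⊗ₜ[k] wedge (k := k) (𝒟.e h) = 0 := by
  refine sum_mul_sum_eq_zero_of_anticommute _ (fun h => ?_) fun h h' => ?_
  · rw [Algebra.TensorProduct.tmul_mul_tmul, wedge_mul_self, TensorProduct.tmul_zero]
  · rw [Algebra.TensorProduct.tmul_mul_tmul, Algebra.TensorProduct.tmul_mul_tmul,
      mul_comm (z h'), ← TensorProduct.tmul_add, wedge_mul_wedge_add, TensorProduct.tmul_zero]

theorem sum_times_contract_mul_self (c : P → P → Q) :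
    (∑ y : P × P, c y.1 y.2 ⊗ₜ[k] (times (𝒟.e y.1) * contract (𝒟.ev (y.1 * y.2)))) *
      ∑ y : P × P, c y.1 y.2 ⊗ₜ[k] (times (𝒟.e y.1) * contract (𝒟.ev (y.1 * y.2))) = 0 := by
  refine sum_mul_sum_eq_zero_of_anticommute _ (fun y => ?_) fun y y' => ?_
  · rw [Algebra.TensorProduct.tmul_mul_tmul, times_contract_mul, contract_mul_self, mul_zero,
      TensorProduct.tmul_zero]
  · rw [Algebra.TensorProduct.tmul_mul_tmul, Algebra.TensorProduct.tmul_mul_tmul,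
      mul_comm (c _ _), ← TensorProduct.tmul_add, times_contract_mul, times_contract_mul,
      (commute_times_times (𝒟.e y'.1) (𝒟.e y.1)).eq, ← mul_add, contract_mul_contract_add,
      mul_zero, TensorProduct.tmul_zero]

theorem differential_mul_self (z : P → Q) (c : P → P → Q) :
    𝒟.differential z c * 𝒟.differential z c =
      ∑ h, (∑ g, c h g * (z (h * g) - z (h * g * 𝒟.ψ))) ⊗ₜ times (𝒟.e h) := by
  rw [differential, add_mul, mul_add, mul_add, sum_wedge_mul_self, sum_times_contract_mul_self,
    zero_add, add_zero, Finset.sum_mul_sum, Finset.sum_comm, Finset.sum_mul_sum,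
    ← Finset.sum_add_distrib, Fintype.sum_prod_type]
  refine Finset.sum_congr rfl fun h _ => ?_
  rw [TensorProduct.sum_tmul]
  refine Finset.sum_congr rfl fun g _ => ?_
  rw [← Finset.sum_add_distrib, ← 𝒟.sum_ev_e_smul z, Finset.mul_sum, TensorProduct.sum_tmul]
  refine Finset.sum_congr rfl fun h' _ => ?_
  rw [Algebra.TensorProduct.tmul_mul_tmul, Algebra.TensorProduct.tmul_mul_tmul,
    mul_comm (z h'), ← TensorProduct.tmul_add, mul_smul_comm, TensorProduct.smul_tmul]
  congr 1
  rw [← mul_assoc, ← (commute_times_wedge (𝒟.e h) (𝒟.e h')).eq, mul_assoc, mul_assoc, ← mul_add,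
    add_comm, contract_mul_wedge_add, mul_smul_comm, mul_one]

theorem differential_mul_self_of_sum_eq [Fintype σ] {z : P → Q} {c : P → P → Q} {w : P → Q}
    (hw : ∀ h, ∑ g, c h g * (z (h * g) - z (h * g * 𝒟.ψ)) = w h - 1) :
    𝒟.differential z c * 𝒟.differential z c =
      ∑ i, (w (𝒟.l i) - w (𝒟.l i * 𝒟.ψ)) ⊗ₜ times (𝒟.basis i) := by
  rw [differential_mul_self]
  have := congrArg (LinearMap.lTensor Q times) (𝒟.sum_tmul_e fun h => w h - 1)
  simpa [hw] using this

theorem commute_differential_times (z : P → Q) (c : P → P → Q) (v : V) :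
    Commute (𝒟.differential z c) ((1 : Q) ⊗ₜ times v) := by
  have hcomm {t : Module.End k (SymExt k V)} (ht : Commute (times v) t) (q : Q) :
      Commute (q ⊗ₜ[k] t) ((1 : Q) ⊗ₜ times v) := by
    rw [Commute, SemiconjBy, Algebra.TensorProduct.tmul_mul_tmul,
      Algebra.TensorProduct.tmul_mul_tmul, one_mul, mul_one, ht.eq]
  exact Commute.add_left
    (Commute.sum_left _ _ _ fun h _ => hcomm (commute_times_wedge _ _) _)
    (Commute.sum_left _ _ _ fun y _ =>
      hcomm ((commute_times_times v _).mul_right (commute_times_contract v _)) _)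

end differential

end DifferenceSystem

section BaseChange

theorem tensorProductEnd_tmul_tmul {k Q X : Type*} [CommRing k] [CommRing Q] [Algebra k Q]
    [AddCommGroup X] [Module k X] (q r : Q) (t : Module.End k X) (x : X) :
    LinearMap.tensorProductEnd k Q X (q ⊗ₜ t) (r ⊗ₜ x) = (q * r) ⊗ₜ t x := by
  change LinearMap.tensorProduct k Q X X (q ⊗ₜ t) (r ⊗ₜ x) = (q * r) ⊗ₜ t x
  simp [LinearMap.tensorProduct, TensorProduct.smul_tmul']

variable {k X J : Type*} [CommRing k] [AddCommGroup X] [Module k X] (b : Module.Basis J k X)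
  {Q Q' : Type*} [CommRing Q] [Algebra k Q] [CommRing Q'] [Algebra k Q']

theorem repr_baseChange_map (f : Q →ₐ[k] Q') (y : Q ⊗[k] X) (j : J) :
    (b.baseChange Q').repr (TensorProduct.map f.toLinearMap LinearMap.id y) j =
      f ((b.baseChange Q).repr y j) := by
  induction y using TensorProduct.induction_on with
  | zero => simp
  | add y z hy hz => simp [hy, hz]
  | tmul q x => simp

theorem map_tensorProductEnd (f : Q →ₐ[k] Q') (a : Q ⊗[k] Module.End k X) (y : Q ⊗[k] X) :
    TensorProduct.map f.toLinearMap LinearMap.id (LinearMap.tensorProductEnd k Q X a y) =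
      LinearMap.tensorProductEnd k Q' X (Algebra.TensorProduct.map f (AlgHom.id k _) a)
        (TensorProduct.map f.toLinearMap LinearMap.id y) := by
  induction a using TensorProduct.induction_on with
  | zero => simp
  | add a b ha hb => simp only [map_add, LinearMap.add_apply, ha, hb]
  | tmul q t =>
    induction y using TensorProduct.induction_on with
    | zero => simp
    | add y z hy hz => simp only [map_add, hy, hz]
    | tmul r x =>
      rw [Algebra.TensorProduct.map_tmul, tensorProductEnd_tmul_tmul]
      simp [tensorProductEnd_tmul_tmul, -LinearMap.tensorProductEnd_apply]

variable {b}

theorem tmul_mem_homogeneousSpan {δ : J → ℕ} {m : ℕ} {x : X} (hx : x ∈ homogeneousSpan b δ m)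
    (q : Q) : q ⊗ₜ[k] x ∈ homogeneousSpan (b.baseChange Q) δ m := by
  refine mem_homogeneousSpan.2 fun j hj => mem_homogeneousSpan.1 hx j fun h => hj ?_
  simp [h]

theorem tensorProductEnd_mem_homogeneousSpan {δ : J → ℕ} {m n : ℕ} {t : Module.End k X}
    (ht : ∀ x ∈ homogeneousSpan b δ m, t x ∈ homogeneousSpan b δ n) (q : Q) {y : Q ⊗[k] X}
    (hy : y ∈ homogeneousSpan (b.baseChange Q) δ m) :
    LinearMap.tensorProductEnd k Q X (q ⊗ₜ t) y ∈ homogeneousSpan (b.baseChange Q) δ n := by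
  have hle : homogeneousSpan (b.baseChange Q) δ m ≤ (homogeneousSpan (b.baseChange Q) δ n).comap
      (LinearMap.tensorProductEnd k Q X (q ⊗ₜ t)) := by
    rw [homogeneousSpan, Submodule.span_le]
    rintro _ ⟨j, hj, rfl⟩
    rw [SetLike.mem_coe, Submodule.mem_comap, Module.Basis.baseChange_apply,
      tensorProductEnd_tmul_tmul]
    exact tmul_mem_homogeneousSpan (ht _ (Submodule.subset_span ⟨j, hj, rfl⟩)) _
  exact hle hy

end BaseChange

namespace DifferenceSystem

open SymExt

variable {k P V σ : Type*} [CommRing k] [CommGroup P] [DecidableEq P] [AddCommGroup V] [Module k V]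
  [Fintype P] [LinearOrder σ] (𝒟 : DifferenceSystem k P V σ)
  {Q : Type*} [CommRing Q] [Algebra k Q]

theorem tensorProductEnd_differential_mem_homogeneousSpan (z : P → Q) (c : P → P → Q) {m : ℕ}
    {y : Q ⊗[k] SymExt k V}
    (hy : y ∈ homogeneousSpan ((SymExt.basis 𝒟.basis).baseChange Q)
      (monomialDegree Finset.card) m) :
    LinearMap.tensorProductEnd k Q _ (𝒟.differential z c) y ∈
      homogeneousSpan ((SymExt.basis 𝒟.basis).baseChange Q)
        (monomialDegree Finset.card) (m + 1) := by
  rw [differential, map_add, map_sum, map_sum, LinearMap.add_apply, LinearMap.sum_apply,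
    LinearMap.sum_apply]
  refine Submodule.add_mem _ (Submodule.sum_mem _ fun h _ => ?_)
    (Submodule.sum_mem _ fun h _ => ?_)
  · refine tensorProductEnd_mem_homogeneousSpan (fun x hx => ?_) _ hy
    rw [← graded_eq_homogeneousSpan] at hx ⊢
    exact wedge_mem_graded _ hx
  · refine tensorProductEnd_mem_homogeneousSpan (fun x hx => ?_) _ hy
    rw [← graded_eq_homogeneousSpan] at hx ⊢
    exact times_contract_mem_graded _ _ hx

theorem isMatrixFactorization_differential [Fintype σ] {z : P → Q} {c : P → P → Q} {w : P → Q}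
    (hw : ∀ h, ∑ g, c h g * (z (h * g) - z (h * g * 𝒟.ψ)) = w h - 1) :
    IsMatrixFactorization ((SymExt.basis 𝒟.basis).baseChange Q) Finset.card
      (fun i => LinearMap.tensorProductEnd k Q _ (1 ⊗ₜ times (𝒟.basis i)))
      (LinearMap.tensorProductEnd k Q _ (𝒟.differential z c))
      (fun i => w (𝒟.l i) - w (𝒟.l i * 𝒟.ψ)) where
  variable_basis i j := by
    rw [Module.Basis.baseChange_apply, Module.Basis.baseChange_apply, tensorProductEnd_tmul_tmul,
      times_basis, mul_one]
  commute i := (𝒟.commute_differential_times z c (𝒟.basis i)).map _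
  mul_self := by
    rw [← map_mul, 𝒟.differential_mul_self_of_sum_eq hw, map_sum]
    refine Finset.sum_congr rfl fun i _ => ?_
    rw [← map_smul, TensorProduct.smul_tmul', smul_eq_mul, mul_one]
  apply_mem _ _ := 𝒟.tensorProductEnd_differential_mem_homogeneousSpan z c

end DifferenceSystem

/-! ### Koszul complexes over group rings -/

open MonoidAlgebra

section CoeffAt

variable {k U X : Type*} [CommRing k] [AddCommGroup X] [Module k X]

/-- The coefficient at `u` of an element of the group ring with coefficients in `X`. -/
def coeffAt (u : U) : MonoidAlgebra k U ⊗[k] X →ₗ[k] X :=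
  TensorProduct.lift
    { toFun f := f.coeff u • LinearMap.id
      map_add' f g := by simp [add_smul]
      map_smul' c f := by simp [mul_smul] }

@[simp]
theorem coeffAt_tmul (u : U) (f : MonoidAlgebra k U) (x : X) :
    coeffAt u (f ⊗ₜ x) = f.coeff u • x := rfl

section Fintype

variable [Fintype U]

theorem sum_coeff_smul_single (f : MonoidAlgebra k U) :
    ∑ u, f.coeff u • single u (1 : k) = f := by
  classical
  ext v
  simp [coeff_sum]

theorem sum_single_tmul_coeffAt (y : MonoidAlgebra k U ⊗[k] X) :
    ∑ u, single u (1 : k) ⊗ₜ[k] coeffAt u y = y := by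
  induction y using TensorProduct.induction_on with
  | zero => simp
  | add y z hy hz => simp [TensorProduct.tmul_add, Finset.sum_add_distrib, hy, hz]
  | tmul f x =>
    simp only [coeffAt_tmul, ← TensorProduct.smul_tmul]
    rw [← TensorProduct.sum_tmul, sum_coeff_smul_single]

theorem coeffAt_sum_single_tmul (F : U → X) (u : U) :
    coeffAt u (∑ v, single v (1 : k) ⊗ₜ[k] F v) = F u := by
  classical
  simp [Finsupp.single_apply]

end Fintype

theorem eq_zero_of_coeffAt_eq_zero [Finite U] {y : MonoidAlgebra k U ⊗[k] X}
    (h : ∀ u, coeffAt u y = 0) : y = 0 := by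
  have := Fintype.ofFinite U
  rw [← sum_single_tmul_coeffAt y]
  simp [h]

theorem coeffAt_mem_homogeneousSpan [CommMonoid U] {J : Type*} {b : Module.Basis J k X}
    {δ : J → ℕ} {m : ℕ} {y : MonoidAlgebra k U ⊗[k] X}
    (hy : y ∈ homogeneousSpan (b.baseChange (MonoidAlgebra k U)) δ m) (u : U) :
    coeffAt u y ∈ homogeneousSpan b δ m := by
  rw [← (b.baseChange _).linearCombination_repr y, Finsupp.linearCombination_apply, Finsupp.sum,
    map_sum]
  refine Submodule.sum_mem _ fun j hj => ?_
  rw [Module.Basis.baseChange_apply, TensorProduct.smul_tmul', coeffAt_tmul]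
  exact Submodule.smul_mem _ _ (Submodule.subset_span
    ⟨j, mem_homogeneousSpan.1 hy j (Finsupp.mem_support_iff.1 hj), rfl⟩)

theorem coeffAt_tensorProductEnd [CommGroup U] [Fintype U]
    (a : MonoidAlgebra k U ⊗[k] Module.End k X) (y : MonoidAlgebra k U ⊗[k] X) (u : U) :
    coeffAt u (LinearMap.tensorProductEnd k (MonoidAlgebra k U) X a y) =
      convolve (fun v => coeffAt (X := Module.End k X) v a) (fun v => coeffAt v y) u := by
  classical
  rw [convolve]
  induction a using TensorProduct.induction_on with
  | zero => simp
  | add a b ha hb => simp only [map_add, LinearMap.add_apply, ha, hb, Finset.sum_add_distrib]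
  | tmul f t =>
    induction y using TensorProduct.induction_on with
    | zero => simp
    | add y z hy hz => simp only [map_add, hy, hz, Finset.sum_add_distrib]
    | tmul g x =>
      rw [tensorProductEnd_tmul_tmul]
      simp only [coeffAt_tmul, LinearMap.smul_apply, map_smul, smul_smul]
      rw [← Finset.sum_smul]
      congr 1
      rw [coeff_mul_apply_left]
      rw [Finsupp.sum_fintype _ _ (by simp)]
      exact Finset.sum_congr rfl fun v _ => mul_comm _ _

end CoeffAt

section BaseChange

variable {k X J : Type*} [CommRing k] [AddCommGroup X] [Module k X] {b : Module.Basis J k X}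
  {Q Q' : Type*} [CommRing Q] [Algebra k Q] [CommRing Q'] [Algebra k Q'] {f : Q →ₐ[k] Q'}

theorem map_eq_zero_iff_mem_coeffIn {σ C : Type*} (b : Module.Basis ((σ →₀ ℕ) × C) k X)
    [Fintype σ] {y : Q ⊗[k] X} :
    TensorProduct.map f.toLinearMap LinearMap.id y = 0 ↔
      y ∈ coeffIn (b.baseChange Q) (RingHom.ker f) Finset.univ := by
  simp only [mem_coeffIn, Finset.subset_univ, true_implies, RingHom.mem_ker,
    ← repr_baseChange_map b f]
  rw [← LinearEquiv.map_eq_zero_iff (b.baseChange Q').repr, Finsupp.ext_iff]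
  rfl

variable (f) in
theorem map_mem_homogeneousSpan {δ : J → ℕ} {m : ℕ} {y : Q ⊗[k] X}
    (hy : y ∈ homogeneousSpan (b.baseChange Q) δ m) :
    TensorProduct.map f.toLinearMap LinearMap.id y ∈ homogeneousSpan (b.baseChange Q') δ m := by
  refine mem_homogeneousSpan.2 fun j hj => mem_homogeneousSpan.1 hy j fun h => hj ?_
  rw [repr_baseChange_map, h, map_zero]

theorem map_smul_eq_smul_map (q : Q) (y : Q ⊗[k] X) :
    TensorProduct.map f.toLinearMap LinearMap.id (q • y) =
      f q • TensorProduct.map f.toLinearMap LinearMap.id y := by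
  induction y using TensorProduct.induction_on with
  | zero => simp
  | add y z hy hz => simp only [smul_add, map_add, hy, hz]
  | tmul q' x => simp [TensorProduct.smul_tmul']

theorem exists_map_eq_of_mem_homogeneousSpan (hf : Function.Surjective f) {δ : J → ℕ} {m : ℕ}
    {v : Q' ⊗[k] X} (hv : v ∈ homogeneousSpan (b.baseChange Q') δ m) :
    ∃ y ∈ homogeneousSpan (b.baseChange Q) δ m,
      TensorProduct.map f.toLinearMap LinearMap.id y = v := by
  rw [homogeneousSpan] at hv
  induction hv using Submodule.span_induction with
  | zero => exact ⟨0, Submodule.zero_mem _, map_zero _⟩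
  | add v w _ _ hv hw =>
    obtain ⟨y, hy, rfl⟩ := hv
    obtain ⟨z, hz, rfl⟩ := hw
    exact ⟨y + z, Submodule.add_mem _ hy hz, map_add _ _ _⟩
  | mem v hv =>
    obtain ⟨j, hj, rfl⟩ := hv
    exact ⟨b.baseChange Q j, Submodule.subset_span ⟨j, hj, rfl⟩, by simp⟩
  | smul q v _ hv =>
    obtain ⟨y, hy, rfl⟩ := hv
    obtain ⟨q, rfl⟩ := hf q
    exact ⟨q • y, Submodule.smul_mem _ _ hy, map_smul_eq_smul_map q y⟩

end BaseChange

section Augmentation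

variable {k L U : Type*} [CommRing k] [Monoid L] [Monoid U]

theorem mapDomainAlgHom_surjective {r : L →* U} (hr : Function.Surjective r) :
    Function.Surjective (mapDomainAlgHom k k r) := by
  intro f
  induction f using MonoidAlgebra.induction_linear with
  | zero => exact ⟨0, map_zero _⟩
  | add f g hf hg =>
    obtain ⟨f, rfl⟩ := hf
    obtain ⟨g, rfl⟩ := hg
    exact ⟨f + g, map_add _ _ _⟩
  | single u c =>
    obtain ⟨a, rfl⟩ := hr u
    exact ⟨single a c, by simp⟩

variable (k L) in
/-- The augmentation of the group ring. -/
def augmentation : MonoidAlgebra k L →ₐ[k] k := MonoidAlgebra.lift k k L 1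

@[simp]
theorem augmentation_single (a : L) (c : k) : augmentation k L (single a c) = c := by
  simp [augmentation]

theorem augmentation_mapDomain (r : L →* U) (f : MonoidAlgebra k L) :
    augmentation k U (mapDomain r f) = augmentation k L f := by
  induction f using MonoidAlgebra.induction_linear with
  | zero => simp
  | add f g hf hg => rw [mapDomain_add, map_add, map_add, hf, hg]
  | single a c => simp

theorem sum_coeff [Fintype U] (f : MonoidAlgebra k U) : ∑ u, f.coeff u = augmentation k U f := by
  conv_rhs => rw [← sum_coeff_smul_single f]
  simp

end Augmentation

namespace DifferenceSystem

variable {k P V σ : Type*} [CommRing k] [CommGroup P] [DecidableEq P] [AddCommGroup V] [Module k V]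
  [Fintype P]

/-- Data for a twisted Koszul complex over the group ring of a lattice `L` on which `P` acts: the
orbit of `z` gives the Koszul differential, and the twist by `c` makes its square the element
belonging to the orbit of `w`. -/
structure KoszulDatum (𝒟 : DifferenceSystem k P V σ) (L : Type*) [CommGroup L] where
  χ : P →* MulAut L
  z : L
  w : L
  c : P → MonoidAlgebra k L
  sum_mul_eq : ∑ g, c g * (single (χ g z) 1 - single (χ (g * 𝒟.ψ) z) 1) = single w 1 - 1
  sum_augmentation_eq : ∀ h, ∑ g, augmentation k L (c g) • 𝒟.ev (h * g) =
    ∑ g, augmentation k L (c g) • 𝒟.ev (h * 𝒟.ψ * g)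

namespace KoszulDatum

open SymExt

variable {𝒟 : DifferenceSystem k P V σ} {L U : Type*} [CommGroup L] [CommGroup U]
  (𝒦 : 𝒟.KoszulDatum L) (r : L →* U)

/-- The differences of elements in the orbit of `a` which belong to the basis of `𝒟`, written
multiplicatively. -/
def difference (a : L) (i : σ) : L := 𝒦.χ (𝒟.l i) a / 𝒦.χ (𝒟.l i * 𝒟.ψ) a

/-- The image in `k[U]` of the `h`-translate of `z`. -/
def vertex (h : P) : MonoidAlgebra k U := single (r (𝒦.χ h 𝒦.z)) 1

/-- The image in `k[U]` of the `h`-translate of `c`. -/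
def twist (h g : P) : MonoidAlgebra k U := mapDomain (r.comp (𝒦.χ h).toMonoidHom) (𝒦.c g)

/-- The differential over `k[U]` of the twisted Koszul complex belonging to `𝒦`. -/
def differential : MonoidAlgebra k U ⊗[k] Module.End k (SymExt k V) :=
  𝒟.differential (𝒦.vertex r) (𝒦.twist r)

theorem sum_twist_mul (h : P) :
    ∑ g, 𝒦.twist r h g * (𝒦.vertex r (h * g) - 𝒦.vertex r (h * g * 𝒟.ψ)) =
      single (r (𝒦.χ h 𝒦.w)) 1 - 1 := by
  have := congrArg (mapDomainAlgHom k k (r.comp (𝒦.χ h).toMonoidHom)) 𝒦.sum_mul_eq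
  simp only [map_sum, map_mul, map_sub, map_one, mapDomainAlgHom_apply, mapDomain_single] at this
  simp only [twist, vertex, mul_assoc, map_mul]
  exact this

theorem map_differential_id :
    Algebra.TensorProduct.map (mapDomainAlgHom k k r) (AlgHom.id k _)
      (𝒦.differential (MonoidHom.id L)) = 𝒦.differential r := by
  rw [differential, 𝒟.map_differential, differential]
  congr 1
  · funext h
    simp [vertex]
  · funext h g
    refine coeff_injective ?_
    simp only [twist, mapDomainAlgHom_apply, coeff_mapDomain, ← Finsupp.mapDomain_comp]
    rfl

theorem differential_mul_self_eq_zero [Finite σ] (hr : ∀ i, 𝒦.difference 𝒦.w i ∈ r.ker) :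
    𝒦.differential r * 𝒦.differential r = 0 := by
  have := Fintype.ofFinite σ
  rw [differential, 𝒟.differential_mul_self_of_sum_eq (𝒦.sum_twist_mul r)]
  refine Finset.sum_eq_zero fun i _ => ?_
  have hi : r (𝒦.χ (𝒟.l i) 𝒦.w) = r (𝒦.χ (𝒟.l i * 𝒟.ψ) 𝒦.w) := by
    rw [← div_eq_one, ← map_div]
    exact hr i
  rw [hi, sub_self, TensorProduct.zero_tmul]

theorem augmentation_twist (h g : P) :
    augmentation k U (𝒦.twist r h g) = augmentation k L (𝒦.c g) :=
  augmentation_mapDomain _ _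

end KoszulDatum

namespace KoszulDatum

open SymExt

section Exact

variable {𝒟 : DifferenceSystem k P V σ} {L U : Type*} [CommGroup L]
  [CommGroup U] (𝒦 : 𝒟.KoszulDatum L) {r : L →* U}

theorem span_range_single_sub_single_eq_ker
    (hker : r.ker = Subgroup.closure (Set.range (𝒦.difference 𝒦.w))) :
    Ideal.span (Set.range fun i => single (𝒦.χ (𝒟.l i) 𝒦.w) (1 : k) -
      single (𝒦.χ (𝒟.l i * 𝒟.ψ) 𝒦.w) 1) = RingHom.ker (mapDomainAlgHom k k r) := by
  ext q
  rw [← Set.image_univ] at hker ⊢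
  exact mem_span_single_sub_single_iff _ _ _ _ hker

theorem map_mapDomain_tensorProductEnd (y : MonoidAlgebra k L ⊗[k] SymExt k V) :
    TensorProduct.map (mapDomainAlgHom k k r).toLinearMap LinearMap.id
        (LinearMap.tensorProductEnd k _ _ (𝒦.differential (MonoidHom.id L)) y) =
      LinearMap.tensorProductEnd k _ _ (𝒦.differential r)
        (TensorProduct.map (mapDomainAlgHom k k r).toLinearMap LinearMap.id y) := by
  rw [map_tensorProductEnd, 𝒦.map_differential_id]

variable [LinearOrder σ]

theorem map_mapDomain_eq_zero_iff [Fintype σ]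
    (hker : r.ker = Subgroup.closure (Set.range (𝒦.difference 𝒦.w)))
    {y : MonoidAlgebra k L ⊗[k] SymExt k V} :
    TensorProduct.map (mapDomainAlgHom k k r).toLinearMap LinearMap.id y = 0 ↔
      y ∈ coeffIn ((SymExt.basis 𝒟.basis).baseChange (MonoidAlgebra k L))
        (Ideal.span (Set.range fun i => single (𝒦.χ (𝒟.l i) 𝒦.w) (1 : k) -
          single (𝒦.χ (𝒟.l i * 𝒟.ψ) 𝒦.w) 1)) Finset.univ := by
  rw [𝒦.span_range_single_sub_single_eq_ker hker]
  exact map_eq_zero_iff_mem_coeffIn (f := mapDomainAlgHom k k r) (SymExt.basis 𝒟.basis)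

theorem exists_tensorProductEnd_differential_eq [Finite σ]
    (hr : Function.Surjective r)
    (hker : r.ker = Subgroup.closure (Set.range (𝒦.difference 𝒦.w)))
    (hind : IsIndependentFamily (𝒦.difference 𝒦.w)) {m : ℕ}
    {v : MonoidAlgebra k U ⊗[k] SymExt k V}
    (hv : v ∈ homogeneousSpan ((SymExt.basis 𝒟.basis).baseChange (MonoidAlgebra k U))
      (monomialDegree Finset.card) (m + 1))
    (hDv : LinearMap.tensorProductEnd k _ _ (𝒦.differential r) v = 0) :
    ∃ u ∈ homogeneousSpan ((SymExt.basis 𝒟.basis).baseChange (MonoidAlgebra k U))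
      (monomialDegree Finset.card) m,
      LinearMap.tensorProductEnd k _ _ (𝒦.differential r) u = v := by
  have := Fintype.ofFinite σ
  obtain ⟨y, hy, rfl⟩ := exists_map_eq_of_mem_homogeneousSpan (mapDomainAlgHom_surjective hr) hv
  have hDy := (𝒦.map_mapDomain_eq_zero_iff hker).1
    ((𝒦.map_mapDomain_tensorProductEnd y).trans hDv)
  obtain ⟨u, hu, hyu⟩ := (𝒟.isMatrixFactorization_differential
    (𝒦.sum_twist_mul (MonoidHom.id L))).exists_sub_apply_mem_coeffIn
      (isRegularFamily_single_sub_single k hind) Finset.card_le_univ hy hDy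
  refine ⟨_, map_mem_homogeneousSpan (mapDomainAlgHom k k r) hu, ?_⟩
  have hsub := (𝒦.map_mapDomain_eq_zero_iff hker).2 hyu
  rw [map_sub, sub_eq_zero] at hsub
  exact (𝒦.map_mapDomain_tensorProductEnd u).symm.trans hsub.symm

end Exact

end KoszulDatum

end DifferenceSystem

/-- The action by automorphisms given by an action of a group by endomorphisms, written
multiplicatively. -/
def mulAutOfAddEnd {G M : Type*} [Group G] [AddCommGroup M] (f : G →* AddMonoid.End M) :
    G →* MulAut (Multiplicative M) where
  toFun g :=
    { toFun m := Multiplicative.ofAdd (f g m.toAdd)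
      invFun m := Multiplicative.ofAdd (f g⁻¹ m.toAdd)
      left_inv m := by
        change Multiplicative.ofAdd ((f g⁻¹ * f g) m.toAdd) = m
        rw [← map_mul, inv_mul_cancel, map_one]
        rfl
      right_inv m := by
        change Multiplicative.ofAdd ((f g * f g⁻¹) m.toAdd) = m
        rw [← map_mul, mul_inv_cancel, map_one]
        rfl
      map_mul' a b := map_add (f g) _ _ }
  map_one' := by
    ext m
    simp
  map_mul' g h := by
    ext m
    exact DFunLike.congr_fun (map_mul f g h) m.toAdd

section GroupRing

variable {k L ι : Type*} [CommRing k] [CommGroup L] [Fintype ι]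

theorem single_div_sub_one (a b : L) : (single (a / b) 1 - 1 : MonoidAlgebra k L) =
    single b⁻¹ 1 * (single a 1 - single b 1) := by
  rw [mul_sub, single_mul_single, single_mul_single, mul_one, inv_mul_cancel, one_def,
    div_eq_inv_mul]

theorem exists_sum_mul_eq_single_sub_one (a b : ι → L) {w : L}
    (hw : w ∈ Subgroup.closure (Set.range fun i => a i / b i)) :
    ∃ c : ι → MonoidAlgebra k L,
      ∑ i, c i * (single (a i) 1 - single (b i) 1) = single w 1 - 1 := by
  rw [← Ideal.mem_span_range_iff_exists_fun]
  induction hw using Subgroup.closure_induction with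
  | mem w hw =>
    obtain ⟨i, rfl⟩ := hw
    dsimp only
    rw [single_div_sub_one]
    exact Ideal.mul_mem_left _ _ (Ideal.subset_span ⟨i, rfl⟩)
  | one => rw [one_def, sub_self]; exact zero_mem _
  | mul u v _ _ hu hv =>
    have h : (single (u * v) 1 - 1 : MonoidAlgebra k L) =
        single u 1 * (single v 1 - 1) + (single u 1 - 1) := by
      rw [mul_sub, single_mul_single, mul_one, mul_one]
      abel
    rw [h]
    exact add_mem (Ideal.mul_mem_left _ _ hv) hu
  | inv u _ hu =>
    have h : (single u⁻¹ 1 - 1 : MonoidAlgebra k L) = -single u⁻¹ 1 * (single u 1 - 1) := by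
      rw [neg_mul, mul_sub, single_mul_single, mul_one, mul_one, inv_mul_cancel, one_def]
      abel
    rw [h]
    exact Ideal.mul_mem_left _ _ hu

/-- The character `1 + ε f` with values in the dual numbers given by an additive map `f`. -/
def dualNumberCharacter (f : Additive L →+ k) : L →* DualNumber k where
  toFun l := 1 + TrivSqZeroExt.inr (f (Additive.ofMul l))
  map_one' := by simp
  map_mul' u v := by
    rw [ofMul_mul, map_add, TrivSqZeroExt.inr_add, mul_add, add_mul, add_mul,
      TrivSqZeroExt.inr_mul_inr]
    simp
    abel

theorem fst_lift_dualNumberCharacter (f : Additive L →+ k) (y : MonoidAlgebra k L) :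
    (MonoidAlgebra.lift k (DualNumber k) L (dualNumberCharacter f) y).fst =
      augmentation k L y := by
  have h : (TrivSqZeroExt.fstHom k k k).comp
      (MonoidAlgebra.lift k (DualNumber k) L (dualNumberCharacter f)) = augmentation k L :=
    MonoidAlgebra.algHom_ext (fun l => by simp [dualNumberCharacter, augmentation_single])
      (Subsingleton.elim _ _)
  exact DFunLike.congr_fun h y

theorem sum_augmentation_mul_sub_eq (a b : ι → L) {w : L} (c : ι → MonoidAlgebra k L)
    (hc : ∑ i, c i * (single (a i) 1 - single (b i) 1) = single w 1 - 1) (f : Additive L →+ k) :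
    ∑ i, augmentation k L (c i) * (f (Additive.ofMul (a i)) - f (Additive.ofMul (b i))) =
      f (Additive.ofMul w) := by
  -- compare the coefficients of `ε` after applying the character `1 + ε f`
  set D := MonoidAlgebra.lift k (DualNumber k) L (dualNumberCharacter f) with hD
  have hsingle (l : L) : D (single l 1) = 1 + TrivSqZeroExt.inr (f (Additive.ofMul l)) := by
    simp [D, dualNumberCharacter]
  have hsnd (y : DualNumber k) : y.snd = TrivSqZeroExt.sndHom k k y := rfl
  have h := congrArg (fun y => (D y).snd) hc
  simp only [map_sum, map_mul, map_sub, hsingle, map_one, add_sub_cancel_left,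
    add_sub_add_left_eq_sub] at h
  rw [hsnd, map_sum] at h
  simpa [hD, fst_lift_dualNumberCharacter] using h

end GroupRing

/-! ### The coresolution of the coset functions -/

theorem forall_inv_mul_eq_iff {U X ι : Type*} [CommGroup U] {f : U → X} {x y : ι → U} :
    (∀ u i, f ((x i)⁻¹ * u) = f ((y i)⁻¹ * u)) ↔
      ∀ a ∈ Subgroup.closure (Set.range fun i => x i / y i), ∀ u, f (a * u) = f u := by
  constructor
  · intro h a ha
    induction ha using Subgroup.closure_induction with
    | mem a ha =>
      obtain ⟨i, rfl⟩ := ha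
      intro u
      have := h (x i * u) i
      rw [inv_mul_cancel_left] at this
      simp only [this, div_eq_inv_mul, mul_assoc]
    | one => simp
    | mul a b _ _ ha hb =>
      intro u
      rw [mul_assoc, ha, hb]
    | inv a _ ha =>
      intro u
      rw [← ha (a⁻¹ * u), mul_inv_cancel_left]
  · intro h u i
    rw [← h _ (Subgroup.subset_closure ⟨i, rfl⟩), ← mul_assoc, div_mul_eq_mul_div, mul_inv_cancel,
      one_div]

/-- The subgroup `A ⋊ P` of `U ⋊ P`. -/
def semidirectSubgroup {U P : Type*} [Group U] [Group P] (φ : P →* MulAut U) (A : Subgroup U)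
    (hA : ∀ g, ∀ a ∈ A, φ g a ∈ A) : Subgroup (U ⋊[φ] P) where
  carrier := {x | x.left ∈ A}
  mul_mem' hx hy := A.mul_mem hx (hA _ _ hy)
  one_mem' := A.one_mem
  inv_mem' hx := hA _ _ (A.inv_mem hx)

namespace DifferenceSystem

open SymExt

section SumWedge

variable {k P V σ : Type*} [CommRing k] [CommGroup P] [DecidableEq P] [AddCommGroup V] [Module k V]
  [Fintype P] [Finite σ] (𝒟 : DifferenceSystem k P V σ)

theorem sum_wedge_eq_zero_iff {q : P → SymExt k V} (hq : ∀ h, q h ∈ graded k V 0) :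
    ∑ h, wedge (𝒟.e h) (q h) = 0 ↔ ∀ i, q (𝒟.l i) = q (𝒟.l i * 𝒟.ψ) := by
  have := Fintype.ofFinite σ
  constructor
  · intro h i
    have hcontract (g) : contract (𝒟.ev (𝒟.l i)) (wedge (𝒟.e g) (q g)) =
        𝒟.ev (𝒟.l i) (𝒟.e g) • q g := by
      rw [contract_wedge, contract_eq_zero _ (hq g), map_zero, sub_zero]
    have := congrArg (contract (𝒟.ev (𝒟.l i))) h
    simp only [map_sum, map_zero, hcontract] at this
    rwa [𝒟.sum_ev_e_smul q, sub_eq_zero] at this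
  · intro h
    have := congrArg (TensorProduct.lift (wedge (k := k) (V := V)).flip) (𝒟.sum_tmul_e q)
    simpa [h] using this

end SumWedge

namespace KoszulDatum

section Operator

variable {k P V σ : Type*} [CommRing k] [CommGroup P] [DecidableEq P] [AddCommGroup V] [Module k V]
  [Fintype P] {𝒟 : DifferenceSystem k P V σ} {L U : Type*} [CommGroup L] [CommGroup U]
  (𝒦 : 𝒟.KoszulDatum L) (r : L →* U)

/-- The coefficient at `u` of the differential of the twisted Koszul complex. -/
def operator (u : U) : Module.End k (SymExt k V) :=
  coeffAt (X := Module.End k (SymExt k V)) u (𝒦.differential r)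

theorem operator_eq (u : U) : 𝒦.operator r u =
    ∑ h, (𝒦.vertex r h).coeff u • wedge (𝒟.e h) +
      ∑ y : P × P, (𝒦.twist r y.1 y.2).coeff u •
        (times (𝒟.e y.1) * contract (𝒟.ev (y.1 * y.2))) := by
  rw [operator, differential, DifferenceSystem.differential, map_add, map_sum, map_sum]
  rfl

theorem operator_mem_graded (u : U) {m : ℕ} {w : SymExt k V} (hw : w ∈ graded k V m) :
    𝒦.operator r u w ∈ graded k V (m + 1) := by
  rw [operator_eq, LinearMap.add_apply, LinearMap.sum_apply, LinearMap.sum_apply]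
  exact Submodule.add_mem _
    (Submodule.sum_mem _ fun h _ => Submodule.smul_mem _ _ (wedge_mem_graded _ hw))
    (Submodule.sum_mem _ fun h _ => Submodule.smul_mem _ _ (times_contract_mem_graded _ _ hw))

theorem operator_apply_of_mem_graded_zero (u : U) {w : SymExt k V} (hw : w ∈ graded k V 0) :
    𝒦.operator r u w = ∑ h, (𝒦.vertex r h).coeff u • wedge (𝒟.e h) w := by
  rw [operator_eq, LinearMap.add_apply, LinearMap.sum_apply, LinearMap.sum_apply]
  simp [contract_eq_zero _ hw]

section Equivariance

variable {r} {φ : P →* MulAut U} (hχ : ∀ g a, r (𝒦.χ g a) = φ g (r a))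

include hχ

theorem vertex_mul (g h : P) : 𝒦.vertex r (g * h) = mapDomain (φ g) (𝒦.vertex r h) := by
  rw [vertex, vertex, mapDomain_single, map_mul, MulAut.mul_apply, hχ]

theorem twist_mul (g h h' : P) :
    𝒦.twist r (g * h) h' = mapDomain (φ g) (𝒦.twist r h h') := by
  refine coeff_injective ?_
  simp only [twist, coeff_mapDomain, ← Finsupp.mapDomain_comp]
  congr 1
  funext a
  simp [hχ]

theorem map_mul_operator (g : P) (u : U) :
    SymExt.map (𝒟.ρ g) * 𝒦.operator r u = 𝒦.operator r (φ g u) * SymExt.map (𝒟.ρ g) := by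
  have hcoeff (f : MonoidAlgebra k U) : (mapDomain (φ g) f).coeff (φ g u) = f.coeff u :=
    Finsupp.mapDomain_apply (φ g).injective _ _
  rw [operator_eq, operator_eq, mul_add, add_mul, Finset.mul_sum, Finset.mul_sum, Finset.sum_mul,
    Finset.sum_mul]
  congr 1
  · refine Eq.trans (Finset.sum_congr rfl fun h _ => ?_) (Equiv.sum_comp (Equiv.mulLeft g) _)
    rw [Equiv.coe_mulLeft, 𝒦.vertex_mul hχ, hcoeff, mul_smul_comm, smul_mul_assoc, map_mul_wedge,
      𝒟.ρ_e]
  · refine Eq.trans (Finset.sum_congr rfl fun y _ => ?_)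
      (Equiv.sum_comp ((Equiv.mulLeft g).prodCongr (Equiv.refl P)) _)
    simp only [Equiv.prodCongr_apply, Prod.map_fst, Prod.map_snd, Equiv.coe_mulLeft,
      Equiv.refl_apply]
    rw [𝒦.twist_mul hχ, hcoeff, mul_smul_comm, smul_mul_assoc, ← mul_assoc, map_mul_times,
      mul_assoc, ← 𝒟.ev_ρ g, map_mul_contract, 𝒟.ρ_e, mul_assoc, mul_assoc]

end Equivariance

theorem sum_smul_times_mul_contract [Finite σ] :
    ∑ h, ∑ g, augmentation k L (𝒦.c g) • (times (𝒟.e h) * contract (𝒟.ev (h * g))) = 0 := by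
  have := Fintype.ofFinite σ
  have hsum := 𝒟.sum_tmul_e fun h => ∑ g, augmentation k L (𝒦.c g) • 𝒟.ev (h * g)
  simp only [← 𝒦.sum_augmentation_eq, sub_self, TensorProduct.zero_tmul,
    Finset.sum_const_zero] at hsum
  simpa [Finset.mul_sum] using congrArg (TensorProduct.lift
    ((LinearMap.mul k (Module.End k (SymExt k V))).flip.compl₁₂ contract times)) hsum

variable [Fintype U]

theorem sum_operator [Finite σ] : ∑ u, 𝒦.operator r u = 0 := by
  have hwedge : ∑ h, wedge (k := k) (𝒟.e h) = 0 := by rw [← map_sum, 𝒟.sum_e, map_zero]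
  have hvertex (h : P) : augmentation k U (𝒦.vertex r h) = 1 := augmentation_single _ _
  simp only [operator_eq, Finset.sum_add_distrib]
  rw [Finset.sum_comm, Finset.sum_comm (s := (Finset.univ : Finset U))]
  simp only [← Finset.sum_smul, sum_coeff, hvertex, augmentation_twist, one_smul, hwedge, zero_add,
    Fintype.sum_prod_type]
  exact 𝒦.sum_smul_times_mul_contract

variable {r}

theorem convolve_operator_operator [Finite σ] (hr : ∀ i, 𝒦.difference 𝒦.w i ∈ r.ker)
    (F : U → SymExt k V) : convolve (𝒦.operator r) (convolve (𝒦.operator r) F) = 0 := by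
  funext u
  have := congrArg (fun t => coeffAt u (LinearMap.tensorProductEnd k _ _ t
    (∑ v, single v (1 : k) ⊗ₜ[k] F v))) (𝒦.differential_mul_self_eq_zero r hr)
  simp only [map_mul, Module.End.mul_apply, coeffAt_tensorProductEnd, coeffAt_sum_single_tmul,
    map_zero, LinearMap.zero_apply] at this
  exact this

theorem convolve_operator_of_mem_graded_zero {F : U → SymExt k V} (hF : ∀ u, F u ∈ graded k V 0)
    (u : U) : convolve (𝒦.operator r) F u =
      ∑ h, wedge (𝒟.e h) (F ((r (𝒦.χ h 𝒦.z))⁻¹ * u)) := by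
  classical
  simp only [convolve, 𝒦.operator_apply_of_mem_graded_zero r _ (hF _)]
  rw [Finset.sum_comm]
  simp [vertex, Finsupp.single_apply]

theorem convolve_operator_eq_zero_iff [Finite σ] {F : U → SymExt k V}
    (hF : ∀ u, F u ∈ graded k V 0) : convolve (𝒦.operator r) F = 0 ↔
      ∀ a ∈ Subgroup.closure (Set.range fun i => r (𝒦.difference 𝒦.z i)), ∀ u,
        F (a * u) = F u := by
  simp only [difference, map_div]
  rw [← forall_inv_mul_eq_iff, funext_iff]
  refine forall_congr' fun u => ?_
  rw [𝒦.convolve_operator_of_mem_graded_zero hF, Pi.zero_apply,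
    𝒟.sum_wedge_eq_zero_iff fun h => hF _]

variable [LinearOrder σ]

theorem exists_convolve_operator_eq [Finite σ] (hr : Function.Surjective r)
    (hker : r.ker = Subgroup.closure (Set.range (𝒦.difference 𝒦.w)))
    (hind : IsIndependentFamily (𝒦.difference 𝒦.w)) {m : ℕ} {F : U → SymExt k V}
    (hF : ∀ u, F u ∈ graded k V (m + 1)) (hDF : convolve (𝒦.operator r) F = 0) :
    ∃ F' : U → SymExt k V, (∀ u, F' u ∈ graded k V m) ∧ convolve (𝒦.operator r) F' = F := by
  simp only [graded_eq_homogeneousSpan 𝒟.basis] at hF ⊢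
  obtain ⟨v, hv, hDv⟩ := 𝒦.exists_tensorProductEnd_differential_eq hr hker hind
    (v := ∑ u, single u (1 : k) ⊗ₜ[k] F u)
    (Submodule.sum_mem _ fun u _ => tmul_mem_homogeneousSpan (hF u) _) (by
      refine eq_zero_of_coeffAt_eq_zero fun u => ?_
      rw [coeffAt_tensorProductEnd]
      simp only [coeffAt_sum_single_tmul]
      exact congrFun hDF u)
  refine ⟨fun u => coeffAt u v, fun u => coeffAt_mem_homogeneousSpan hv u, funext fun u => ?_⟩
  rw [← coeffAt_sum_single_tmul (k := k) F u, ← hDv, coeffAt_tensorProductEnd]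
  rfl

end Operator

end KoszulDatum

section GradedRep

open CategoryTheory SemidirectProduct coindComplement

universe u

variable {k P V σ : Type u} [Field k] [CommGroup P] [DecidableEq P] [AddCommGroup V] [Module k V]
  (𝒟 : DifferenceSystem k P V σ)

/-- The representation of `P` on the homogeneous elements of degree `m` of `Sym V ⊗ Λ V`. -/
def gradedRep (m : ℕ) : Rep.{u} k P :=
  Rep.of (X := graded k V m)
    { toFun g := (SymExt.map (𝒟.ρ g)).restrict fun _ h => map_mem_graded _ h
      map_one' := by
        ext w
        have : SymExt.map (𝒟.ρ 1) w.1 = w.1 := by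
          rw [map_one 𝒟.ρ]
          exact LinearMap.congr_fun SymExt.map_id w.1
        exact this
      map_mul' g h := by
        ext w
        have : SymExt.map (𝒟.ρ (g * h)) w.1 = SymExt.map (𝒟.ρ g) (SymExt.map (𝒟.ρ h) w.1) := by
          rw [map_mul 𝒟.ρ]
          exact LinearMap.congr_fun (SymExt.map_comp _ _) w.1
        exact this }

/-- The inclusion of the homogeneous elements of degree `m` in `Sym V ⊗ Λ V`. It keeps apart the
carrier of the representation and the submodule. -/
def incl (m : ℕ) : 𝒟.gradedRep m →ₗ[k] SymExt k V := (graded k V m).subtype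

theorem incl_mem (m : ℕ) (w : 𝒟.gradedRep m) : 𝒟.incl m w ∈ graded k V m := Subtype.property _

theorem incl_injective (m : ℕ) : Function.Injective (𝒟.incl m) := Subtype.val_injective

theorem incl_ρ (m : ℕ) (g : P) (w : 𝒟.gradedRep m) :
    𝒟.incl m ((𝒟.gradedRep m).ρ g w) = SymExt.map (𝒟.ρ g) (𝒟.incl m w) := rfl

theorem exists_incl_eq {m : ℕ} {w : SymExt k V} (hw : w ∈ graded k V m) :
    ∃ w', 𝒟.incl m w' = w :=
  ⟨(⟨w, hw⟩ : graded k V m), rfl⟩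

/-- The restriction of an operator of degree one to homogeneous elements. -/
def restrict (m : ℕ) (t : Module.End k (SymExt k V))
    (ht : ∀ w ∈ graded k V m, t w ∈ graded k V (m + 1)) :
    𝒟.gradedRep m →ₗ[k] 𝒟.gradedRep (m + 1) :=
  LinearMap.restrict t ht

/-- The unit element, as a homogeneous element of degree zero. -/
def unit : 𝒟.gradedRep 0 := (⟨1, one_mem_graded⟩ : graded k V 0)

theorem unit_ne_zero : 𝒟.unit ≠ 0 := fun h => one_ne_zero (congrArg (𝒟.incl 0) h)

theorem exists_smul_unit_eq (w : 𝒟.gradedRep 0) : ∃ c : k, c • 𝒟.unit = w := by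
  have hw := 𝒟.incl_mem 0 w
  rw [graded_zero, Submodule.mem_span_singleton] at hw
  obtain ⟨c, hc⟩ := hw
  exact ⟨c, 𝒟.incl_injective 0 ((map_smul _ _ _).trans hc)⟩

theorem gradedRep_zero_apply (g : P) (w : 𝒟.gradedRep 0) : (𝒟.gradedRep 0).ρ g w = w := by
  obtain ⟨c, rfl⟩ := 𝒟.exists_smul_unit_eq w
  rw [map_smul]
  congr 1
  exact 𝒟.incl_injective 0 ((𝒟.incl_ρ _ _ _).trans (SymExt.map_one _))

end GradedRep

section CosetFunctions

open CategoryTheory SemidirectProduct coindComplement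

universe u

variable {k P V σ U : Type u} [Field k] [CommGroup P] [DecidableEq P] [AddCommGroup V] [Module k V]
  (𝒟 : DifferenceSystem k P V σ) [CommGroup U] (φ : P →* MulAut U) (A : Subgroup U)
  (hA : ∀ g, ∀ a ∈ A, φ g a ∈ A)

/-- The embedding of the functions on the cosets of `A ⋊ P` in the functions on the cosets of
`P`. -/
def cosetFunctions :
    Rep.coind (semidirectSubgroup φ A hA).subtype (Rep.trivial k (semidirectSubgroup φ A hA) k) ⟶
      coindComplement φ (𝒟.gradedRep 0) :=
  Rep.ofHom
    { toFun f := ⟨fun x => f.1 x • 𝒟.unit, by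
        rintro ⟨_, g, rfl⟩ x
        have hf : f.1 (inr g * x) = f.1 x := f.2 ⟨inr g, A.one_mem⟩ x
        change f.1 (inr g * x) • 𝒟.unit = (𝒟.gradedRep 0).ρ g (f.1 x • 𝒟.unit)
        rw [gradedRep_zero_apply, hf]⟩
      map_add' f f' := Subtype.ext (funext fun x => add_smul (f.1 x) (f'.1 x) _)
      map_smul' c f := Subtype.ext (funext fun x => mul_smul c (f.1 x) _)
      isIntertwining' g := rfl }

theorem cosetFunctions_apply
    (f : Rep.coind (semidirectSubgroup φ A hA).subtype
      (Rep.trivial k (semidirectSubgroup φ A hA) k)) (x : U ⋊[φ] P) :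
    ((𝒟.cosetFunctions φ A hA).hom f).1 x = f.1 x • 𝒟.unit := rfl

theorem cosetFunctions_injective : Function.Injective (𝒟.cosetFunctions φ A hA).hom := by
  intro f f' h
  refine Subtype.ext (funext fun x => smul_left_injective k 𝒟.unit_ne_zero ?_)
  exact congrArg (fun f : coindComplement φ (𝒟.gradedRep 0) => f.1 x) h

variable {φ A} in
include hA in
theorem apply_mul_of_mem_semidirectSubgroup {f : coindComplement φ (𝒟.gradedRep 0)}
    (hf : ∀ a ∈ A, ∀ u, f.1 (inl (a * u)) = f.1 (inl u)) {s : U ⋊[φ] P}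
    (hs : s ∈ semidirectSubgroup φ A hA) (x : U ⋊[φ] P) : f.1 (s * x) = f.1 x := by
  have hP (g x) : f.1 (inr g * x) = f.1 x := by
    rw [apply_inr_mul, gradedRep_zero_apply]
  have hinl (x : U ⋊[φ] P) : f.1 x = f.1 (inl (φ x.right⁻¹ x.left)) := by
    rw [← hP x.right (inl _)]
    exact congrArg f.1 (by ext <;> simp)
  rw [hinl (s * x), hinl x]
  have : φ (s * x).right⁻¹ (s * x).left =
      φ (s * x).right⁻¹ s.left * φ x.right⁻¹ x.left := by simp
  rw [this, hf _ (hA _ _ hs)]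

theorem exists_cosetFunctions_eq_iff (f : coindComplement φ (𝒟.gradedRep 0)) :
    (∃ b, (𝒟.cosetFunctions φ A hA).hom b = f) ↔
      ∀ a ∈ A, ∀ u, f.1 (inl (a * u)) = f.1 (inl u) := by
  constructor
  · rintro ⟨b, rfl⟩ a ha u
    have hb : b.1 (inl a * inl u) = b.1 (inl u) := b.2 ⟨inl a, ha⟩ (inl u)
    rw [cosetFunctions_apply, cosetFunctions_apply, map_mul, hb]
  · intro h
    choose c hc using 𝒟.exists_smul_unit_eq
    exact ⟨⟨fun x => c (f.1 x), fun s x =>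
      congrArg c (𝒟.apply_mul_of_mem_semidirectSubgroup hA h s.2 x)⟩,
      Subtype.ext (funext fun x => hc _)⟩

end CosetFunctions

namespace KoszulDatum

open CategoryTheory coindComplement

universe u

variable {k P V σ L U : Type u} [Field k] [CommGroup P] [DecidableEq P] [AddCommGroup V]
  [Module k V] [Fintype P] {𝒟 : DifferenceSystem k P V σ} [CommGroup L] [CommGroup U]
  [Fintype U] (𝒦 : 𝒟.KoszulDatum L) {r : L →* U} {φ : P →* MulAut U}

variable (r) in
/-- The differential of degree `m` of the coresolution belonging to `𝒦`. -/
def gradedOperator (m : ℕ) (u : U) : 𝒟.gradedRep m →ₗ[k] 𝒟.gradedRep (m + 1) :=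
  𝒟.restrict m (𝒦.operator r u) fun _ h => 𝒦.operator_mem_graded r u h

theorem incl_convolve_gradedOperator {m : ℕ} (F : U → 𝒟.gradedRep m) :
    (fun u => 𝒟.incl (m + 1) (convolve (𝒦.gradedOperator r m) F u)) =
      convolve (𝒦.operator r) fun u => 𝒟.incl m (F u) :=
  funext fun _ => map_sum _ _ _

theorem convolve_gradedOperator_eq_iff {m : ℕ} {F : U → 𝒟.gradedRep m}
    {F' : U → 𝒟.gradedRep (m + 1)} :
    convolve (𝒦.gradedOperator r m) F = F' ↔
      convolve (𝒦.operator r) (fun u => 𝒟.incl m (F u)) = fun u => 𝒟.incl (m + 1) (F' u) := by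
  rw [← incl_convolve_gradedOperator]
  exact (𝒟.incl_injective (m + 1)).comp_left.eq_iff.symm

theorem convolve_gradedOperator_eq_zero_iff {m : ℕ} {F : U → 𝒟.gradedRep m} :
    convolve (𝒦.gradedOperator r m) F = 0 ↔
      convolve (𝒦.operator r) (fun u => 𝒟.incl m (F u)) = 0 := by
  rw [convolve_gradedOperator_eq_iff]
  simp only [Pi.zero_apply, map_zero]
  rfl

theorem exists_cosetFunctions_eq_iff_convolve_gradedOperator [Finite σ]
    (A : Subgroup U)
    (hA : ∀ g, ∀ a ∈ A, φ g a ∈ A)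
    (hAgen : A = Subgroup.closure (Set.range fun i => r (𝒦.difference 𝒦.z i)))
    (f : coindComplement φ (𝒟.gradedRep 0)) :
    (∃ b, (𝒟.cosetFunctions φ A hA).hom b = f) ↔
      convolve (𝒦.gradedOperator r 0) (equivFun φ (𝒟.gradedRep 0) f) = 0 := by
  rw [exists_cosetFunctions_eq_iff, convolve_gradedOperator_eq_zero_iff,
    𝒦.convolve_operator_eq_zero_iff fun u => 𝒟.incl_mem 0 _, ← hAgen]
  simp only [(𝒟.incl_injective 0).eq_iff]
  rfl

variable [Finite σ] [LinearOrder σ] (hr : Function.Surjective r)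
  (hχ : ∀ g a, r (𝒦.χ g a) = φ g (r a))
  (hker : r.ker = Subgroup.closure (Set.range (𝒦.difference 𝒦.w)))
  (hind : IsIndependentFamily (𝒦.difference 𝒦.w))

/-- The coresolution by the graded pieces of `Sym V ⊗ Λ V`, with the differentials of the twisted
Koszul complex. -/
def coresolution : ConvolutionCoresolution (k := k) φ where
  N := 𝒟.gradedRep
  A := 𝒦.gradedOperator r
  finite m := finite_graded 𝒟.basis m
  equivariant m g u := LinearMap.ext fun x => 𝒟.incl_injective _
    (LinearMap.congr_fun (𝒦.map_mul_operator hχ g u) (𝒟.incl m x))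
  sum_eq_zero m := LinearMap.ext fun x => 𝒟.incl_injective _ (by
    have := LinearMap.congr_fun (𝒦.sum_operator r) (𝒟.incl m x)
    rw [LinearMap.sum_apply] at this ⊢
    rw [map_sum]
    exact this)
  convolve_convolve m F := by
    rw [convolve_gradedOperator_eq_zero_iff, incl_convolve_gradedOperator]
    refine 𝒦.convolve_operator_operator (fun i => ?_) _
    rw [hker]
    exact Subgroup.subset_closure ⟨i, rfl⟩
  exact m F hF := by
    obtain ⟨F', hF', h⟩ := 𝒦.exists_convolve_operator_eq hr hker hind (fun u => 𝒟.incl_mem _ (F u))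
      (𝒦.convolve_gradedOperator_eq_zero_iff.1 hF)
    choose G hG using fun u => 𝒟.exists_incl_eq (hF' u)
    exact ⟨G, 𝒦.convolve_gradedOperator_eq_iff.2 (by simpa only [hG] using h)⟩

omit [Fintype U] in
include hr hχ hker hind in
theorem finrank_groupCohomology_semidirectSubgroup [Finite U] (A : Subgroup U)
    (hA : ∀ g, ∀ a ∈ A, φ g a ∈ A)
    (hAgen : A = Subgroup.closure (Set.range fun i => r (𝒦.difference 𝒦.z i))) (n : ℕ) :
    Module.finrank k (groupCohomology (Rep.trivial k (semidirectSubgroup φ A hA) k) n) =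
      diagonalDim (fun n m => Module.finrank k (groupCohomology (𝒟.gradedRep m) n)) n 0 := by
  have := Fintype.ofFinite U
  rw [← (groupCohomology.coindIso
    (Rep.trivial k (semidirectSubgroup φ A hA) k) n).toLinearEquiv.finrank_eq]
  refine (𝒦.coresolution hr hχ hker hind).finrank_groupCohomology _
    (𝒟.cosetFunctions φ A hA) (𝒟.cosetFunctions_injective φ A hA)
    (𝒦.exists_cosetFunctions_eq_iff_convolve_gradedOperator A hA hAgen) n

end KoszulDatum

end DifferenceSystem

/-! ### The invariant subgroups of `T` -/

namespace PAdicSpaceGroup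

open CategoryTheory
open scoped Matrix

variable {p x : ℕ} [Fact p.Prime]

instance neZero_pred : NeZero (p - 1) := ⟨(Nat.sub_pos_of_lt (Fact.out : p.Prime).one_lt).ne'⟩

variable (p x) in
/-- The automorphism `θ` as a `ℤ_p`-linear endomorphism. -/
def thetaLin : Module.End ℤ_[p] (T p x) where
  toFun := theta p x
  map_add' := map_add _
  map_smul' c t := by
    funext j
    by_cases h : j = 0
    · simp [theta, companionAut, h, Matrix.mulVec_smul]
    · simp [theta, h]

theorem thetaLin_apply (t : T p x) : thetaLin p x t = theta p x t := rfl

/-- The vectors of the standard basis of `T`. -/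
def unitVec (i : Fin (p ^ (x - 1)) × Fin (p - 1)) : T p x := Pi.single i.1 (Pi.single i.2 1)

theorem unitVec_apply (i : Fin (p ^ (x - 1)) × Fin (p - 1)) (j : Fin (p ^ (x - 1)))
    (s : Fin (p - 1)) : unitVec i j s = (if (j, s) = i then 1 else 0 : ℤ_[p]) := by
  obtain ⟨a, b⟩ := i
  by_cases h : j = a
  · subst h
    simp [unitVec, Pi.single_apply]
  · simp [unitVec, h]

theorem sum_smul_unitVec (t : T p x) : ∑ i, t i.1 i.2 • unitVec i = t := by
  funext j s
  simp [Finset.sum_apply, unitVec_apply]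

theorem thetaLin_single (j : Fin (p ^ (x - 1))) (v : K p) :
    thetaLin p x (Pi.single j v) =
      Pi.single (j + 1) (if j + 1 = 0 then companion p *ᵥ v else v) := by
  funext i
  rw [thetaLin_apply]
  simp only [theta, AddEquiv.coe_mk, Equiv.coe_fn_mk, companionAut]
  by_cases h : i = j + 1
  · subst h
    simp
  · have h' : i - 1 ≠ j := fun h' => h (by rw [← h', sub_add_cancel])
    simp [h, h']

theorem thetaLin_pow_single_zero (j : ℕ) (hj : j < p ^ (x - 1)) (v : K p) :
    (thetaLin p x ^ j) (Pi.single 0 v) = Pi.single ⟨j, hj⟩ v := by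
  induction j with
  | zero => rfl
  | succ j ih =>
    rw [pow_succ', Module.End.mul_apply, ih (by omega), thetaLin_single]
    have h1 : (⟨j, by omega⟩ : Fin (p ^ (x - 1))) + 1 = ⟨j + 1, hj⟩ := by
      apply Fin.ext
      rw [Fin.val_add]
      have : ((1 : Fin (p ^ (x - 1))) : ℕ) = 1 := by
        rw [Fin.coe_ofNat_eq_mod]
        exact Nat.mod_eq_of_lt (by omega)
      rw [this]
      exact Nat.mod_eq_of_lt hj
    rw [h1, if_neg]
    intro h
    simpa using congrArg Fin.val h

theorem thetaLin_pow_card_single_zero (v : K p) :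
    (thetaLin p x ^ p ^ (x - 1)) (Pi.single 0 v) = Pi.single 0 (companion p *ᵥ v) := by
  obtain ⟨n, hn⟩ : ∃ n, p ^ (x - 1) = n + 1 :=
    Nat.exists_eq_add_one.2 (pow_pos (Fact.out : p.Prime).pos _)
  have e : (thetaLin p x ^ p ^ (x - 1)) = thetaLin p x * thetaLin p x ^ n := by
    rw [← pow_succ']
    exact congrArg _ hn
  rw [e, Module.End.mul_apply, thetaLin_pow_single_zero n (by omega), thetaLin_single]
  have h1 : (⟨n, by omega⟩ : Fin (p ^ (x - 1))) + 1 = 0 := by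
    apply Fin.ext
    rw [Fin.val_add, Fin.coe_ofNat_eq_mod, Nat.add_mod_mod]
    change (n + 1) % _ = 0
    rw [← hn, Nat.mod_self]
  rw [h1, if_pos rfl]

theorem companion_mulVec_single (s : Fin (p - 1)) (i : Fin (p - 1)) :
    (companion p *ᵥ Pi.single s 1) i =
      if (s : ℕ) + 1 = p - 1 then -1 else if (i : ℕ) = s + 1 then 1 else 0 := by
  simp [companion]

theorem companion_mulVec_single_of_lt (s : ℕ) (hs : s + 1 < p - 1) :
    companion p *ᵥ Pi.single ⟨s, by omega⟩ 1 = Pi.single ⟨s + 1, hs⟩ 1 := by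
  funext i
  rw [companion_mulVec_single, if_neg (by simpa using hs.ne)]
  simp [Pi.single_apply, Fin.ext_iff]

theorem companion_mulVec_single_last :
    companion p *ᵥ Pi.single ⟨p - 2, by have := (Fact.out : p.Prime).two_le; omega⟩ 1 =
      fun _ => -1 := by
  funext i
  rw [companion_mulVec_single, if_pos]
  have := (Fact.out : p.Prime).two_le
  simp only
  omega

variable (p x) in
/-- The first vector of the standard basis, a generator of `T` as a module over `ℤ_p[θ]`. -/
def origin : T p x := unitVec 0

theorem pow_card_mul_origin (s : ℕ) (hs : s < p - 1) :
    (thetaLin p x ^ (p ^ (x - 1) * s)) (origin p x) = unitVec (0, ⟨s, hs⟩) := by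
  induction s with
  | zero => rfl
  | succ s ih =>
    rw [Nat.mul_succ, add_comm, pow_add, Module.End.mul_apply, ih (by omega)]
    simp only [unitVec]
    rw [thetaLin_pow_card_single_zero, companion_mulVec_single_of_lt s hs]

theorem pow_origin (j s : ℕ) (hj : j < p ^ (x - 1)) (hs : s < p - 1) :
    (thetaLin p x ^ (j + p ^ (x - 1) * s)) (origin p x) = unitVec (⟨j, hj⟩, ⟨s, hs⟩) := by
  rw [pow_add, Module.End.mul_apply, pow_card_mul_origin s hs]
  simp only [unitVec]
  rw [thetaLin_pow_single_zero j hj]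

theorem pow_last_origin (j : ℕ) (hj : j < p ^ (x - 1)) :
    (thetaLin p x ^ (j + p ^ (x - 1) * (p - 1))) (origin p x) =
      Pi.single ⟨j, hj⟩ (fun _ => -1) := by
  have h2 := (Fact.out : p.Prime).two_le
  have e : p ^ (x - 1) * (p - 1) = p ^ (x - 1) + p ^ (x - 1) * (p - 2) := by
    rw [show p - 1 = p - 2 + 1 by omega, Nat.mul_succ, add_comm]
  rw [e, pow_add, pow_add, Module.End.mul_apply, Module.End.mul_apply,
    pow_card_mul_origin (p - 2) (by omega)]
  simp only [unitVec]
  rw [thetaLin_pow_card_single_zero, companion_mulVec_single_last, thetaLin_pow_single_zero j hj]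

theorem eq_zero_of_apply_origin {α : Module.End ℤ_[p] (T p x)} (hα : Commute α (thetaLin p x))
    (h : α (origin p x) = 0) : α = 0 := by
  refine LinearMap.ext fun t => ?_
  rw [← sum_smul_unitVec t, map_sum, LinearMap.zero_apply]
  refine Finset.sum_eq_zero fun i _ => ?_
  obtain ⟨⟨j, hj⟩, ⟨s, hs⟩⟩ := i
  rw [map_smul, ← pow_origin j s hj hs, ← Module.End.mul_apply, (hα.pow_right _).eq,
    Module.End.mul_apply, h, map_zero, smul_zero]

theorem sum_pow_thetaLin : ∑ s ∈ Finset.range p, (thetaLin p x ^ p ^ (x - 1)) ^ s = 0 := by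
  have h2 := (Fact.out : p.Prime).two_le
  refine eq_zero_of_apply_origin ?_ ?_
  · exact Commute.sum_left _ _ _ fun s _ => ((Commute.refl _).pow_left _).pow_left _
  · obtain ⟨n, hn⟩ : ∃ n, p = n + 1 := ⟨p - 1, by omega⟩
    rw [show Finset.range p = Finset.range (p - 1 + 1) by congr; omega, Finset.sum_range_succ,
      LinearMap.add_apply, LinearMap.sum_apply, ← pow_mul]
    have h1 := pow_last_origin (p := p) (x := x) 0 (pow_pos (Fact.out : p.Prime).pos _)
    rw [zero_add] at h1
    rw [h1, Finset.sum_range]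
    simp only [← pow_mul]
    rw [Finset.sum_congr rfl fun (s : Fin (p - 1)) _ => pow_card_mul_origin s.1 s.2]
    funext j i
    have h0 : (⟨0, pow_pos (Fact.out : p.Prime).pos _⟩ : Fin (p ^ (x - 1))) = 0 := rfl
    rw [h0]
    by_cases hj : j = 0
    · subst hj
      simp [Finset.sum_apply, unitVec_apply]
    · simp [Finset.sum_apply, unitVec_apply, hj]

theorem thetaLin_pow_card : thetaLin p x ^ (p ^ (x - 1) * p) = 1 := by
  have h := geom_sum_mul (thetaLin p x ^ p ^ (x - 1)) p
  rw [sum_pow_thetaLin, zero_mul, ← pow_mul] at h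
  exact (sub_eq_zero.1 h.symm)

variable (p x) in
/-- The ring of endomorphisms of `T` generated by `θ`. -/
abbrev thetaRing : Subalgebra ℤ (Module.End ℤ_[p] (T p x)) := Algebra.adjoin ℤ {thetaLin p x}

theorem thetaLin_mem : thetaLin p x ∈ thetaRing p x := Algebra.subset_adjoin rfl

theorem commute_of_mem_thetaRing {α β : Module.End ℤ_[p] (T p x)} (hα : α ∈ thetaRing p x)
    (hβ : β ∈ thetaRing p x) : Commute α β :=
  Algebra.commute_of_mem_adjoin_singleton_of_commute hβ
    (Algebra.commute_of_mem_adjoin_self hα).symm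

theorem sub_one_mem : thetaLin p x - 1 ∈ thetaRing p x :=
  sub_mem thetaLin_mem (one_mem _)

theorem pow_sub_one_mem : thetaLin p x ^ p ^ (x - 1) - 1 ∈ thetaRing p x :=
  sub_mem (pow_mem thetaLin_mem _) (one_mem _)

theorem exists_pow_sub_one_mul_eq :
    ∃ κ ∈ thetaRing p x, (thetaLin p x ^ p ^ (x - 1) - 1) * κ = p := by
  set ω := thetaLin p x ^ p ^ (x - 1)
  have hm : ω ∈ thetaRing p x := pow_mem thetaLin_mem _
  refine ⟨0 - ∑ s ∈ Finset.range p, ∑ r ∈ Finset.range s, ω ^ r,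
    sub_mem (zero_mem _) (sum_mem fun s _ => sum_mem fun r _ => pow_mem hm r), ?_⟩
  rw [mul_sub, mul_zero, Finset.mul_sum]
  simp only [mul_geom_sum]
  rw [Finset.sum_sub_distrib, sum_pow_thetaLin]
  simp

theorem exists_sub_one_mul_eq : ∃ κ ∈ thetaRing p x, (thetaLin p x - 1) * κ = p := by
  obtain ⟨κ, hκ, h⟩ := exists_pow_sub_one_mul_eq (p := p) (x := x)
  refine ⟨(∑ r ∈ Finset.range (p ^ (x - 1)), thetaLin p x ^ r) * κ,
    mul_mem (sum_mem fun r _ => pow_mem thetaLin_mem r) hκ, ?_⟩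
  rw [← mul_assoc, mul_geom_sum, h]

theorem natCast_pow_apply (n : ℕ) (t : T p x) :
    ((p : Module.End ℤ_[p] (T p x)) ^ n) t = (p ^ n : ℤ_[p]) • t := by
  rw [← Nat.cast_pow, Module.End.natCast_apply, ← Nat.cast_pow, Nat.cast_smul_eq_nsmul]

theorem injective_of_mul_eq {α β : Module.End ℤ_[p] (T p x)} {n : ℕ} (h : β * α = p ^ n) :
    Function.Injective α := by
  refine (injective_iff_map_eq_zero α).2 fun t ht => ?_
  have h1 := LinearMap.congr_fun h t
  rw [Module.End.mul_apply, ht, map_zero, natCast_pow_apply] at h1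
  refine (smul_eq_zero.1 h1.symm).resolve_left (pow_ne_zero _ ?_)
  exact Nat.cast_ne_zero.2 (Fact.out : p.Prime).ne_zero

theorem sub_one_injective : Function.Injective ⇑(thetaLin p x - 1 : Module.End ℤ_[p] (T p x)) := by
  obtain ⟨κ, hκ, h⟩ := exists_sub_one_mul_eq (p := p) (x := x)
  refine injective_of_mul_eq (β := κ) (n := 1) ?_
  rw [(commute_of_mem_thetaRing hκ sub_one_mem).eq, h, pow_one]

variable (p x) in
/-- The sum of the coordinates modulo `p`. -/
def coordSum : T p x →+ ZMod p where
  toFun t := ∑ i : Fin (p ^ (x - 1)) × Fin (p - 1), PadicInt.toZMod (t i.1 i.2)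
  map_zero' := by simp
  map_add' := by simp [Finset.sum_add_distrib]

theorem coordSum_apply (t : T p x) : coordSum p x t = ∑ i : Fin (p ^ (x - 1)) × Fin (p - 1),
    PadicInt.toZMod (t i.1 i.2) := rfl

theorem coordSum_smul (c : ℤ_[p]) (t : T p x) :
    coordSum p x (c • t) = PadicInt.toZMod c * coordSum p x t := by
  simp [coordSum_apply, Finset.mul_sum]

theorem coordSum_unitVec (i) : coordSum p x (unitVec i) = 1 := by
  rw [coordSum_apply, Finset.sum_eq_single i]
  · simp [unitVec_apply]
  · intro j _ hj
    simp [unitVec_apply, hj]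
  · simp

theorem coordSum_pow_origin (n : ℕ) (hn : n < p ^ (x - 1) * p) :
    coordSum p x ((thetaLin p x ^ n) (origin p x)) = 1 := by
  have hq : 0 < p ^ (x - 1) := pow_pos (Fact.out : p.Prime).pos _
  have hp := (Fact.out : p.Prime).two_le
  rw [← Nat.mod_add_div n (p ^ (x - 1))]
  have h1 : n % p ^ (x - 1) < p ^ (x - 1) := Nat.mod_lt _ hq
  have h2 : n / p ^ (x - 1) < p := Nat.div_lt_of_lt_mul hn
  rcases lt_or_eq_of_le (Nat.le_sub_one_of_lt h2) with h | h
  · rw [pow_origin _ _ h1 h, coordSum_unitVec]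
  · rw [h, pow_last_origin _ h1, coordSum_apply, Fintype.sum_prod_type,
      Finset.sum_eq_single ⟨_, h1⟩]
    · simp [Nat.cast_sub (by omega : 1 ≤ p)]
    · intro j _ hj
      simp [hj]
    · simp

theorem coordSum_thetaLin (t : T p x) : coordSum p x (thetaLin p x t) = coordSum p x t := by
  have hp := (Fact.out : p.Prime).two_le
  conv_lhs => rw [← sum_smul_unitVec t]
  conv_rhs => rw [← sum_smul_unitVec t]
  simp only [map_sum, map_smul, coordSum_smul]
  refine Finset.sum_congr rfl fun i _ => ?_
  obtain ⟨⟨j, hj⟩, ⟨s, hs⟩⟩ := i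
  have hlt : j + p ^ (x - 1) * s + 1 < p ^ (x - 1) * p := by
    have h1 : p ^ (x - 1) * (s + 1 + 1) ≤ p ^ (x - 1) * p := Nat.mul_le_mul_left _ (by omega)
    have h2 : p ^ (x - 1) * (s + 1 + 1) = p ^ (x - 1) * s + p ^ (x - 1) + p ^ (x - 1) := by ring
    omega
  rw [← pow_origin j s hj hs, ← Module.End.mul_apply, ← pow_succ', coordSum_pow_origin _ hlt,
    coordSum_pow_origin _ (by omega)]

variable (p x) in
/-- The image of `(θ - 1) ^ m`. -/
def piPow (m : ℕ) : AddSubgroup (T p x) :=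
  (LinearMap.range ((thetaLin p x - 1) ^ m)).toAddSubgroup

theorem mem_piPow {m : ℕ} {t : T p x} :
    t ∈ piPow p x m ↔ ∃ s, ((thetaLin p x - 1) ^ m) s = t := Iff.rfl

theorem piPow_zero : piPow p x 0 = ⊤ := by
  ext t
  simp [mem_piPow]

theorem piPow_succ (m : ℕ) :
    piPow p x (m + 1) = (piPow p x m).map (thetaLin p x - 1).toAddMonoidHom := by
  ext t
  simp only [mem_piPow, AddSubgroup.mem_map, pow_succ', Module.End.mul_apply]
  simp

theorem pow_apply_sub_mem_piPow (n : ℕ) (t : T p x) :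
    (thetaLin p x ^ n) t - t ∈ piPow p x 1 := by
  refine mem_piPow.2 ⟨(∑ r ∈ Finset.range n, thetaLin p x ^ r) t, ?_⟩
  rw [pow_one, ← Module.End.mul_apply, mul_geom_sum]
  rfl

theorem unitVec_sub_origin_mem_piPow (i : Fin (p ^ (x - 1)) × Fin (p - 1)) :
    unitVec i - origin p x ∈ piPow p x 1 := by
  obtain ⟨⟨j, hj⟩, ⟨s, hs⟩⟩ := i
  rw [← pow_origin j s hj hs]
  exact pow_apply_sub_mem_piPow _ _

theorem smul_mem_piPow {m : ℕ} (c : ℤ_[p]) {t : T p x} (ht : t ∈ piPow p x m) :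
    c • t ∈ piPow p x m :=
  Submodule.smul_mem _ c ht

theorem p_smul_mem_piPow_one (t : T p x) : (p : ℤ_[p]) • t ∈ piPow p x 1 := by
  obtain ⟨κ, -, hκ⟩ := exists_sub_one_mul_eq (p := p) (x := x)
  refine mem_piPow.2 ⟨κ t, ?_⟩
  rw [pow_one, ← Module.End.mul_apply, hκ, Module.End.natCast_apply, Nat.cast_smul_eq_nsmul]

theorem ker_coordSum : (coordSum p x).ker = piPow p x 1 := by
  ext t
  rw [AddMonoidHom.mem_ker]
  constructor
  · intro h
    obtain ⟨c, hc⟩ : ∃ c : ℤ_[p], c * p = ∑ i : Fin (p ^ (x - 1)) × Fin (p - 1), t i.1 i.2 := by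
      rw [← Ideal.mem_span_singleton', ← PadicInt.maximalIdeal_eq_span_p, ← PadicInt.ker_toZMod,
        RingHom.mem_ker, map_sum, ← coordSum_apply, h]
    have ht : t = ∑ i, t i.1 i.2 • (unitVec i - origin p x) + (p : ℤ_[p]) • c • origin p x := by
      simp only [smul_sub]
      rw [Finset.sum_sub_distrib, sum_smul_unitVec, ← Finset.sum_smul, ← hc, mul_comm, mul_smul,
        sub_add_cancel]
    rw [ht]
    exact add_mem (sum_mem fun i _ => smul_mem_piPow _ (unitVec_sub_origin_mem_piPow i))
      (p_smul_mem_piPow_one _)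
  · rintro ⟨s, rfl⟩
    rw [pow_one, LinearMap.sub_apply, map_sub, coordSum_thetaLin, Module.End.one_apply, sub_self]

theorem index_piPow_one : (piPow p x 1).index = p := by
  rw [← ker_coordSum, AddSubgroup.index_ker]
  have : (coordSum p x).range = ⊤ := by
    rw [AddMonoidHom.range_eq_top]
    intro c
    refine ⟨c.val • origin p x, ?_⟩
    rw [map_nsmul, origin, coordSum_unitVec]
    simp
  rw [this]
  simp

theorem index_map_sub_one (N : AddSubgroup (T p x)) :
    (N.map (thetaLin p x - 1).toAddMonoidHom).index = N.index * p := by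
  rw [AddSubgroup.index_map]
  have h1 : (thetaLin p x - 1).toAddMonoidHom.ker = ⊥ :=
    (AddMonoidHom.ker_eq_bot_iff _).2 sub_one_injective
  have h2 : (thetaLin p x - 1).toAddMonoidHom.range = piPow p x 1 := by
    ext t
    rw [mem_piPow, pow_one]
    rfl
  rw [h1, h2, sup_bot_eq, index_piPow_one]

theorem index_piPow (m : ℕ) : (piPow p x m).index = p ^ m := by
  induction m with
  | zero => rw [piPow_zero, AddSubgroup.index_top, pow_zero]
  | succ m ih => rw [piPow_succ, index_map_sub_one, ih, pow_succ]

theorem exists_sub_one_pow_eq :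
    ∃ β : Module.End ℤ_[p] (T p x), (thetaLin p x - 1) ^ p ^ (x - 1 + 1) = p * β := by
  obtain ⟨r, hr⟩ := (Commute.one_right (thetaLin p x - 1)).exists_add_pow_prime_pow_eq
    (Fact.out : p.Prime) (x - 1 + 1)
  have hone : thetaLin p x ^ p ^ (x - 1 + 1) = 1 := by rw [pow_succ, thetaLin_pow_card]
  rw [sub_add_cancel, hone, one_pow, mul_one, add_right_comm, right_eq_add] at hr
  refine ⟨0 - (thetaLin p x - 1) * r, ?_⟩
  rw [mul_sub, mul_zero, ← mul_assoc, zero_sub, ← add_eq_zero_iff_eq_neg, hr]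

theorem sup_range_pow_eq_top {S M : Type*} [Ring S] [AddCommGroup M] [Module S M]
    {π : Module.End S M} {N : AddSubgroup M} (hN : ∀ t ∈ N, π t ∈ N)
    (h : N ⊔ (LinearMap.range π).toAddSubgroup = ⊤) (j : ℕ) :
    N ⊔ (LinearMap.range (π ^ j)).toAddSubgroup = ⊤ := by
  have hpow : ∀ i, ∀ t ∈ N, (π ^ i) t ∈ N := by
    intro i t ht
    induction i with
    | zero => exact ht
    | succ i ih => exact pow_succ' π i ▸ hN _ ih
  induction j with
  | zero => exact top_unique fun t _ => AddSubgroup.mem_sup_right ⟨t, rfl⟩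
  | succ j ih =>
    rw [eq_top_iff, ← ih]
    refine sup_le le_sup_left ?_
    rintro _ ⟨s, rfl⟩
    obtain ⟨n, hn, _, ⟨s', rfl⟩, rfl⟩ := AddSubgroup.mem_sup.1 (h ▸ AddSubgroup.mem_top s)
    rw [map_add]
    exact add_mem (AddSubgroup.mem_sup_left (hpow j n hn)) (AddSubgroup.mem_sup_right ⟨s', rfl⟩)

theorem isCoatom_of_prime_index {G : Type*} [AddGroup G] {N : AddSubgroup G}
    (hN : N.index.Prime) : IsCoatom N := by
  refine ⟨fun h => hN.ne_one (AddSubgroup.index_eq_one.2 h), fun N' hlt => ?_⟩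
  have hmul := AddSubgroup.relIndex_mul_index hlt.le
  rcases (Nat.dvd_prime hN).1 (AddSubgroup.index_dvd_of_le hlt.le) with h | h
  · exact AddSubgroup.index_eq_one.1 h
  · rw [h] at hmul
    exact absurd (AddSubgroup.relIndex_eq_one.1 ((Nat.mul_eq_right hN.ne_zero).1 hmul)) hlt.not_ge

theorem eq_top_of_sup_piPow_one_eq_top {N : AddSubgroup (T p x)}
    (hN : ∀ t ∈ N, thetaLin p x t ∈ N) {m : ℕ} (hi : N.index = p ^ m)
    (h : N ⊔ piPow p x 1 = ⊤) : N = ⊤ := by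
  obtain ⟨β, hβ⟩ := exists_sub_one_pow_eq (p := p) (x := x)
  have hc : Commute (p : Module.End ℤ_[p] (T p x)) β := Nat.cast_commute p β
  rw [piPow, pow_one] at h
  have htop := sup_range_pow_eq_top (fun t ht => N.sub_mem (hN t ht) ht) h (p ^ (x - 1 + 1) * m)
  rw [← htop, left_eq_sup]
  rintro _ ⟨s, rfl⟩
  rw [pow_mul, hβ, hc.mul_pow, Module.End.mul_apply, ← Nat.cast_pow,
    Module.End.natCast_apply, ← hi]
  exact N.nsmul_index_mem _

theorem le_piPow_one {N : AddSubgroup (T p x)} (hN : ∀ t ∈ N, thetaLin p x t ∈ N)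
    {m : ℕ} (hi : N.index = p ^ (m + 1)) : N ≤ piPow p x 1 := by
  have hp := (Fact.out : p.Prime)
  have hcoatom : IsCoatom (piPow p x 1) := isCoatom_of_prime_index (by rwa [index_piPow_one])
  refine (hcoatom.le_iff.1 le_sup_right).elim (fun h => ?_) (sup_eq_right.1 ·)
  rw [eq_top_of_sup_piPow_one_eq_top hN hi h, AddSubgroup.index_top] at hi
  exact absurd hi.symm (Nat.one_lt_pow m.succ_ne_zero hp.one_lt).ne'

theorem eq_piPow (m : ℕ) : ∀ N : AddSubgroup (T p x),
    (∀ t ∈ N, thetaLin p x t ∈ N) → N.index = p ^ m → N = piPow p x m := by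
  induction m with
  | zero =>
    intro N _ hi
    rw [pow_zero, AddSubgroup.index_eq_one] at hi
    rw [hi, piPow_zero]
  | succ m ih =>
    intro N hN hi
    have hle := le_piPow_one hN hi
    let N₁ := N.comap (thetaLin p x - 1).toAddMonoidHom
    have h1 : N₁.map (thetaLin p x - 1).toAddMonoidHom = N := by
      refine le_antisymm (AddSubgroup.map_comap_le _ _) fun t ht => ?_
      obtain ⟨s, rfl⟩ := mem_piPow.1 (hle ht)
      rw [pow_one] at ht ⊢
      exact ⟨s, ht, rfl⟩
    have h2 : N₁.index = p ^ m := by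
      have h3 := index_map_sub_one N₁
      rw [h1, hi, pow_succ] at h3
      exact (Nat.eq_of_mul_eq_mul_right (Fact.out : p.Prime).pos h3).symm
    rw [piPow_succ, ← ih N₁ (fun t ht => ?_) h2, h1]
    have h4 := hN _ ht
    change (thetaLin p x - 1) (thetaLin p x t) ∈ N
    rw [← Module.End.mul_apply, (commute_of_mem_thetaRing sub_one_mem thetaLin_mem).eq]
    exact h4

theorem map_theta_eq {N : AddSubgroup (T p x)} :
    N.map (theta p x).toAddMonoidHom = N ↔
      (∀ t ∈ N, thetaLin p x t ∈ N) ∧ ∀ t, thetaLin p x t ∈ N → t ∈ N := by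
  constructor
  · intro h
    refine ⟨fun t ht => ?_, fun t ht => ?_⟩
    · rw [← h]
      exact ⟨t, ht, rfl⟩
    · rw [← h] at ht
      obtain ⟨s, hs, hst⟩ := ht
      rwa [← (theta p x).injective hst]
  · rintro ⟨h1, h2⟩
    refine le_antisymm ?_ fun t ht => ?_
    · rintro _ ⟨t, ht, rfl⟩
      exact h1 t ht
    · refine ⟨(theta p x).symm t, h2 _ ?_, (theta p x).apply_symm_apply t⟩
      rw [thetaLin_apply, AddEquiv.apply_symm_apply]
      exact ht

theorem map_theta_piPow (m : ℕ) :
    (piPow p x m).map (theta p x).toAddMonoidHom = piPow p x m := by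
  have hc : ∀ t, thetaLin p x (((thetaLin p x - 1) ^ m) t) =
      ((thetaLin p x - 1) ^ m) (thetaLin p x t) := LinearMap.congr_fun
    (commute_of_mem_thetaRing thetaLin_mem (pow_mem sub_one_mem m)).eq
  refine map_theta_eq.2 ⟨?_, ?_⟩
  · rintro _ ⟨t, rfl⟩
    exact ⟨thetaLin p x t, (hc t).symm⟩
  · rintro t ⟨s, hs⟩
    refine ⟨(theta p x).symm s, (theta p x).injective ?_⟩
    rw [← thetaLin_apply, hc, thetaLin_apply, AddEquiv.apply_symm_apply, hs]
    rfl

theorem existsUnique_invariantSubgroup (m : ℕ) :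
    ∃! N : InvariantSubgroup p x, N.1.index = p ^ m := by
  refine ⟨⟨piPow p x m, map_theta_piPow m⟩, index_piPow m, fun N hN => Subtype.ext ?_⟩
  exact eq_piPow m N.1 (map_theta_eq.1 N.2).1 hN

variable (p x) in
/-- Reduction of the coordinates modulo `p`, the quotient map of `T` modulo `p T`. -/
def reduce : T p x →+ (Fin (p ^ (x - 1)) → Fin (p - 1) → ZMod p) where
  toFun t j s := PadicInt.toZMod (t j s)
  map_zero' := by ext; simp
  map_add' s t := by ext; simp

theorem mem_ker_reduce {t : T p x} : t ∈ (reduce p x).ker ↔ ∃ s, t = (p : ℤ_[p]) • s := by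
  constructor
  · intro h
    have hdvd : ∀ j s, ∃ c, c * (p : ℤ_[p]) = t j s := by
      intro j s
      rw [← Ideal.mem_span_singleton', ← PadicInt.maximalIdeal_eq_span_p, ← PadicInt.ker_toZMod]
      exact congrFun (congrFun h j) s
    choose c hc using hdvd
    exact ⟨c, funext₂ fun j s => (hc j s).symm.trans (mul_comm _ _)⟩
  · rintro ⟨s, rfl⟩
    ext
    simp [reduce]

theorem index_ker_reduce : (reduce p x).ker.index = p ^ dim p x := by
  have hs : Function.Surjective (reduce p x) := fun c =>
    ⟨fun j s => ((c j s).val : ℤ_[p]), by ext; simp [reduce]⟩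
  rw [AddSubgroup.index_ker, AddMonoidHom.range_eq_top.2 hs]
  simp [dim, pow_mul]

theorem mem_piPow_dim {t : T p x} : t ∈ piPow p x (dim p x) ↔ ∃ s, t = (p : ℤ_[p]) • s := by
  rw [← eq_piPow _ _ (fun t ht => ?_) index_ker_reduce, mem_ker_reduce]
  obtain ⟨s, rfl⟩ := mem_ker_reduce.1 ht
  exact mem_ker_reduce.2 ⟨thetaLin p x s, map_smul _ _ _⟩

/-! ### The point group and the characters of `T` -/

instance commGroupPoint : CommGroup (P p x) where
  mul_comm := by
    rintro ⟨_, m, rfl⟩ ⟨_, n, rfl⟩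
    exact Subtype.ext ((Commute.refl (thetaMul p x)).zpow_zpow m n).eq

instance decidableEqPoint : DecidableEq (P p x) := Classical.decEq _

variable (p x) in
/-- The generator `θ` of the point group. -/
def gen : P p x := ⟨thetaMul p x, Subgroup.mem_zpowers _⟩

theorem gen_pow_apply (n : ℕ) (t : T p x) :
    Multiplicative.toAdd ((gen p x ^ n).1 (Multiplicative.ofAdd t)) = (thetaLin p x ^ n) t := by
  induction n with
  | zero => rfl
  | succ n ih =>
    rw [pow_succ', pow_succ', Module.End.mul_apply, ← ih]
    rfl

theorem gen_pow_card : gen p x ^ p ^ (x - 1 + 1) = 1 := by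
  refine Subtype.ext (MulEquiv.ext fun t => ?_)
  have h := gen_pow_apply (p := p) (x := x) (p ^ (x - 1 + 1)) (Multiplicative.toAdd t)
  rw [pow_succ, thetaLin_pow_card] at h
  exact h

theorem gen_pow_card_div_ne_one : gen p x ^ p ^ (x - 1) ≠ 1 := by
  intro h
  have hθ : thetaLin p x ^ p ^ (x - 1) = 1 := LinearMap.ext fun t => by
    rw [← gen_pow_apply, h]
    rfl
  have hsum := sum_pow_thetaLin (p := p) (x := x)
  simp only [hθ, one_pow, Finset.sum_const, Finset.card_range, nsmul_one] at hsum
  have hp : (p : ℤ_[p]) = 0 := by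
    simpa [origin, unitVec_apply] using congrFun₂ (LinearMap.congr_fun hsum (origin p x)) 0 0
  exact (Fact.out : p.Prime).ne_zero (Nat.cast_eq_zero.1 hp)

theorem orderOf_gen : orderOf (gen p x) = p ^ (x - 1 + 1) :=
  orderOf_eq_prime_pow gen_pow_card_div_ne_one gen_pow_card

instance fintypePoint : Fintype (P p x) := by
  have h : IsOfFinOrder (thetaMul p x) := by
    refine isOfFinOrder_iff_pow_eq_one.2 ⟨p ^ (x - 1 + 1), pow_pos (Fact.out : p.Prime).pos _, ?_⟩
    exact congrArg Subtype.val (gen_pow_card (p := p) (x := x))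
  have := (finite_zpowers.2 h).to_subtype
  exact Fintype.ofFinite _

theorem exists_gen_pow (g : P p x) :
    ∃ j s, j < p ^ (x - 1) ∧ s < p ∧ g = gen p x ^ (j + p ^ (x - 1) * s) := by
  have hg : g ∈ Subgroup.zpowers (gen p x) := by
    obtain ⟨_, m, rfl⟩ := g
    exact ⟨m, rfl⟩
  obtain ⟨n, hn, rfl⟩ := Finset.mem_image.1 (mem_zpowers_iff_mem_range_orderOf.1 hg)
  rw [Finset.mem_range, orderOf_gen, pow_succ] at hn
  exact ⟨n % p ^ (x - 1), n / p ^ (x - 1), Nat.mod_lt _ (pow_pos (Fact.out : p.Prime).pos _),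
    Nat.div_lt_of_lt_mul hn, by rw [Nat.mod_add_div]⟩

variable (p x) in
/-- The action of the point group on the translation group. -/
def pointRep : P p x →* Module.End ℤ_[p] (T p x) where
  toFun g :=
    { toFun := fun t => Multiplicative.toAdd (g.1 (Multiplicative.ofAdd t))
      map_add' := fun s t => map_mul g.1 _ _
      map_smul' := fun c t => by
        obtain ⟨j, s, -, -, rfl⟩ := exists_gen_pow g
        rw [gen_pow_apply, gen_pow_apply]
        exact map_smul _ _ _ }
  map_one' := rfl
  map_mul' _ _ := rfl

theorem pointRep_gen_pow (n : ℕ) : pointRep p x (gen p x ^ n) = thetaLin p x ^ n :=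
  LinearMap.ext fun t => gen_pow_apply n t

theorem pointRep_mem (g : P p x) : pointRep p x g ∈ thetaRing p x := by
  obtain ⟨j, s, -, -, rfl⟩ := exists_gen_pow g
  rw [pointRep_gen_pow]
  exact pow_mem thetaLin_mem _

variable (p x) in
/-- The element of order `p` of the point group. -/
def psi : P p x := gen p x ^ p ^ (x - 1)

variable (p x) in
/-- The index set of the standard basis of `T`. -/
abbrev Idx : Type := Fin (p ^ (x - 1)) ×ₗ Fin (p - 1)

/-- The element of the point group which sends `origin` to a vector of the standard basis. -/
def idxElt (i : Idx p x) : P p x :=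
  gen p x ^ ((ofLex i).1.1 + p ^ (x - 1) * (ofLex i).2.1)

theorem pointRep_idxElt (i : Idx p x) :
    pointRep p x (idxElt i) (origin p x) = unitVec (ofLex i) := by
  rw [idxElt, pointRep_gen_pow, pow_origin _ _ (ofLex i).1.2 (ofLex i).2.2]

/-- The coordinates of `T`, modulo `p`. -/
def coordMod (i : Fin (p ^ (x - 1)) × Fin (p - 1)) : T p x →+ ZMod p where
  toFun t := PadicInt.toZMod (t i.1 i.2)
  map_zero' := by simp
  map_add' := by simp

theorem coordMod_apply (i : Fin (p ^ (x - 1)) × Fin (p - 1)) (t : T p x) :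
    coordMod i t = PadicInt.toZMod (t i.1 i.2) := rfl

theorem exists_eq_natCast_add (n : ℕ) (a : ℤ_[p]) : ∃ (m : ℕ) (b : ℤ_[p]), a = m + p ^ n * b := by
  obtain ⟨b, hb⟩ := Ideal.mem_span_singleton'.1 (PadicInt.appr_spec n a)
  exact ⟨a.appr n, b, by rw [mul_comm, hb]; ring⟩

theorem map_p_smul (f : T p x →+ ZMod p) (t : T p x) : f ((p : ℤ_[p]) • t) = 0 := by
  rw [Nat.cast_smul_eq_nsmul, map_nsmul]
  simp

theorem map_padic_smul (f : T p x →+ ZMod p) (a : ℤ_[p]) (t : T p x) :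
    f (a • t) = PadicInt.toZMod a * f t := by
  obtain ⟨m, b, rfl⟩ := exists_eq_natCast_add 1 a
  rw [add_smul, map_add, pow_one, mul_smul, map_p_smul, Nat.cast_smul_eq_nsmul, map_nsmul]
  simp

theorem gen_pow_eq_one_iff {j s : ℕ} (hj : j < p ^ (x - 1)) (hs : s < p) :
    gen p x ^ (j + p ^ (x - 1) * s) = 1 ↔ j = 0 ∧ s = 0 := by
  rw [← orderOf_dvd_iff_pow_eq_one, orderOf_gen, pow_succ]
  constructor
  · intro h
    have hlt : j + p ^ (x - 1) * s < p ^ (x - 1) * p := by nlinarith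
    have h0 := Nat.eq_zero_of_dvd_of_lt h hlt
    rw [Nat.add_eq_zero_iff, Nat.mul_eq_zero] at h0
    exact ⟨h0.1, h0.2.resolve_left (by omega)⟩
  · rintro ⟨rfl, rfl⟩
    exact dvd_zero _

theorem gen_pow_mul_psi_eq_one_iff {j s : ℕ} (hj : j < p ^ (x - 1)) (hs : s < p) :
    gen p x ^ (j + p ^ (x - 1) * s) * psi p x = 1 ↔ j = 0 ∧ s = p - 1 := by
  rw [psi, ← pow_add, ← orderOf_dvd_iff_pow_eq_one, orderOf_gen, pow_succ, add_assoc,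
    ← Nat.mul_succ]
  constructor
  · intro h
    have hdvd : p ^ (x - 1) ∣ j :=
      (Nat.dvd_add_left (dvd_mul_right _ _)).1 ((dvd_mul_right _ _).trans h)
    obtain rfl := Nat.eq_zero_of_dvd_of_lt hdvd hj
    rw [zero_add] at h
    have hle := Nat.le_of_dvd s.succ_pos (Nat.dvd_of_mul_dvd_mul_left hj h)
    exact ⟨rfl, by omega⟩
  · rintro ⟨rfl, rfl⟩
    rw [zero_add, Nat.succ_eq_add_one, Nat.sub_add_cancel (by omega)]

theorem coordMod_zero_pow_origin {j s : ℕ} (hj : j < p ^ (x - 1)) (hs : s < p) :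
    coordMod 0 ((thetaLin p x ^ (j + p ^ (x - 1) * s)) (origin p x)) =
      (if j = 0 ∧ s = 0 then 1 else 0) - (if j = 0 ∧ s = p - 1 then 1 else 0) := by
  have hp := (Fact.out : p.Prime).two_le
  rcases lt_or_eq_of_le (Nat.le_sub_one_of_lt hs) with h | rfl
  · rw [pow_origin j s hj h, coordMod_apply, unitVec_apply]
    simp [Prod.ext_iff, Fin.ext_iff, h.ne, eq_comm, apply_ite]
  · rw [pow_last_origin j hj, coordMod_apply]
    by_cases hj0 : j = 0
    · subst hj0
      have h0 : (⟨0, hj⟩ : Fin (p ^ (x - 1))) = 0 := rfl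
      simp [h0, show p - 1 ≠ 0 by omega]
    · have hne : (0 : Fin (p ^ (x - 1))) ≠ ⟨j, hj⟩ := fun h => hj0 (congrArg Fin.val h).symm
      simp [hne, hj0]

theorem coordMod_origin (g : P p x) :
    coordMod 0 (pointRep p x g (origin p x)) =
      (if g = 1 then 1 else 0) - (if g * psi p x = 1 then 1 else 0) := by
  obtain ⟨j, s, hj, hs, rfl⟩ := exists_gen_pow g
  rw [pointRep_gen_pow, coordMod_zero_pow_origin hj hs]
  simp only [gen_pow_eq_one_iff hj hs, gen_pow_mul_psi_eq_one_iff hj hs]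

variable (p x) in
/-- The action of the point group on the characters of `T` modulo `p`. -/
def dualRep : Representation (ZMod p) (P p x) (T p x →+ ZMod p) where
  toFun g :=
    { toFun := fun f => f.comp (pointRep p x g⁻¹).toAddMonoidHom
      map_add' := fun _ _ => rfl
      map_smul' := fun _ _ => rfl }
  map_one' := by
    ext f t
    simp
  map_mul' g h := by
    refine LinearMap.ext fun f => AddMonoidHom.ext fun t => ?_
    change f (pointRep p x (g * h)⁻¹ t) = f (pointRep p x h⁻¹ (pointRep p x g⁻¹ t))
    rw [mul_inv_rev, map_mul, Module.End.mul_apply]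

variable (p x) in
/-- A homomorphism from `T` to `𝔽_p` is given by its values at the standard basis. -/
def dualEquiv : (T p x →+ ZMod p) ≃ₗ[ZMod p] (Idx p x → ZMod p) where
  toFun f i := f (unitVec (ofLex i))
  map_add' _ _ := rfl
  map_smul' _ _ := rfl
  invFun c := ∑ i : Idx p x, c i • coordMod (ofLex i)
  left_inv f := by
    refine AddMonoidHom.ext fun t => ?_
    conv_rhs => rw [← sum_smul_unitVec t]
    rw [map_sum, AddMonoidHom.finsetSum_apply]
    refine Fintype.sum_equiv ofLex _ _ fun i => ?_
    rw [map_padic_smul, mul_comm]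
    rfl
  right_inv c := by
    funext i
    change (∑ i : Idx p x, c i • coordMod (ofLex i)) (unitVec (ofLex i)) = c i
    rw [AddMonoidHom.finsetSum_apply, Finset.sum_eq_single i]
    · simp [coordMod_apply, unitVec_apply]
    · intro j _ hj
      have : ¬ ofLex j = ofLex i := fun h => hj (ofLex.injective h)
      simp [coordMod_apply, unitVec_apply, this]
    · simp

variable (p x) in
/-- The characters of `T` modulo `p`, with the orbit of the first coordinate and the evaluations at
the orbit of `origin`. -/
def differenceSystem : DifferenceSystem (ZMod p) (P p x) (T p x →+ ZMod p) (Idx p x) where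
  ρ := dualRep p x
  ψ := psi p x
  e h := dualRep p x h (coordMod 0)
  ev h :=
    { toFun := fun f => f (pointRep p x h (origin p x))
      map_add' := fun _ _ => rfl
      map_smul' := fun _ _ => rfl }
  l := idxElt
  basis := Module.Basis.ofEquivFun (dualEquiv p x)
  ρ_e g h := by rw [map_mul, Module.End.mul_apply]
  ev_ρ g h := by
    ext f
    change f (pointRep p x g⁻¹ (pointRep p x (g * h) (origin p x))) =
      f (pointRep p x h (origin p x))
    rw [← Module.End.mul_apply, ← map_mul, inv_mul_cancel_left]
  ev_e y h := by
    change coordMod _ (pointRep p x h⁻¹ (pointRep p x y (origin p x))) = _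
    rw [← Module.End.mul_apply, ← map_mul, coordMod_origin, mul_assoc]
    simp only [inv_mul_eq_one]
  basis_repr i f := by
    change f (unitVec (ofLex i)) = f (pointRep p x (idxElt i) (origin p x))
    rw [pointRep_idxElt]

/-! ### The lattice of integral vectors -/

variable (p x) in
/-- The vectors with integer coordinates, a dense lattice in `T` whose group ring is a domain of
Laurent polynomials. -/
def intLattice : AddSubgroup (T p x) where
  carrier := {t | ∀ j s, ∃ m : ℤ, t j s = m}
  zero_mem' _ _ := ⟨0, by simp⟩
  add_mem' ha hb j s := by
    obtain ⟨m, hm⟩ := ha j s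
    obtain ⟨n, hn⟩ := hb j s
    exact ⟨m + n, by simp [hm, hn]⟩
  neg_mem' ha j s := by
    obtain ⟨m, hm⟩ := ha j s
    exact ⟨-m, by simp [hm]⟩

theorem unitVec_mem_intLattice (i) : unitVec i ∈ intLattice p x := fun j s => by
  rw [unitVec_apply]
  split_ifs
  exacts [⟨1, by simp⟩, ⟨0, by simp⟩]

theorem exists_sum_zsmul_unitVec {t : T p x} (ht : t ∈ intLattice p x) :
    ∃ m : Fin (p ^ (x - 1)) × Fin (p - 1) → ℤ, t = ∑ i, m i • unitVec i := by
  choose m hm using ht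
  refine ⟨fun i => m i.1 i.2, ?_⟩
  conv_lhs => rw [← sum_smul_unitVec t]
  simp only [hm, Int.cast_smul_eq_zsmul]

theorem pow_origin_mem_intLattice (n : ℕ) (hn : n < p ^ (x - 1) * p) :
    (thetaLin p x ^ n) (origin p x) ∈ intLattice p x := by
  have hq : 0 < p ^ (x - 1) := pow_pos (Fact.out : p.Prime).pos _
  rw [← Nat.mod_add_div n (p ^ (x - 1))]
  have h1 : n % p ^ (x - 1) < p ^ (x - 1) := Nat.mod_lt _ hq
  have h2 : n / p ^ (x - 1) < p := Nat.div_lt_of_lt_mul hn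
  rcases lt_or_eq_of_le (Nat.le_sub_one_of_lt h2) with h | h
  · rw [pow_origin _ _ h1 h]
    exact unitVec_mem_intLattice _
  · rw [h, pow_last_origin _ h1]
    intro j s
    by_cases hj : j = ⟨n % p ^ (x - 1), h1⟩
    · subst hj
      exact ⟨-1, by simp⟩
    · exact ⟨0, by simp [hj]⟩

theorem thetaLin_mem_intLattice {t : T p x} (ht : t ∈ intLattice p x) :
    thetaLin p x t ∈ intLattice p x := by
  have hp := (Fact.out : p.Prime).two_le
  obtain ⟨m, rfl⟩ := exists_sum_zsmul_unitVec ht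
  rw [map_sum]
  refine sum_mem fun i _ => ?_
  rw [map_zsmul]
  refine zsmul_mem ?_ _
  obtain ⟨⟨j, hj⟩, ⟨s, hs⟩⟩ := i
  have hlt : j + p ^ (x - 1) * s + 1 < p ^ (x - 1) * p := by
    have h1 : p ^ (x - 1) * (s + 1 + 1) ≤ p ^ (x - 1) * p := Nat.mul_le_mul_left _ (by omega)
    have h2 : p ^ (x - 1) * (s + 1 + 1) = p ^ (x - 1) * s + p ^ (x - 1) + p ^ (x - 1) := by ring
    omega
  rw [← pow_origin j s hj hs, ← Module.End.mul_apply, ← pow_succ']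
  exact pow_origin_mem_intLattice _ hlt

theorem apply_mem_intLattice {α : Module.End ℤ_[p] (T p x)} (hα : α ∈ thetaRing p x) :
    ∀ {t : T p x}, t ∈ intLattice p x → α t ∈ intLattice p x := by
  induction hα using Algebra.adjoin_induction with
  | mem _ h =>
    obtain rfl := h
    exact thetaLin_mem_intLattice
  | algebraMap m =>
    intro t ht
    have : algebraMap ℤ (Module.End ℤ_[p] (T p x)) m t = m • t := by simp
    rw [this]
    exact zsmul_mem ht m
  | add _ _ _ _ hα hβ => exact fun ht => add_mem (hα ht) (hβ ht)
  | mul _ _ _ _ hα hβ => exact fun ht => hα (hβ ht)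

variable (p x) in
/-- The group of vectors with integer coordinates, written multiplicatively. -/
abbrev MulLat : Type := Multiplicative (intLattice p x)

/-- The action of an element of the ring generated by `θ` on the vectors with integer
coordinates. -/
def latEnd (α : thetaRing p x) : AddMonoid.End (intLattice p x) :=
  (α.1.toAddMonoidHom.comp (intLattice p x).subtype).codRestrict _
    fun t => apply_mem_intLattice α.2 t.2

variable (p x) in
/-- The action of the point group on the vectors with integer coordinates. -/
def latAut : P p x →* MulAut (MulLat p x) := mulAutOfAddEnd
  { toFun := fun g => latEnd ⟨pointRep p x g, pointRep_mem g⟩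
    map_one' := by
      refine AddMonoidHom.ext fun t => Subtype.ext ?_
      exact LinearMap.congr_fun (map_one (pointRep p x)) t.1
    map_mul' := fun g h => by
      refine AddMonoidHom.ext fun t => Subtype.ext ?_
      exact LinearMap.congr_fun (map_mul (pointRep p x) g h) t.1 }

/-- The underlying vector. -/
def MulLat.vec (t : MulLat p x) : T p x := (Multiplicative.toAdd t : intLattice p x)

theorem MulLat.vec_injective : Function.Injective (MulLat.vec (p := p) (x := x)) :=
  fun _ _ h => Subtype.ext h

theorem MulLat.vec_div (s t : MulLat p x) : (s / t).vec = s.vec - t.vec := rfl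

/-- The action of an element of the ring generated by `θ`, written multiplicatively. -/
def latHom (α : thetaRing p x) : MulLat p x →* MulLat p x :=
  AddMonoidHom.toMultiplicative (latEnd α)

theorem vec_latHom (α : thetaRing p x) (t : MulLat p x) : (latHom α t).vec = α.1 t.vec := rfl

theorem vec_latAut (g : P p x) (t : MulLat p x) : (latAut p x g t).vec = pointRep p x g t.vec := rfl

/-- The standard basis, as integral vectors. -/
def latVec (i : Idx p x) : MulLat p x :=
  Multiplicative.ofAdd ⟨unitVec (ofLex i), unitVec_mem_intLattice _⟩

theorem closure_latVec : Subgroup.closure (Set.range (latVec (p := p) (x := x))) = ⊤ := by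
  refine (Subgroup.eq_top_iff' _).2 fun t => ?_
  obtain ⟨m, hm⟩ := exists_sum_zsmul_unitVec (Multiplicative.toAdd t).2
  have h : t = ∏ i : Idx p x, latVec i ^ m (ofLex i) := by
    apply Multiplicative.toAdd.injective
    apply Subtype.ext
    rw [hm, toAdd_prod, AddSubgroup.val_finsetSum]
    exact (Fintype.sum_equiv ofLex _ _ fun i => rfl).symm
  rw [h]
  exact Subgroup.prod_mem _ fun i _ =>
    zpow_mem (Subgroup.subset_closure (Set.mem_range_self i)) _

theorem range_eq_closure_latVec {G : Type*} [Group G] (F : MulLat p x →* G) :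
    F.range = Subgroup.closure (Set.range fun i => (F (latVec i))⁻¹) := by
  rw [MonoidHom.range_eq_map, ← closure_latVec, MonoidHom.map_closure, ← Subgroup.closure_inv,
    ← Set.range_comp]
  congr 1
  ext y
  simp [inv_eq_iff_eq_inv, eq_comm]

/-- An element of the ring generated by `θ` is an isogeny if it divides a power of `p`. -/
def IsIsogeny (α : thetaRing p x) : Prop :=
  ∃ (β : thetaRing p x) (n : ℕ), α.1 * β.1 = (p : Module.End ℤ_[p] (T p x)) ^ n

theorem thetaRing_commute (α β : thetaRing p x) : Commute α.1 β.1 :=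
  commute_of_mem_thetaRing α.2 β.2

theorem IsIsogeny.one : IsIsogeny (1 : thetaRing p x) :=
  ⟨1, 0, by simp⟩

theorem IsIsogeny.mul {α β : thetaRing p x} (hα : IsIsogeny α) (hβ : IsIsogeny β) :
    IsIsogeny (α * β) := by
  obtain ⟨α', m, hm⟩ := hα
  obtain ⟨β', n, hn⟩ := hβ
  refine ⟨β' * α', n + m, ?_⟩
  have hc : Commute (p : Module.End ℤ_[p] (T p x)) α.1 := Nat.cast_commute p _
  calc α.1 * β.1 * (β'.1 * α'.1) = α.1 * (β.1 * β'.1) * α'.1 := by simp only [mul_assoc]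
    _ = _ := by rw [hn, ← (hc.pow_left n).eq, mul_assoc, hm, pow_add]

theorem IsIsogeny.pow {α : thetaRing p x} (hα : IsIsogeny α) (n : ℕ) : IsIsogeny (α ^ n) := by
  induction n with
  | zero => rw [pow_zero]; exact .one
  | succ n ih => rw [pow_succ]; exact ih.mul hα

theorem IsIsogeny.injective {α : thetaRing p x} (hα : IsIsogeny α) : Function.Injective α.1 := by
  obtain ⟨β, n, h⟩ := hα
  exact injective_of_mul_eq ((thetaRing_commute β α).eq.trans h)

theorem IsIsogeny.natCast : IsIsogeny (p : thetaRing p x) :=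
  ⟨1, 1, by simp⟩

variable (p x) in
/-- The element `θ - 1`. -/
def piElt : thetaRing p x := ⟨thetaLin p x - 1, sub_one_mem⟩

variable (p x) in
/-- The element `ψ - 1`. -/
def psiElt : thetaRing p x := ⟨thetaLin p x ^ p ^ (x - 1) - 1, pow_sub_one_mem⟩

theorem isIsogeny_piElt : IsIsogeny (piElt p x) := by
  obtain ⟨κ, hκ, h⟩ := exists_sub_one_mul_eq (p := p) (x := x)
  exact ⟨⟨κ, hκ⟩, 1, by rw [pow_one]; exact h⟩

theorem isIsogeny_psiElt : IsIsogeny (psiElt p x) := by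
  obtain ⟨κ, hκ, h⟩ := exists_pow_sub_one_mul_eq (p := p) (x := x)
  exact ⟨⟨κ, hκ⟩, 1, by rw [pow_one]; exact h⟩

theorem natCast_apply (t : T p x) : ((p : thetaRing p x) : Module.End ℤ_[p] (T p x)) t =
    (p : ℤ_[p]) • t := by
  have h := natCast_pow_apply 1 t
  rw [pow_one, pow_one] at h
  exact h

theorem pointRep_psi : pointRep p x (psi p x) = (psiElt p x).1 + 1 := by
  rw [psi, pointRep_gen_pow, psiElt, sub_add_cancel]

/-- The image of `T` under an element of the ring generated by `θ`. -/
def image (α : thetaRing p x) : AddSubgroup (T p x) := (LinearMap.range α.1).toAddSubgroup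

theorem mem_image {α : thetaRing p x} {t : T p x} : t ∈ image α ↔ ∃ s, α.1 s = t := Iff.rfl

theorem apply_mem_image {α : thetaRing p x} (β : thetaRing p x) {t : T p x} (ht : t ∈ image α) :
    β.1 t ∈ image α := by
  obtain ⟨s, rfl⟩ := ht
  exact ⟨β.1 s, LinearMap.congr_fun (thetaRing_commute α β).eq s⟩

theorem IsIsogeny.exists_pow_smul_mem {α : thetaRing p x} (hα : IsIsogeny α) :
    ∃ n : ℕ, ∀ t : T p x, (p ^ n : ℤ_[p]) • t ∈ image α := by
  obtain ⟨β, n, h⟩ := hα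
  refine ⟨n, fun t => ⟨β.1 t, ?_⟩⟩
  rw [← natCast_pow_apply, ← h]
  rfl

theorem IsIsogeny.finite_quotient {α : thetaRing p x} (hα : IsIsogeny α) :
    Finite (T p x ⧸ image α) := by
  obtain ⟨n, hn⟩ := hα.exists_pow_smul_mem
  obtain ⟨β, hβ⟩ := exists_sub_one_pow_eq (p := p) (x := x)
  have hle : piPow p x (p ^ (x - 1 + 1) * n) ≤ image α := by
    rintro _ ⟨s, rfl⟩
    have hc : Commute (p : Module.End ℤ_[p] (T p x)) β := Nat.cast_commute p β
    rw [pow_mul, hβ, hc.mul_pow, Module.End.mul_apply, natCast_pow_apply]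
    exact hn _
  have : (image α).FiniteIndex := by
    have h : (piPow p x (p ^ (x - 1 + 1) * n)).FiniteIndex :=
      ⟨by rw [index_piPow]; exact pow_ne_zero _ (Fact.out : p.Prime).ne_zero⟩
    exact AddSubgroup.finiteIndex_of_le hle
  exact AddSubgroup.finite_quotient_of_finiteIndex

theorem IsIsogeny.exists_intLattice_add {α : thetaRing p x} (hα : IsIsogeny α) (t : T p x) :
    ∃ a ∈ intLattice p x, ∃ b ∈ image α, t = a + b := by
  obtain ⟨n, hn⟩ := hα.exists_pow_smul_mem
  have h : ∀ j s, ∃ (m : ℕ) (b : ℤ_[p]), t j s = m + p ^ n * b :=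
    fun j s => exists_eq_natCast_add n (t j s)
  choose m b hb using h
  refine ⟨fun j s => m j s, fun j s => ⟨m j s, by simp⟩, (p ^ n : ℤ_[p]) • b, hn _, ?_⟩
  funext j s
  exact hb j s

theorem mem_intLattice_of_pow_smul {n : ℕ} {t : T p x}
    (h : (p ^ n : ℤ_[p]) • t ∈ intLattice p x) : t ∈ intLattice p x := by
  intro j s
  obtain ⟨m, hm⟩ := h j s
  have h1 : (p ^ n : ℤ_[p]) * t j s = m := hm
  have hp : (p ^ n : ℤ_[p]) ≠ 0 := pow_ne_zero _ (Nat.cast_ne_zero.2 (Fact.out : p.Prime).ne_zero)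
  have h2 : ((p : ℤ) ^ n) ∣ m := by
    have h3 : ‖(m : ℤ_[p])‖ ≤ (p : ℝ) ^ (-n : ℤ) := by
      rw [PadicInt.norm_le_pow_iff_mem_span_pow, ← h1]
      exact Ideal.mul_mem_right _ _ (Ideal.mem_span_singleton_self _)
    exact_mod_cast (PadicInt.norm_int_le_pow_iff_dvd).1 h3
  obtain ⟨c, rfl⟩ := h2
  exact ⟨c, mul_left_cancel₀ hp (by rw [h1]; push_cast; rfl)⟩

variable (p x) in
/-- The vector `origin`, as a vector with integer coordinates. -/
def latOrigin : MulLat p x := Multiplicative.ofAdd ⟨origin p x, unitVec_mem_intLattice _⟩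

theorem vec_latOrigin : (latOrigin p x).vec = origin p x := rfl

theorem pointRep_idxElt_mul_psi (i : Idx p x) :
    pointRep p x (idxElt i * psi p x) (origin p x) =
      (psiElt p x).1 (unitVec (ofLex i)) + unitVec (ofLex i) := by
  rw [mul_comm, map_mul, Module.End.mul_apply, pointRep_idxElt, pointRep_psi]
  rfl

theorem latAut_div (α : thetaRing p x) (i : Idx p x) :
    latAut p x (idxElt i) (latHom α (latOrigin p x)) /
      latAut p x (idxElt i * psi p x) (latHom α (latOrigin p x)) =
      (latHom (α * psiElt p x) (latVec i))⁻¹ := by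
  have hc : ∀ (g : P p x) t, pointRep p x g (α.1 t) = α.1 (pointRep p x g t) := fun g =>
    LinearMap.congr_fun (commute_of_mem_thetaRing (pointRep_mem g) α.2).eq
  apply MulLat.vec_injective
  rw [MulLat.vec_div, vec_latAut, vec_latAut, vec_latHom, vec_latOrigin, hc, hc, pointRep_idxElt,
    pointRep_idxElt_mul_psi, map_add, sub_add_cancel_right]
  rfl

theorem latHom_one (t : MulLat p x) : latHom (1 : thetaRing p x) t = t := rfl

theorem latAut_origin_div (i : Idx p x) :
    latAut p x (idxElt i) (latOrigin p x) / latAut p x (idxElt i * psi p x) (latOrigin p x) =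
      (latHom (psiElt p x) (latVec i))⁻¹ := by
  have h := latAut_div 1 i
  rwa [one_mul, latHom_one] at h

theorem latHom_natCast_mul_mem_closure (δ : thetaRing p x) :
    latHom ((p : thetaRing p x) * δ) (latOrigin p x) ∈ Subgroup.closure (Set.range fun g : P p x =>
      latAut p x g (latOrigin p x) / latAut p x (g * psi p x) (latOrigin p x)) := by
  obtain ⟨κ, hκ, h⟩ := exists_pow_sub_one_mul_eq (p := p) (x := x)
  have h1 : latHom ((p : thetaRing p x) * δ) (latOrigin p x) =
      latHom (psiElt p x) (latHom (⟨κ, hκ⟩ * δ) (latOrigin p x)) := by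
    apply MulLat.vec_injective
    change (p * δ.1) (origin p x) = ((thetaLin p x ^ p ^ (x - 1) - 1) * (κ * δ.1)) (origin p x)
    rw [← mul_assoc, h]
  have h2 : latHom ((p : thetaRing p x) * δ) (latOrigin p x) ∈ (latHom (psiElt p x)).range :=
    h1 ▸ ⟨_, rfl⟩
  rw [range_eq_closure_latVec] at h2
  refine Subgroup.closure_mono ?_ h2
  rintro _ ⟨i, rfl⟩
  exact ⟨idxElt i, latAut_origin_div i⟩

/-- The quotient of `T` by the image of `α`, written multiplicatively. -/
abbrev TQuot (α : thetaRing p x) : Type := Multiplicative (T p x ⧸ image α)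

/-- The action of the point group on the quotient of `T` by the image of `α`. -/
def quotAut (α : thetaRing p x) : P p x →* MulAut (TQuot α) := mulAutOfAddEnd
  { toFun := fun g => QuotientAddGroup.map _ _ (pointRep p x g).toAddMonoidHom
      fun _ ht => apply_mem_image ⟨pointRep p x g, pointRep_mem g⟩ ht
    map_one' := by
      refine AddMonoidHom.ext fun t => ?_
      induction t using QuotientAddGroup.induction_on
      rfl
    map_mul' := fun g h => by
      refine AddMonoidHom.ext fun t => ?_
      induction t using QuotientAddGroup.induction_on
      rfl }

/-- The projection of `T` to its quotient by the image of `α`, written multiplicatively. -/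
def quotMk (α : thetaRing p x) : Multiplicative (T p x) →* TQuot α :=
  AddMonoidHom.toMultiplicative (QuotientAddGroup.mk' (image α))

theorem quotMk_eq_one {α : thetaRing p x} {t : T p x} :
    quotMk α (Multiplicative.ofAdd t) = 1 ↔ t ∈ image α :=
  QuotientAddGroup.eq_zero_iff t

variable (p x) in
/-- The inclusion of the vectors with integer coordinates. -/
def latIncl : MulLat p x →* Multiplicative (T p x) :=
  AddMonoidHom.toMultiplicative (intLattice p x).subtype

theorem latIncl_apply (t : MulLat p x) : latIncl p x t = Multiplicative.ofAdd t.vec := rfl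

/-- The homomorphism which sends `t` to the class of `β t` modulo the image of `α`. -/
def quotHom (α β : thetaRing p x) : Multiplicative (T p x) →* TQuot α :=
  (quotMk α).comp (AddMonoidHom.toMultiplicative β.1.toAddMonoidHom)

theorem IsIsogeny.range_quotHom_latIncl {α : thetaRing p x} (hα : IsIsogeny α) (β : thetaRing p x) :
    ((quotHom α β).comp (latIncl p x)).range = (quotHom α β).range := by
  refine le_antisymm ?_ ?_
  · rintro _ ⟨t, rfl⟩
    exact ⟨_, rfl⟩
  · rintro _ ⟨t, rfl⟩
    obtain ⟨a, ha, b, hb, hab⟩ := hα.exists_intLattice_add (Multiplicative.toAdd t)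
    refine ⟨Multiplicative.ofAdd ⟨a, ha⟩, ?_⟩
    have h1 : t = Multiplicative.ofAdd a * Multiplicative.ofAdd b := hab
    have h2 : quotHom α β (Multiplicative.ofAdd b) = 1 :=
      quotMk_eq_one.2 (apply_mem_image β hb)
    rw [h1, map_mul, h2, mul_one]
    rfl

theorem IsIsogeny.surjective_quotMk_latIncl {α : thetaRing p x} (hα : IsIsogeny α) :
    Function.Surjective ((quotMk α).comp (latIncl p x)) := by
  have h := hα.range_quotHom_latIncl 1
  have h1 : quotHom α 1 = quotMk α := rfl
  rw [h1] at h
  rw [← MonoidHom.range_eq_top, h, MonoidHom.range_eq_top]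
  intro y
  obtain ⟨t, ht⟩ := QuotientAddGroup.mk_surjective (Multiplicative.toAdd y)
  exact ⟨Multiplicative.ofAdd t, ht⟩

theorem IsIsogeny.ker_quotMk_latIncl {α : thetaRing p x} (hα : IsIsogeny α) :
    ((quotMk α).comp (latIncl p x)).ker = (latHom α).range := by
  ext t
  rw [MonoidHom.mem_ker, MonoidHom.comp_apply, latIncl_apply, quotMk_eq_one]
  constructor
  · rintro ⟨s, hs⟩
    obtain ⟨β, n, h⟩ := hα
    have h1 : s ∈ intLattice p x := by
      refine mem_intLattice_of_pow_smul (n := n) ?_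
      rw [← natCast_pow_apply, ← h, (thetaRing_commute α β).eq, Module.End.mul_apply, hs]
      exact apply_mem_intLattice β.2 (Multiplicative.toAdd t).2
    exact ⟨Multiplicative.ofAdd ⟨s, h1⟩, MulLat.vec_injective hs⟩
  · rintro ⟨s, rfl⟩
    exact ⟨s.vec, rfl⟩

/-- The coordinate with index `i` of `β t`. -/
def coordHom (β : thetaRing p x) (i : Idx p x) : MulLat p x →* Multiplicative ℤ_[p] where
  toFun t := Multiplicative.ofAdd (β.1 t.vec (ofLex i).1 (ofLex i).2)
  map_one' := congrFun₂ (map_zero β.1) _ _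
  map_mul' _ _ := congrFun₂ (map_add β.1 _ _) _ _

theorem coordHom_latHom_latVec {α β : thetaRing p x} {n : ℕ}
    (h : α.1 * β.1 = (p : Module.End ℤ_[p] (T p x)) ^ n) (i j : Idx p x) :
    coordHom β i (latHom α (latVec j)) =
      Multiplicative.ofAdd (if j = i then (p : ℤ_[p]) ^ n else 0) := by
  have hβ : β.1 (α.1 (unitVec (ofLex j))) = (p ^ n : ℤ_[p]) • unitVec (ofLex j) := by
    rw [← natCast_pow_apply, ← h, (thetaRing_commute α β).eq]
    rfl
  change Multiplicative.ofAdd (β.1 (α.1 (unitVec (ofLex j))) (ofLex i).1 (ofLex i).2) = _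
  rw [hβ]
  congr 1
  simp only [Pi.smul_apply, unitVec_apply, Prod.mk.eta, ofLex_inj, smul_eq_mul, mul_ite, mul_one,
    mul_zero, eq_comm (a := i)]

theorem IsIsogeny.isIndependentFamily {α : thetaRing p x} (hα : IsIsogeny α) :
    IsIndependentFamily fun i => (latHom α (latVec i))⁻¹ := by
  intro s i hi m hm
  obtain ⟨β, n, h⟩ := hα
  have hker : Subgroup.closure ((fun i => (latHom α (latVec i))⁻¹) '' (s : Set (Idx p x))) ≤
      (coordHom β i).ker := by
    rw [Subgroup.closure_le]
    rintro _ ⟨j, hj, rfl⟩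
    have hji : j ≠ i := fun h => hi (h ▸ hj)
    change coordHom β i _ = 1
    rw [map_inv, coordHom_latHom_latVec h, if_neg hji]
    simp
  have hone : coordHom β i _ = 1 := hker hm
  rw [map_zpow, map_inv, coordHom_latHom_latVec h, if_pos rfl, ← ofAdd_neg, ← ofAdd_zsmul] at hone
  have hzero : m • -((p : ℤ_[p]) ^ n) = 0 := hone
  have hp : (p : ℤ_[p]) ^ n ≠ 0 := pow_ne_zero _ (Nat.cast_ne_zero.2 (Fact.out : p.Prime).ne_zero)
  exact (smul_eq_zero.1 hzero).resolve_right (neg_ne_zero.2 hp)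

/-! ### The quotients of the space group -/

theorem augmentation_mul_ev_sub_eq_zero {δ : thetaRing p x}
    {c : P p x → MonoidAlgebra (ZMod p) (MulLat p x)}
    (hc : ∑ g, c g * (single (latAut p x g (latOrigin p x)) 1 -
      single (latAut p x (g * psi p x) (latOrigin p x)) 1) =
        single (latHom ((p : thetaRing p x) * δ) (latOrigin p x)) 1 - 1)
    (h : P p x) (f : T p x →+ ZMod p) :
    ∑ g, augmentation (ZMod p) (MulLat p x) (c g) * ((differenceSystem p x).ev (h * g) f -
      (differenceSystem p x).ev (h * (g * psi p x)) f) = 0 := by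
  let F : Additive (MulLat p x) →+ ZMod p :=
    (f.comp (pointRep p x h).toAddMonoidHom).comp
      ((intLattice p x).subtype.comp
        (AddEquiv.additiveMultiplicative (intLattice p x)).toAddMonoidHom)
  have hF (g : P p x) : F (Additive.ofMul (latAut p x g (latOrigin p x))) =
      (differenceSystem p x).ev (h * g) f := by
    change f (pointRep p x h (pointRep p x g (origin p x))) = f (pointRep p x (h * g) (origin p x))
    rw [map_mul, Module.End.mul_apply]
  have hw : F (Additive.ofMul (latHom ((p : thetaRing p x) * δ) (latOrigin p x))) = 0 := by
    change f (pointRep p x h (((p : thetaRing p x) : Module.End ℤ_[p] (T p x))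
      (δ.1 (origin p x)))) = 0
    rw [natCast_apply, map_smul, map_p_smul]
  simpa only [hF, hw] using sum_augmentation_mul_sub_eq _ _ c hc F

/-- The Koszul datum on the integral lattice given by the orbits of `origin` and of
`p δ origin`. -/
def koszulDatum (δ : thetaRing p x) : (differenceSystem p x).KoszulDatum (MulLat p x) where
  χ := latAut p x
  z := latOrigin p x
  w := latHom ((p : thetaRing p x) * δ) (latOrigin p x)
  c := (exists_sum_mul_eq_single_sub_one _ _ (latHom_natCast_mul_mem_closure δ)).choose
  sum_mul_eq :=
    (exists_sum_mul_eq_single_sub_one _ _ (latHom_natCast_mul_mem_closure δ)).choose_spec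
  sum_augmentation_eq h := LinearMap.ext fun f => by
    have key := augmentation_mul_ev_sub_eq_zero (exists_sum_mul_eq_single_sub_one _ _
      (latHom_natCast_mul_mem_closure δ)).choose_spec h f
    simp only [mul_sub, Finset.sum_sub_distrib, sub_eq_zero] at key
    simp only [LinearMap.sum_apply, LinearMap.smul_apply, smul_eq_mul]
    refine key.trans (Finset.sum_congr rfl fun g _ => ?_)
    rw [mul_comm g, ← mul_assoc]
    rfl

theorem koszulDatum_difference_z (δ : thetaRing p x) :
    (koszulDatum δ).difference (koszulDatum δ).z =
      fun i => (latHom (psiElt p x) (latVec i))⁻¹ :=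
  funext latAut_origin_div

/-- The element `p δ (ψ - 1)`; its image is the subgroup by which `T` is divided. -/
def koszulElt (δ : thetaRing p x) : thetaRing p x := (p : thetaRing p x) * δ * psiElt p x

theorem koszulDatum_difference_w (δ : thetaRing p x) :
    (koszulDatum δ).difference (koszulDatum δ).w =
      fun i => (latHom (koszulElt δ) (latVec i))⁻¹ :=
  funext (latAut_div _)

theorem IsIsogeny.koszulElt {δ : thetaRing p x} (hδ : IsIsogeny δ) :
    IsIsogeny (koszulElt δ) :=
  (IsIsogeny.natCast.mul hδ).mul isIsogeny_psiElt

theorem quotAut_quotHom (α β : thetaRing p x) (g : P p x) (t : Multiplicative (T p x)) :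
    quotAut α g (quotHom α β t) =
      quotHom α β (Multiplicative.ofAdd (pointRep p x g t.toAdd)) :=
  congrArg (fun s => quotMk α (Multiplicative.ofAdd s))
    (LinearMap.congr_fun (commute_of_mem_thetaRing (pointRep_mem g) β.2).eq t.toAdd)

theorem quotAut_mem_range_quotHom (α β : thetaRing p x) (g : P p x) :
    ∀ a ∈ (quotHom α β).range, quotAut α g a ∈ (quotHom α β).range := by
  rintro _ ⟨t, rfl⟩
  exact ⟨_, (quotAut_quotHom α β g t).symm⟩

/-- The subgroup `ψ' T / α T ⋊ P` of `T / α T ⋊ P`, where `ψ' = ψ - 1` and `α = p δ ψ'`. -/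
abbrev modelGroup (δ : thetaRing p x) : Subgroup (TQuot (koszulElt δ) ⋊[quotAut _] P p x) :=
  semidirectSubgroup (quotAut (koszulElt δ)) (quotHom (koszulElt δ) (psiElt p x)).range
    (quotAut_mem_range_quotHom _ _)

variable (p x) in
/-- The dimension of the cohomology in degree `n` of the graded pieces of `Sym V ⊗ Λ V`, summed
over the pieces with the shift by their degree, where `V` is the dual of `T` modulo `p`. -/
def gradedDim (n : ℕ) : ℕ :=
  diagonalDim (fun n m => Module.finrank (ZMod p)
    (groupCohomology ((differenceSystem p x).gradedRep m) n)) n 0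

theorem finrank_H_modelGroup {δ : thetaRing p x} (hδ : IsIsogeny δ) (n : ℕ) :
    Module.finrank (ZMod p) (H p (modelGroup δ) n) = gradedDim p x n := by
  have hα := hδ.koszulElt
  have := hα.finite_quotient
  refine (koszulDatum δ).finrank_groupCohomology_semidirectSubgroup
    (r := (quotMk (koszulElt δ)).comp (latIncl p x)) (φ := quotAut (koszulElt δ))
    hα.surjective_quotMk_latIncl (fun g a => rfl) ?_ ?_ _ (quotAut_mem_range_quotHom _ _) ?_ n
  · rw [hα.ker_quotMk_latIncl, koszulDatum_difference_w, range_eq_closure_latVec]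
  · rw [koszulDatum_difference_w]
    exact hα.isIndependentFamily
  · rw [koszulDatum_difference_z, ← hα.range_quotHom_latIncl, range_eq_closure_latVec]
    simp only [map_inv]
    rfl

/-- The homomorphism from the space group induced by `t ↦ β t`. -/
def spaceHom (α β : thetaRing p x) : R p x →* TQuot α ⋊[quotAut α] P p x :=
  SemidirectProduct.map (quotHom α β) (MonoidHom.id _) fun g =>
    MonoidHom.ext fun t => (quotAut_quotHom α β g t).symm

theorem range_spaceHom (α β : thetaRing p x) : (spaceHom α β).range =
    semidirectSubgroup (quotAut α) (quotHom α β).range (quotAut_mem_range_quotHom _ _) := by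
  ext y
  constructor
  · rintro ⟨r, rfl⟩
    exact ⟨r.left, rfl⟩
  · rintro ⟨t, ht⟩
    exact ⟨⟨t, y.right⟩, SemidirectProduct.ext ht rfl⟩

theorem mem_image_iff_psiElt_apply_mem {δ : thetaRing p x} {t : T p x} :
    t ∈ image ((p : thetaRing p x) * δ) ↔ (psiElt p x).1 t ∈ image (koszulElt δ) := by
  rw [mem_image, mem_image]
  refine exists_congr fun s => ?_
  have hc : (koszulElt δ).1 s = (psiElt p x).1 (((p : thetaRing p x) * δ).1 s) :=
    LinearMap.congr_fun (thetaRing_commute ((p : thetaRing p x) * δ) (psiElt p x)).eq s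
  rw [hc]
  exact isIsogeny_psiElt.injective.eq_iff.symm

section Quotient

variable {δ : thetaRing p x} {N : InvariantSubgroup p x}

theorem inSpaceGroup_eq_ker_spaceHom (hN : N.1 = image ((p : thetaRing p x) * δ)) :
    N.inSpaceGroup = (spaceHom (koszulElt δ) (psiElt p x)).ker := by
  have hmem (t : T p x) : t ∈ N.1 ↔ (psiElt p x).1 t ∈ image (koszulElt δ) := by
    rw [hN, mem_image_iff_psiElt_apply_mem]
  ext y
  constructor
  · rintro ⟨t, ht, rfl⟩
    exact SemidirectProduct.ext (quotMk_eq_one.2 ((hmem _).1 ht)) rfl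
  · intro hy
    have hl : quotHom _ _ y.left = 1 := congrArg SemidirectProduct.left hy
    have hr : y.right = 1 := congrArg SemidirectProduct.right hy
    exact ⟨y.left, (hmem _).2 (quotMk_eq_one.1 hl), SemidirectProduct.ext rfl hr.symm⟩

/-- The identification of the quotient of the space group by `p δ T` with `modelGroup δ`. -/
def quotientEquiv (hN : N.1 = image ((p : thetaRing p x) * δ)) : N.Quotient ≃* modelGroup δ :=
  (QuotientGroup.quotientMulEquivOfEq (inSpaceGroup_eq_ker_spaceHom hN)).trans
    ((QuotientGroup.quotientKerEquivRange _).trans (MulEquiv.subgroupCongr (range_spaceHom _ _)))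

/-- The isomorphism of cohomology given by an isomorphism of groups. -/
def cohomologyEquiv {G G' : Type} [Group G] [Group G'] (e : G ≃* G') (n : ℕ) :
    H p G n ≃ₗ[ZMod p] H p G' n :=
  (groupCohomology.mapIso (A := Rep.trivial (ZMod p) G' (ZMod p))
    (B := Rep.trivial (ZMod p) G (ZMod p)) e (LinearEquiv.refl (ZMod p) (ZMod p))
    (fun _ => rfl) n).toLinearEquiv

theorem finite_H {G : Type} [Group G] [Finite G] (n : ℕ) : Module.Finite (ZMod p) (H p G n) := by
  have : Module.Finite (ZMod p) (Rep.trivial (ZMod p) G (ZMod p)) :=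
    inferInstanceAs (Module.Finite (ZMod p) (ZMod p))
  exact finite_groupCohomology _ n

theorem finite_modelGroup (hδ : IsIsogeny δ) : Finite (modelGroup δ) := by
  have := hδ.koszulElt.finite_quotient
  have := finite_semidirectProduct (quotAut (koszulElt δ))
  infer_instance

theorem nonempty_H_quotient_equiv {δ' : thetaRing p x} {N' : InvariantSubgroup p x}
    (hδ : IsIsogeny δ) (hδ' : IsIsogeny δ') (hN : N.1 = image ((p : thetaRing p x) * δ))
    (hN' : N'.1 = image ((p : thetaRing p x) * δ')) :
    Nonempty (∀ n : ℕ, H p N.Quotient n ≃ₗ[ZMod p] H p N'.Quotient n) := by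
  have := finite_modelGroup hδ
  have := finite_modelGroup hδ'
  refine ⟨fun n => ?_⟩
  have := finite_H (p := p) (G := modelGroup δ) n
  have := finite_H (p := p) (G := modelGroup δ') n
  have e : H p (modelGroup δ) n ≃ₗ[ZMod p] H p (modelGroup δ') n :=
    .ofFinrankEq _ _ ((finrank_H_modelGroup hδ n).trans (finrank_H_modelGroup hδ' n).symm)
  exact (cohomologyEquiv (quotientEquiv hN) n).trans
    (e.trans (cohomologyEquiv (quotientEquiv hN') n).symm)

theorem eq_image_of_index_eq {i : ℕ} (hN : N.1.index = p ^ (i + dim p x)) :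
    N.1 = image ((p : thetaRing p x) * piElt p x ^ i) := by
  rw [eq_piPow _ N.1 (map_theta_eq.1 N.2).1 hN]
  have hpi : (piElt p x ^ i).1 = (thetaLin p x - 1) ^ i := rfl
  have hc := LinearMap.congr_fun (thetaRing_commute (p : thetaRing p x) (piElt p x ^ i)).eq
  ext t
  rw [mem_piPow, mem_image, pow_add]
  constructor
  · rintro ⟨s, rfl⟩
    obtain ⟨s', hs'⟩ := mem_piPow_dim.1 ⟨s, rfl⟩
    refine ⟨s', (hc s').trans ?_⟩
    rw [Module.End.mul_apply, Module.End.mul_apply, natCast_apply, hpi, hs']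
  · rintro ⟨s, rfl⟩
    obtain ⟨s', hs'⟩ := mem_piPow_dim.2 ⟨s, rfl⟩
    refine ⟨s', Eq.trans ?_ (hc s).symm⟩
    rw [Module.End.mul_apply, Module.End.mul_apply, natCast_apply, hpi, ← hs']

end Quotient

end PAdicSpaceGroup

end

/-- For every `i` there is exactly one `θ`-invariant subgroup `N_i` of `T` of index
`p ^ (i + d_x)`, and `H^*(R / N_i; 𝔽_p)` and `H^*(R / N_0; 𝔽_p)` are isomorphic as graded
`𝔽_p`-modules. -/
theorem theorem1 (p x : ℕ) [Fact p.Prime] (hx : 1 ≤ x) :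
    (∀ i : ℕ, ∃! N : PAdicSpaceGroup.InvariantSubgroup p x,
      N.1.index = p ^ (i + PAdicSpaceGroup.dim p x)) ∧
    ∀ (i : ℕ) (N₀ Nᵢ : PAdicSpaceGroup.InvariantSubgroup p x),
      N₀.1.index = p ^ PAdicSpaceGroup.dim p x →
      Nᵢ.1.index = p ^ (i + PAdicSpaceGroup.dim p x) →
      Nonempty (∀ n : ℕ,
        PAdicSpaceGroup.H p Nᵢ.Quotient n ≃ₗ[ZMod p] PAdicSpaceGroup.H p N₀.Quotient n) := by
  refine ⟨fun i => PAdicSpaceGroup.existsUnique_invariantSubgroup _, fun i N₀ Nᵢ h₀ hᵢ => ?_⟩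
  rw [← zero_add (PAdicSpaceGroup.dim p x)] at h₀
  have hθ := PAdicSpaceGroup.isIsogeny_piElt (p := p) (x := x)
  exact PAdicSpaceGroup.nonempty_H_quotient_equiv (hθ.pow i) (hθ.pow 0)
    (PAdicSpaceGroup.eq_image_of_index_eq hᵢ) (PAdicSpaceGroup.eq_image_of_index_eq h₀)
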